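/- Let $\mathtt n\ge 1$ (type $B_\theta$ if $\mathtt n=2\theta+1$, type $D_\theta$ if $\mathtt n=2\theta$), let $N>7$ be odd with $\gcd(3,N)=1$, let $q\in\mathbb C$ be a primitive $N$-th root of unity, and let $q^{1/2}$ be the square root of $q$ with $q^{N/2}=(q^{1/2})^N=1$. For $1\le i\le \mathtt n$ put $i'=\mathtt n+1-i$; let $\rho_i=\mathtt n/2-i$ if $i<i'$, $\rho_i=-\rho_{i'}$ if $i>i'$, and $\rho_i=0$ if $i=i'$. Let $J=(c_{ij})$ with $c_{ij}=\delta_{i,j'}q^{-\rho_i}$ and $$R^{ij}_{ab}=q^{\delta_{ij}-\delta_{ij'}}\delta_{ia}\delta_{jb}+\mathsf u(i-a)(q-q^{-1})(\delta_{ja}\delta_{ib}-c_{ji}c_{ab}),$$ where $\mathsf u(x)=1$ if $x\ge 1$ and $\mathsf u(x)=0$ otherwise. Let $\mathcal O_q(B^+)$ be the $\mathbb C$-algebra generated by $z_{ij}$, $1\le i,j\le \mathtt n$, with $\mathbf z=(z_{ij})$, subject to the relations $\sum_{k,l}\big(R^{lk}_{ab}z_{ik}z_{jl}-R^{ji}_{kl}z_{ka}z_{lb}\big)=0$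 for all $i,j,a,b$; $\;\mathbf zJ\mathbf z^tJ^{-1}=1=J\mathbf z^tJ^{-1}\mathbf z$; $\;z_{ij}=0$ for $i>j$; and, if $\mathtt n$ is odd, $z_{\mathtt n_0\mathtt n_0}=1$, where $\mathtt n_0=(\mathtt n+1)/2$. It is a Hopf algebra with $\Delta(z_{ij})=\sum_k z_{ik}\otimes z_{kj}$, $\varepsilon(z_{ij})=\delta_{ij}$, $S(z_{ij})=q^{\rho_j-\rho_i}z_{j'i'}$. Let $\mathcal O(B^+)$ be the commutative $\mathbb C$-algebra generated by $X_{ij}$, $1\le i,j\le\mathtt n$, subject to $\sum_kX_{kj}X_{k'i'}=\delta_{ij}$ for all $i,j$, $\det X=1$, and $X_{ij}=0$ for $i>j$; it is a Hopf algebra with $\Delta(X_{ij})=\sum_kX_{ik}\otimes X_{kj}$, $\varepsilon(X_{ij})=\delta_{ij}$, $S(X_{ij})=X_{j'i'}$. Then there is a Hopf algebra homomorphism $\iota:\mathcal O(B^+)\to\mathcal O_q(B^+)$ which for all $i\le j$ is given by $$\iota(X_{ij})=\begin{cases}\dfrac{(1+q)^N}{2}\,z_{ij}^N,&\text{if $\mathtt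 n$ is odd and } i<\mathtt n_0<j,\\[.5em] z_{ij}^N,&\text{otherwise,}\end{cases}$$ and $\iota$ is injective. -/

import Mathlib

open scoped TensorProduct

noncomputable section

namespace QSO

/-! ### The data of the R-matrix of type B and D

Indices run over `Fin n`, so the `1`-based index `i` of the literature is `i.val + 1`, and the
involution `i ↦ i' = n + 1 - i` is `Fin.rev`.  The parameter `s` stands for `q ^ (1/2)`, thus
`q = s ^ 2`; powers of `s` are needed because `ρ_i` may be a half-integer. -/

section Coefficients

variable {n : ℕ}

/-- `twoRho i = 2 ρ_i`, where `ρ_i = n / 2 - i` (`i` counted from `1`) for `i < i'`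
and `ρ_{i'} = - ρ_i` for `i ≤ i'` (so `ρ_i = 0` if `i = i'`). -/
def twoRho (i : Fin n) : ℤ :=
  if i < i.rev then (n : ℤ) - 2 * ((i.val : ℤ) + 1)
  else if i.rev < i then -((n : ℤ) - 2 * ((i.rev.val : ℤ) + 1))
  else 0

/-- The matrix `J = (c_{ij})`, `c_{ij} = δ_{i,j'} q ^ (-ρ_i)`. -/
def metricJ (s : ℂˣ) : Matrix (Fin n) (Fin n) ℂ :=
  Matrix.of fun i j => if i = j.rev then (s : ℂ) ^ (-twoRho i) else 0

/-- The coefficient `R^{ij}_{ab}` of the orthogonal R-matrix (`ε = 1`). -/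
def coeffR (s : ℂˣ) (i j a b : Fin n) : ℂ :=
  ((s : ℂ) ^ 2) ^ ((if i = j then 1 else 0) - (if i = j.rev then 1 else 0) : ℤ)
      * (if i = a then 1 else 0) * (if j = b then 1 else 0)
    + (if a < i then 1 else 0) * ((s : ℂ) ^ 2 - ((s : ℂ) ^ 2)⁻¹)
      * ((if j = a then 1 else 0) * (if i = b then 1 else 0)
          - metricJ s j i * metricJ s a b)

lemma twoRho_rev (i : Fin n) : twoRho i.rev = -twoRho i := by
  unfold twoRho
  rw [Fin.rev_rev]
  rcases lt_trichotomy i i.rev with h | h | h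
  · rw [if_neg h.asymm, if_pos h, if_pos h]
  · have h1 : ¬ i < i.rev := fun h2 => (h2.ne h).elim
    have h2 : ¬ i.rev < i := fun h2 => (h2.ne h.symm).elim
    simp only [if_neg h1, if_neg h2, neg_zero]
  · rw [if_pos h, if_neg h.asymm, if_pos h, neg_neg]

lemma metricJ_mul_self (s : ℂˣ) : metricJ (n := n) s * metricJ s = 1 := by
  ext i k
  rw [Matrix.mul_apply, Finset.sum_eq_single i.rev]
  · by_cases h : i = k
    · subst h
      simp [metricJ, twoRho_rev, zpow_ne_zero _ s.ne_zero]
    · have h' : i.rev ≠ k.rev := fun e => h (Fin.rev_injective e)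
      simp [metricJ, Matrix.one_apply_ne h, h]
  · intro j _ hj
    have : i ≠ j.rev := fun e => hj (by rw [e, Fin.rev_rev])
    simp [metricJ, this]
  · simp

lemma metricJ_inv (s : ℂˣ) : (metricJ (n := n) s)⁻¹ = metricJ s :=
  Matrix.inv_eq_right_inv (metricJ_mul_self s)

end Coefficients

/-! ### The relations, for a matrix with entries in an arbitrary algebra -/

section Relations

variable {n : ℕ} {A : Type*} [Ring A] [Algebra ℂ A]

/-- The FRT element
`∑_{k,l} R^{lk}_{ab} z_{ik} z_{jl} - R^{ji}_{kl} z_{ka} z_{lb}`. -/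
def frt (s : ℂˣ) (z : Matrix (Fin n) (Fin n) A) (i b j a : Fin n) : A :=
  ∑ k, ∑ l, (coeffR s l k a b • (z i k * z j l) - coeffR s j i k l • (z k a * z l b))

/-- A complex matrix, seen as a matrix over the algebra `A`. -/
abbrev scal (A : Type*) [Ring A] [Algebra ℂ A] {ι : Type*} (M : Matrix ι ι ℂ) : Matrix ι ι A :=
  M.map (algebraMap ℂ A)

/-- The matrix `z J zᵗ J⁻¹`. -/
def metricL (s : ℂˣ) (z : Matrix (Fin n) (Fin n) A) : Matrix (Fin n) (Fin n) A :=
  z * scal A (metricJ s) * z.transpose * scal A (metricJ s)⁻¹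

/-- The matrix `J zᵗ J⁻¹`. -/
def metricInv (s : ℂˣ) (z : Matrix (Fin n) (Fin n) A) : Matrix (Fin n) (Fin n) A :=
  scal A (metricJ s) * z.transpose * scal A (metricJ s)⁻¹

end Relations

/-! ### The quantized function algebra of the Borel subgroup -/

/-- The generator `z_{ij}` of the free algebra `ℂ⟨z_{ij}⟩`, arranged in a matrix. -/
def freeZ (n : ℕ) : Matrix (Fin n) (Fin n) (FreeAlgebra ℂ (Fin n × Fin n)) :=
  Matrix.of fun i j => FreeAlgebra.ι ℂ (i, j)

/-- The relations `FRT(i,b,j,a) = 0`, `z J zᵗ J⁻¹ = 1` and `J zᵗ J⁻¹ z = 1`. -/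
inductive OrthRel (n : ℕ) (s : ℂˣ) :
    FreeAlgebra ℂ (Fin n × Fin n) → FreeAlgebra ℂ (Fin n × Fin n) → Prop
  | frt (i b j a : Fin n) : OrthRel n s (frt s (freeZ n) i b j a) 0
  | metric_left (i j : Fin n) :
      OrthRel n s (metricL s (freeZ n) i j) ((1 : Matrix (Fin n) (Fin n) _) i j)
  | metric_right (i j : Fin n) :
      OrthRel n s ((metricInv s (freeZ n) * freeZ n) i j) ((1 : Matrix (Fin n) (Fin n) _) i j)

/-- The relations of `O_q(B⁺)`: the orthogonal relations, `z_{ij} = 0` for `i > j`, and, when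
there is a middle index `n₀ = n₀'` (`n` odd), `z_{n₀ n₀} = 1`.  As `z_{ii} z_{i'i'} = 1` holds in
the triangular quotient, the last relation says `z_{11} z_{22} ⋯ z_{nn} = 1`: it is the special
orthogonal (determinant one) condition, which does not follow from the other relations. -/
inductive BorelRel (n : ℕ) (s : ℂˣ) :
    FreeAlgebra ℂ (Fin n × Fin n) → FreeAlgebra ℂ (Fin n × Fin n) → Prop
  | orth {x y} : OrthRel n s x y → BorelRel n s x y
  | tri (i j : Fin n) : j < i → BorelRel n s (freeZ n i j) 0
  | mid (i : Fin n) : i.rev = i → BorelRel n s (freeZ n i i) 1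

/-- The quantized function algebra `O_q(B⁺)` of the standard Borel subgroup of `SO_n`,
with `q = s ^ 2`. -/
def OqB (n : ℕ) (s : ℂˣ) : Type := RingQuot (BorelRel n s)

instance (n : ℕ) (s : ℂˣ) : Ring (OqB n s) := inferInstanceAs (Ring (RingQuot (BorelRel n s)))
instance (n : ℕ) (s : ℂˣ) : Algebra ℂ (OqB n s) :=
  inferInstanceAs (Algebra ℂ (RingQuot (BorelRel n s)))

/-- The projection of the free algebra onto `O_q(B⁺)`. -/
def OqB.mk (n : ℕ) (s : ℂˣ) : FreeAlgebra ℂ (Fin n × Fin n) →ₐ[ℂ] OqB n s :=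
  RingQuot.mkAlgHom ℂ (BorelRel n s)

/-- The matrix of generators `z_{ij}` of `O_q(B⁺)`. -/
def OqB.z (n : ℕ) (s : ℂˣ) : Matrix (Fin n) (Fin n) (OqB n s) := (freeZ n).map (OqB.mk n s)

/-! ### Matrices satisfying the relations -/

section Points

variable {n : ℕ} {A B : Type*} [Ring A] [Algebra ℂ A] [Ring B] [Algebra ℂ B] {s : ℂˣ}

/-- The matrix `z` satisfies all the defining relations of `O_q(B⁺)`. -/
structure IsPoint (s : ℂˣ) (z : Matrix (Fin n) (Fin n) A) : Prop where
  frt : ∀ i b j a, frt s z i b j a = 0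
  left : metricL s z = 1
  right : metricInv s z * z = 1
  tri : ∀ i j, j < i → z i j = 0
  mid : ∀ i : Fin n, i.rev = i → z i i = 1

lemma scal_map (f : A →ₐ[ℂ] B) {ι : Type*} (M : Matrix ι ι ℂ) :
    (scal A M).map f = scal B M := by
  ext i j; simp [scal]

lemma frt_map (f : A →ₐ[ℂ] B) (z : Matrix (Fin n) (Fin n) A) (i b j a : Fin n) :
    frt s (z.map f) i b j a = f (frt s z i b j a) := by
  simp [frt, map_sum]

lemma metricInv_map (f : A →ₐ[ℂ] B) (z : Matrix (Fin n) (Fin n) A) :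
    metricInv s (z.map f) = (metricInv s z).map f := by
  simp only [metricInv, Matrix.map_mul, scal_map, Matrix.transpose_map]

lemma metricL_eq (z : Matrix (Fin n) (Fin n) A) : metricL s z = z * metricInv s z := by
  simp only [metricL, metricInv, Matrix.mul_assoc]

lemma metricL_map (f : A →ₐ[ℂ] B) (z : Matrix (Fin n) (Fin n) A) :
    metricL s (z.map f) = (metricL s z).map f := by
  simp only [metricL_eq, metricInv_map, Matrix.map_mul]

lemma IsPoint.map {z : Matrix (Fin n) (Fin n) A} (h : IsPoint s z) (f : A →ₐ[ℂ] B) :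
    IsPoint s (z.map f) where
  frt i b j a := by rw [frt_map, h.frt, map_zero]
  left := by rw [metricL_map, h.left]; simp
  right := by rw [metricInv_map, ← Matrix.map_mul, h.right]; simp
  tri i j hij := by simp [h.tri i j hij]
  mid i hi := by simp [h.mid i hi]

lemma OqB.mk_rel {x y : FreeAlgebra ℂ (Fin n × Fin n)} (h : BorelRel n s x y) :
    OqB.mk n s x = OqB.mk n s y := RingQuot.mkAlgHom_rel ℂ h

lemma map_one_apply (f : A →ₐ[ℂ] B) (i j : Fin n) :
    f ((1 : Matrix (Fin n) (Fin n) A) i j) = (1 : Matrix (Fin n) (Fin n) B) i j := by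
  simp [Matrix.one_apply, apply_ite f]

lemma OqB.isPoint (n : ℕ) (s : ℂˣ) : IsPoint s (OqB.z n s) where
  frt i b j a := by rw [OqB.z, frt_map, OqB.mk_rel (.orth (.frt i b j a)), map_zero]
  left := by
    ext i j
    rw [OqB.z, metricL_map, Matrix.map_apply, OqB.mk_rel (.orth (.metric_left i j)), map_one_apply]
  right := by
    ext i j
    rw [OqB.z, metricInv_map, ← Matrix.map_mul, Matrix.map_apply,
      OqB.mk_rel (.orth (.metric_right i j)), map_one_apply]
  tri i j hij := by rw [OqB.z, Matrix.map_apply, OqB.mk_rel (.tri i j hij), map_zero]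
  mid i hi := by rw [OqB.z, Matrix.map_apply, OqB.mk_rel (.mid i hi), map_one]

/-- The universal property of `O_q(B⁺)`. -/
def OqB.lift (z : Matrix (Fin n) (Fin n) A) (h : IsPoint s z) : OqB n s →ₐ[ℂ] A :=
  RingQuot.liftAlgHom ℂ (s := BorelRel n s)
    ⟨FreeAlgebra.lift ℂ fun p => z p.1 p.2, by
      have hz : (freeZ n).map (FreeAlgebra.lift ℂ fun p => z p.1 p.2) = z := by
        ext i j; simp [freeZ]
      intro x y hxy
      induction hxy with
      | orth h' =>
        induction h' with
        | frt i b j a => rw [map_zero, ← frt_map, hz, h.frt]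
        | metric_left i j =>
          have := congrFun (congrFun (metricL_map (s := s)
            (FreeAlgebra.lift ℂ fun p : Fin n × Fin n => z p.1 p.2) (freeZ n)) i) j
          rw [hz, h.left, Matrix.map_apply] at this
          rw [← this, map_one_apply]
        | metric_right i j =>
          have := congrFun (congrFun (h.right) i) j
          rw [← hz, metricInv_map, ← Matrix.map_mul, Matrix.map_apply] at this
          rw [this, map_one_apply]
      | tri i j hij => simpa [freeZ] using h.tri i j hij
      | mid i hi => simpa [freeZ] using h.mid i hi⟩

@[simp] lemma OqB.lift_z (z : Matrix (Fin n) (Fin n) A) (h : IsPoint s z) (i j : Fin n) :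
    OqB.lift z h (OqB.z n s i j) = z i j := by
  refine (RingQuot.liftAlgHom_mkAlgHom_apply ..).trans ?_
  simp [freeZ]

lemma OqB.algHom_ext {f g : OqB n s →ₐ[ℂ] A}
    (h : ∀ i j, f (OqB.z n s i j) = g (OqB.z n s i j)) : f = g := by
  apply RingQuot.ringQuot_ext' (S := ℂ) (s := BorelRel n s)
  apply FreeAlgebra.hom_ext
  funext p
  exact h p.1 p.2

lemma OqB.induction {P : OqB n s → Prop} (hs : ∀ c, P (algebraMap ℂ _ c))
    (hz : ∀ i j, P (OqB.z n s i j)) (ha : ∀ x y, P x → P y → P (x + y))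
    (hm : ∀ x y, P x → P y → P (x * y)) (x : OqB n s) : P x := by
  obtain ⟨y, rfl⟩ := RingQuot.mkAlgHom_surjective ℂ (BorelRel n s) x
  induction y using FreeAlgebra.induction with
  | grade0 r => rw [AlgHom.commutes]; exact hs r
  | grade1 p => exact hz p.1 p.2
  | mul a b h1 h2 => rw [map_mul]; exact hm _ _ h1 h2
  | add a b h1 h2 => rw [map_add]; exact ha _ _ h1 h2

/-! ### Products and inverses of such matrices -/

/-- The matrix `(z ⊗ z)_{(i,j),(a,b)} = z_{ia} z_{jb}`. -/
def kron (z : Matrix (Fin n) (Fin n) A) : Matrix (Fin n × Fin n) (Fin n × Fin n) A :=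
  Matrix.of fun p r => z p.1 r.1 * z p.2 r.2

/-- The braiding matrix `(p, r) ↦ R^{p₂ p₁}_{r₁ r₂}`. -/
def braid (n : ℕ) (s : ℂˣ) : Matrix (Fin n × Fin n) (Fin n × Fin n) ℂ :=
  Matrix.of fun p r => coeffR s p.2 p.1 r.1 r.2

lemma frt_iff (z : Matrix (Fin n) (Fin n) A) :
    (∀ i b j a, frt s z i b j a = 0) ↔ scal A (braid n s) * kron z = kron z * scal A (braid n s) := by
  have key : ∀ i b j a, frt s z i b j a =
      (kron z * scal A (braid n s)) (i, j) (a, b) - (scal A (braid n s) * kron z) (i, j) (a, b) := by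
    intro i b j a
    simp only [frt, Matrix.mul_apply, Fintype.sum_prod_type, kron, scal, braid, Matrix.map_apply,
      Matrix.of_apply, Finset.sum_sub_distrib]
    congr 1
    · refine Finset.sum_congr rfl fun k _ => Finset.sum_congr rfl fun l _ => ?_
      rw [Algebra.smul_def, Algebra.commutes]
    · refine Finset.sum_congr rfl fun k _ => Finset.sum_congr rfl fun l _ => ?_
      rw [Algebra.smul_def]
  constructor
  · intro h
    ext ⟨i, j⟩ ⟨a, b⟩
    have := h i b j a
    rw [key, sub_eq_zero] at this
    exact this.symm
  · intro h i b j a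
    rw [key, h, sub_self]

lemma IsPoint.mul {z w : Matrix (Fin n) (Fin n) A} (hz : IsPoint s z) (hw : IsPoint s w)
    (hc : ∀ i j k l, Commute (z i j) (w k l)) : IsPoint s (z * w) := by
  have hk : kron (z * w) = kron z * kron w := by
    ext ⟨i, j⟩ ⟨a, b⟩
    simp only [kron, Matrix.mul_apply, Matrix.of_apply, Fintype.sum_prod_type,
      Finset.sum_mul_sum]
    refine Finset.sum_congr rfl fun k _ => Finset.sum_congr rfl fun l _ => ?_
    rw [mul_assoc, ← mul_assoc (w k a), ← (hc j l k a).eq]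
    simp only [mul_assoc]
  have ht : (z * w).transpose = w.transpose * z.transpose := by
    ext i j
    simp only [Matrix.transpose_apply, Matrix.mul_apply]
    exact Finset.sum_congr rfl fun k _ => (hc j k k i).eq
  have hJ : ∀ X : Matrix (Fin n) (Fin n) A,
      scal A (metricJ s)⁻¹ * (scal A (metricJ s) * X) = X ∧
      scal A (metricJ s) * (scal A (metricJ s)⁻¹ * X) = X := by
    intro X
    rw [metricJ_inv, ← Matrix.mul_assoc, and_self, scal, ← Matrix.map_mul, metricJ_mul_self,
      Matrix.map_one _ (map_zero _) (map_one _), Matrix.one_mul]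
  have hinv : metricInv s (z * w) = metricInv s w * metricInv s z := by
    simp only [metricInv, ht, Matrix.mul_assoc, (hJ _).1]
  refine ⟨?_, ?_, ?_, ?_, ?_⟩
  · rw [frt_iff, hk, ← Matrix.mul_assoc, (frt_iff z).1 hz.frt, Matrix.mul_assoc,
      (frt_iff w).1 hw.frt, Matrix.mul_assoc]
  · have h1 := hw.left
    have h2 := hz.left
    rw [metricL_eq] at h1 h2 ⊢
    rw [hinv, Matrix.mul_assoc, ← Matrix.mul_assoc w, h1, Matrix.one_mul, h2]
  · rw [hinv, Matrix.mul_assoc, ← Matrix.mul_assoc _ z, hz.right, Matrix.one_mul, hw.right]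
  · intro i j hij
    rw [Matrix.mul_apply]
    refine Finset.sum_eq_zero fun k _ => ?_
    rcases lt_or_ge k i with h | h
    · rw [hz.tri i k h, zero_mul]
    · rw [hw.tri k j (hij.trans_le h), mul_zero]
  · intro i hi
    rw [Matrix.mul_apply, Finset.sum_eq_single i, hz.mid i hi, hw.mid i hi, one_mul]
    · intro k _ hk
      rcases lt_or_gt_of_ne hk with h | h
      · rw [hz.tri i k h, zero_mul]
      · rw [hw.tri k i h, mul_zero]
    · simp

lemma metricInv_apply (z : Matrix (Fin n) (Fin n) A) (i j : Fin n) :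
    metricInv s z i j = (s : ℂ) ^ (twoRho j - twoRho i) • z j.rev i.rev := by
  rw [metricInv, metricJ_inv, Matrix.mul_apply, Finset.sum_eq_single j.rev]
  · rw [Matrix.mul_apply, Finset.sum_eq_single i.rev]
    · simp only [scal, Matrix.map_apply, metricJ, Matrix.of_apply, Fin.rev_rev, if_true,
        Matrix.transpose_apply, twoRho_rev, neg_neg]
      rw [mul_assoc, ← Algebra.commutes ((s : ℂ) ^ twoRho j), ← mul_assoc, ← map_mul,
        ← zpow_add₀ s.ne_zero, Algebra.smul_def, neg_add_eq_sub]
    · intro k _ hk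
      have : i ≠ k.rev := fun e => hk (by rw [e, Fin.rev_rev])
      simp [metricJ, this]
    · simp
  · intro k _ hk
    simp [metricJ, hk]
  · simp

lemma IsPoint.one : IsPoint s (1 : Matrix (Fin n) (Fin n) A) := by
  have hJ : scal A (metricJ (n := n) s) * scal A (metricJ s) = 1 := by
    rw [scal, ← Matrix.map_mul, metricJ_mul_self, Matrix.map_one _ (map_zero _) (map_one _)]
  have hi : metricInv s (1 : Matrix (Fin n) (Fin n) A) = 1 := by
    rw [metricInv, Matrix.transpose_one, Matrix.mul_one, metricJ_inv, hJ]
  refine ⟨?_, ?_, ?_, ?_, ?_⟩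
  · have hk : kron (1 : Matrix (Fin n) (Fin n) A) = 1 := by
      ext ⟨i, j⟩ ⟨a, b⟩
      by_cases h1 : i = a <;> by_cases h2 : j = b <;>
        simp [kron, Matrix.one_apply, h1, h2]
    rw [frt_iff, hk, Matrix.one_mul, Matrix.mul_one]
  · rw [metricL_eq, hi, Matrix.one_mul]
  · rw [hi, Matrix.one_mul]
  · intro i j hij
    exact Matrix.one_apply_ne hij.ne'
  · intro i _
    exact Matrix.one_apply_eq i

/-- The inverse of a matrix satisfying the relations satisfies them in the opposite algebra. -/
lemma IsPoint.op {z : Matrix (Fin n) (Fin n) A} (hz : IsPoint s z) :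
    IsPoint s ((metricInv s z).map MulOpposite.op) := by
  set w := metricInv s z with hw
  have hzw : z * w = 1 := by rw [hw, ← metricL_eq, hz.left]
  have hwz : w * z = 1 := hz.right
  have hwij : ∀ i j, w i j = (s : ℂ) ^ (twoRho j - twoRho i) • z j.rev i.rev :=
    metricInv_apply z
  have hopinv : ∀ i j, metricInv s (w.map MulOpposite.op) i j =
      MulOpposite.op ((s : ℂ) ^ (2 * (twoRho j - twoRho i)) • z i j) := by
    intro i j
    rw [metricInv_apply, Matrix.map_apply, hw, metricInv_apply, Fin.rev_rev,
      Fin.rev_rev, twoRho_rev, twoRho_rev, ← MulOpposite.op_smul, smul_smul,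
      ← zpow_add₀ s.ne_zero]
    congr 3
    ring
  refine ⟨?_, ?_, ?_, ?_, ?_⟩
  · have e1 : ∀ i a, (∑ k, z i k * w k a) = if i = a then 1 else 0 := by
      intro i a
      rw [← Matrix.mul_apply, hzw, Matrix.one_apply]
    have e2 : ∀ i a, (∑ k, w i k * z k a) = if i = a then 1 else 0 := by
      intro i a
      rw [← Matrix.mul_apply, hwz, Matrix.one_apply]
    let M : Matrix (Fin n × Fin n) (Fin n × Fin n) A :=
      Matrix.of fun p r => w p.2 r.2 * w p.1 r.1
    have hKM : kron z * M = 1 := by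
      ext ⟨i, j⟩ ⟨a, b⟩
      have : (kron z * M) (i, j) (a, b) =
          ∑ k, z i k * (∑ l, z j l * w l b) * w k a := by
        simp only [Matrix.mul_apply, Fintype.sum_prod_type, kron, M, Matrix.of_apply,
          Finset.mul_sum, Finset.sum_mul, mul_assoc]
      rw [this, e1, Matrix.one_apply]
      by_cases h : j = b
      · simp only [h, if_true, mul_one, e1, Prod.mk.injEq, and_true]
      · simp [h]
    have hMK : M * kron z = 1 := by
      ext ⟨i, j⟩ ⟨a, b⟩
      have : (M * kron z) (i, j) (a, b) =
          ∑ l, w j l * (∑ k, w i k * z k a) * z l b := by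
        simp only [Matrix.mul_apply, Fintype.sum_prod_type, kron, M, Matrix.of_apply,
          Finset.mul_sum, Finset.sum_mul, mul_assoc]
        exact Finset.sum_comm
      rw [this, e2, Matrix.one_apply]
      by_cases h : i = a
      · simp only [h, if_true, mul_one, e2, Prod.mk.injEq, true_and]
      · simp [h]
    have hHM : scal A (braid n s) * M = M * scal A (braid n s) := by
      calc scal A (braid n s) * M = M * (kron z * scal A (braid n s)) * M := by
            rw [← Matrix.mul_assoc, hMK, Matrix.one_mul]
        _ = M * scal A (braid n s) := by
            rw [← (frt_iff z).1 hz.frt, Matrix.mul_assoc, Matrix.mul_assoc, hKM, Matrix.mul_one]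
    rw [frt_iff]
    ext ⟨i, j⟩ ⟨a, b⟩
    have h := congrArg MulOpposite.op (congrFun (congrFun hHM (i, j)) (a, b))
    simp only [Matrix.mul_apply, M, Matrix.of_apply, scal, Matrix.map_apply] at h
    simp only [Matrix.mul_apply, kron, Matrix.of_apply, scal, Matrix.map_apply]
    simp only [← MulOpposite.op_mul, ← Algebra.commutes] at h ⊢
    simp only [← Algebra.smul_def, ← MulOpposite.op_smul] at h ⊢
    rw [Finset.op_sum, Finset.op_sum] at h
    exact h
  · rw [metricL_eq]
    ext i j
    have h := congrFun (congrFun hwz j.rev) i.rev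
    rw [Matrix.mul_apply, ← Equiv.sum_comp Fin.revPerm] at h
    simp only [Fin.revPerm_apply, hwij, Fin.rev_rev, twoRho_rev] at h
    have h' := congrArg (fun x => (s : ℂ) ^ (twoRho j - twoRho i) • x) h
    simp only [Finset.smul_sum, smul_mul_assoc, smul_smul, ← zpow_add₀ s.ne_zero] at h'
    rw [Matrix.mul_apply]
    simp only [hopinv, Matrix.map_apply, hwij, ← MulOpposite.op_mul,
      smul_mul_assoc, mul_smul_comm, smul_smul, ← zpow_add₀ s.ne_zero]
    rw [← Finset.op_sum]
    have e : ∀ k : Fin n, twoRho k - twoRho i + 2 * (twoRho j - twoRho k) =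
        twoRho j - twoRho i + (-twoRho k - -twoRho j) := fun k => by ring
    simp only [e]
    rw [h']
    by_cases hij : i = j
    · subst hij; simp
    · have : j.rev ≠ i.rev := fun e => hij (Fin.rev_injective e).symm
      simp [Matrix.one_apply_ne hij, Matrix.one_apply_ne this]
  · ext i j
    have h := congrFun (congrFun hzw j.rev) i.rev
    rw [Matrix.mul_apply, ← Equiv.sum_comp Fin.revPerm] at h
    simp only [Fin.revPerm_apply, hwij, Fin.rev_rev, twoRho_rev] at h
    have h' := congrArg (fun x => (s : ℂ) ^ (twoRho j - twoRho i) • x) h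
    simp only [Finset.smul_sum, mul_smul_comm, smul_smul, ← zpow_add₀ s.ne_zero] at h'
    rw [Matrix.mul_apply]
    simp only [hopinv, Matrix.map_apply, hwij, ← MulOpposite.op_mul,
      smul_mul_assoc, mul_smul_comm, smul_smul, ← zpow_add₀ s.ne_zero]
    rw [← Finset.op_sum]
    have e : ∀ k : Fin n, 2 * (twoRho k - twoRho i) + (twoRho j - twoRho k) =
        twoRho j - twoRho i + (-twoRho i - -twoRho k) := fun k => by ring
    simp only [e]
    rw [h']
    by_cases hij : i = j
    · subst hij; simp
    · have : j.rev ≠ i.rev := fun e => hij (Fin.rev_injective e).symm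
      simp [Matrix.one_apply_ne hij, Matrix.one_apply_ne this]
  · intro i j hij
    rw [Matrix.map_apply, hw, metricInv_apply, hz.tri _ _ (Fin.rev_lt_rev.2 hij), smul_zero,
      MulOpposite.op_zero]
  · intro i hi
    rw [Matrix.map_apply, hw, metricInv_apply, sub_self, zpow_zero, one_smul, hz.mid _ (by rw [hi, hi]),
      MulOpposite.op_one]

end Points

/-! ### The Hopf algebra structure of `O_q(B⁺)` -/

namespace OqB

open Algebra.TensorProduct

variable (n : ℕ) (s : ℂˣ)

/-- The comultiplication, `Δ(z_{ij}) = ∑_k z_{ik} ⊗ z_{kj}`. -/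
def comulHom : OqB n s →ₐ[ℂ] OqB n s ⊗[ℂ] OqB n s :=
  lift ((z n s).map (includeLeft : OqB n s →ₐ[ℂ] OqB n s ⊗[ℂ] OqB n s) *
      (z n s).map (includeRight : OqB n s →ₐ[ℂ] OqB n s ⊗[ℂ] OqB n s))
    (((isPoint n s).map _).mul ((isPoint n s).map _) fun i j k l => by
      simp [Commute, SemiconjBy])

/-- The counit, `ε(z_{ij}) = δ_{ij}`. -/
def counitHom : OqB n s →ₐ[ℂ] ℂ := lift 1 .one

/-- The antipode as a homomorphism to the opposite algebra; the matrix `(S(z_{ij}))` is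
`J zᵗ J⁻¹`, that is, `S(z_{ij}) = q ^ (ρ_j - ρ_i) z_{j'i'}`. -/
def antipodeHom : OqB n s →ₐ[ℂ] (OqB n s)ᵐᵒᵖ :=
  lift ((metricInv s (z n s)).map MulOpposite.op) (isPoint n s).op

variable {n s}

lemma comulHom_z (i j : Fin n) : comulHom n s (z n s i j) = ∑ k, z n s i k ⊗ₜ z n s k j := by
  simp [comulHom, Matrix.mul_apply]

lemma counitHom_z (i j : Fin n) : counitHom n s (z n s i j) = if i = j then 1 else 0 := by
  simp [counitHom, Matrix.one_apply]

lemma antipodeHom_z (i j : Fin n) :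
    antipodeHom n s (z n s i j) = MulOpposite.op (metricInv s (z n s) i j) := by
  simp [antipodeHom]

instance : Bialgebra ℂ (OqB n s) :=
  Bialgebra.ofAlgHom (comulHom n s) (counitHom n s)
    (by
      apply algHom_ext
      intro i j
      simp [comulHom_z, TensorProduct.sum_tmul, TensorProduct.tmul_sum]
      exact Finset.sum_comm)
    (by
      apply algHom_ext
      intro i j
      simp [comulHom_z, counitHom_z, TensorProduct.ite_tmul])
    (by
      apply algHom_ext
      intro i j
      simp [comulHom_z, counitHom_z, TensorProduct.tmul_ite])

@[simp] lemma comul_z (i j : Fin n) :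
    Coalgebra.comul (R := ℂ) (z n s i j) = ∑ k, z n s i k ⊗ₜ[ℂ] z n s k j := comulHom_z i j

@[simp] lemma counit_z (i j : Fin n) :
    Coalgebra.counit (R := ℂ) (z n s i j) = if i = j then 1 else 0 := counitHom_z i j

/-- The antipode as a linear map. -/
def antipodeLin : OqB n s →ₗ[ℂ] OqB n s :=
  (MulOpposite.opLinearEquiv ℂ).symm.toLinearMap ∘ₗ (antipodeHom n s).toLinearMap

lemma antipodeLin_z (i j : Fin n) :
    antipodeLin (z n s i j) = metricInv s (z n s) i j := by
  simp [antipodeLin, antipodeHom_z]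

lemma antipodeLin_mul (x y : OqB n s) :
    antipodeLin (x * y) = antipodeLin y * antipodeLin x := by
  simp [antipodeLin]

lemma antipodeLin_algebraMap (c : ℂ) :
    antipodeLin (algebraMap ℂ (OqB n s) c) = algebraMap ℂ (OqB n s) c := by
  simp [antipodeLin]

instance : HopfAlgebra ℂ (OqB n s) where
  antipode := antipodeLin
  mul_antipode_rTensor_comul := by
    ext x
    induction x using OqB.induction with
    | hs c => simp [Algebra.TensorProduct.algebraMap_apply, antipodeLin_algebraMap]
    | hz i j =>
      have h := congrFun (congrFun (isPoint n s).right i) j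
      rw [Matrix.mul_apply, Matrix.one_apply] at h
      simp [antipodeLin_z, h, apply_ite (algebraMap ℂ (OqB n s))]
    | ha x y hx hy => rw [map_add, map_add, hx, hy]
    | hm x y hx hy =>
      have key : ∀ t u : OqB n s ⊗[ℂ] OqB n s, ∀ c : ℂ,
          LinearMap.mul' ℂ _ (antipodeLin.rTensor _ t) = algebraMap ℂ (OqB n s) c →
          LinearMap.mul' ℂ _ (antipodeLin.rTensor _ (t * u)) =
            algebraMap ℂ (OqB n s) c * LinearMap.mul' ℂ _ (antipodeLin.rTensor _ u) := by
        intro t u c ht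
        induction u with
        | zero => simp
        | add u v hu hv => simp only [mul_add, map_add, hu, hv]
        | tmul p r =>
          have : ∀ t : OqB n s ⊗[ℂ] OqB n s,
              LinearMap.mul' ℂ _ (antipodeLin.rTensor _ (t * p ⊗ₜ[ℂ] r)) =
                antipodeLin p * LinearMap.mul' ℂ _ (antipodeLin.rTensor _ t) * r := by
            intro t
            induction t with
            | zero => simp
            | add u v hu hv => simp only [mul_add, add_mul, map_add, hu, hv]
            | tmul a b => simp [antipodeLin_mul, mul_assoc]
          rw [this, ht, ← Algebra.commutes]
          simp [mul_assoc]
      simp only [LinearMap.comp_apply] at hx hy ⊢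
      rw [Bialgebra.comul_mul, key _ _ _ hx, hy, Bialgebra.counit_mul]
      simp
  mul_antipode_lTensor_comul := by
    ext x
    induction x using OqB.induction with
    | hs c =>
      have h1 : antipodeLin (1 : OqB n s) = 1 := by simp [antipodeLin]
      simp [Algebra.TensorProduct.algebraMap_apply, h1]
    | hz i j =>
      have h := congrFun (congrFun (isPoint n s).left i) j
      rw [metricL_eq, Matrix.mul_apply, Matrix.one_apply] at h
      simp [antipodeLin_z, h, apply_ite (algebraMap ℂ (OqB n s))]
    | ha x y hx hy => rw [map_add, map_add, hx, hy]
    | hm x y hx hy =>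
      have key : ∀ t u : OqB n s ⊗[ℂ] OqB n s, ∀ c : ℂ,
          LinearMap.mul' ℂ _ (antipodeLin.lTensor _ u) = algebraMap ℂ (OqB n s) c →
          LinearMap.mul' ℂ _ (antipodeLin.lTensor _ (t * u)) =
            LinearMap.mul' ℂ _ (antipodeLin.lTensor _ t) * algebraMap ℂ (OqB n s) c := by
        intro t u c hu
        induction t with
        | zero => simp
        | add t v ht hv => simp only [add_mul, map_add, ht, hv]
        | tmul p r =>
          have : ∀ u : OqB n s ⊗[ℂ] OqB n s,
              LinearMap.mul' ℂ _ (antipodeLin.lTensor _ (p ⊗ₜ[ℂ] r * u)) =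
                p * LinearMap.mul' ℂ _ (antipodeLin.lTensor _ u) * antipodeLin r := by
            intro u
            induction u with
            | zero => simp
            | add u v hu hv => simp only [mul_add, add_mul, map_add, hu, hv]
            | tmul a b => simp [antipodeLin_mul, mul_assoc]
          rw [this, hu, mul_assoc, Algebra.commutes]
          simp [mul_assoc]
      simp only [LinearMap.comp_apply] at hx hy ⊢
      rw [Bialgebra.comul_mul, key _ _ _ hy, hx, Bialgebra.counit_mul]
      simp

lemma antipode_z (i j : Fin n) :
    HopfAlgebra.antipode ℂ (z n s i j) =
      (s : ℂ) ^ (twoRho j - twoRho i) • z n s j.rev i.rev :=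
  (antipodeLin_z i j).trans (metricInv_apply _ i j)

end OqB

/-! ### The coordinate algebra of the Borel subgroup of `SO_n` -/

/-- The defining relations of `O(B⁺)` in `ℂ[X_{ij}]`: the relations
`∑_k X_{kj} X_{k'i'} = δ_{ij}` and `det X = 1` of `O(SO_n)`, and `X_{ij} = 0` for `i > j`. -/
def classicalRel (n : ℕ) : Set (MvPolynomial (Fin n × Fin n) ℂ) :=
  {p | ∃ i j : Fin n, p = (∑ k : Fin n, MvPolynomial.X (k, j) * MvPolynomial.X (k.rev, i.rev))
      - if i = j then 1 else 0} ∪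
  {Matrix.det (Matrix.of fun i j : Fin n => (MvPolynomial.X (i, j) : MvPolynomial _ ℂ)) - 1} ∪
  {p | ∃ i j : Fin n, j < i ∧ p = MvPolynomial.X (i, j)}

/-- The coordinate algebra `O(B⁺)` of the standard (upper triangular) Borel subgroup of
`SO_n(ℂ)`. -/
def OB (n : ℕ) : Type := MvPolynomial (Fin n × Fin n) ℂ ⧸ Ideal.span (classicalRel n)

instance (n : ℕ) : CommRing (OB n) :=
  inferInstanceAs (CommRing (MvPolynomial (Fin n × Fin n) ℂ ⧸ Ideal.span (classicalRel n)))
instance (n : ℕ) : Algebra ℂ (OB n) :=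
  inferInstanceAs (Algebra ℂ (MvPolynomial (Fin n × Fin n) ℂ ⧸ Ideal.span (classicalRel n)))

namespace OB

/-- The projection of the polynomial ring onto `O(B⁺)`. -/
def mk (n : ℕ) : MvPolynomial (Fin n × Fin n) ℂ →ₐ[ℂ] OB n :=
  Ideal.Quotient.mkₐ ℂ (Ideal.span (classicalRel n))

/-- The matrix of coordinate functions `X_{ij}` of `O(B⁺)`. -/
def X (n : ℕ) : Matrix (Fin n) (Fin n) (OB n) := Matrix.of fun i j => mk n (MvPolynomial.X (i, j))

section Points

variable {n : ℕ} {A : Type*} [CommRing A]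

/-- `x` is an upper triangular matrix in `SO_n(A)`. -/
structure IsPoint (x : Matrix (Fin n) (Fin n) A) : Prop where
  orth : ∀ i j, ∑ k, x k j * x k.rev i.rev = if i = j then 1 else 0
  det : x.det = 1
  tri : ∀ i j, j < i → x i j = 0

lemma mk_eq_zero {p : MvPolynomial (Fin n × Fin n) ℂ} (h : p ∈ classicalRel n) : mk n p = 0 :=
  Ideal.Quotient.eq_zero_iff_mem.2 (Ideal.subset_span h)

lemma isPoint (n : ℕ) : IsPoint (X n) where
  orth i j := by
    have := mk_eq_zero (n := n) (Or.inl (Or.inl ⟨i, j, rfl⟩))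
    rw [map_sub, sub_eq_zero, map_sum] at this
    simpa [apply_ite (mk n), X] using this
  det := by
    have := mk_eq_zero (n := n) (Or.inl (Or.inr rfl))
    rw [map_sub, sub_eq_zero, map_one, AlgHom.map_det] at this
    exact this
  tri i j hij := mk_eq_zero (Or.inr ⟨i, j, hij, rfl⟩)

/-- The universal property of `O(B⁺)`. -/
def lift [Algebra ℂ A] (x : Matrix (Fin n) (Fin n) A) (h : IsPoint x) : OB n →ₐ[ℂ] A :=
  Ideal.Quotient.liftₐ (Ideal.span (classicalRel n))
    (MvPolynomial.aeval fun p : Fin n × Fin n => x p.1 p.2) (by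
      intro a ha
      have : Ideal.span (classicalRel n) ≤
          RingHom.ker (MvPolynomial.aeval (R := ℂ) fun p : Fin n × Fin n => x p.1 p.2) := by
        rw [Ideal.span_le]
        rintro p ((⟨i, j, rfl⟩ | rfl) | ⟨i, j, hij, rfl⟩)
        · rw [SetLike.mem_coe, RingHom.mem_ker, map_sub, sub_eq_zero]
          simpa [apply_ite] using h.orth i j
        · rw [SetLike.mem_coe, RingHom.mem_ker, map_sub, sub_eq_zero, AlgHom.map_det, map_one,
            ← h.det]
          congr 1
          ext i j
          simp
        · rw [SetLike.mem_coe, RingHom.mem_ker]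
          simpa using h.tri i j hij
      exact this ha)

@[simp] lemma lift_X [Algebra ℂ A] (x : Matrix (Fin n) (Fin n) A) (h : IsPoint x) (i j : Fin n) :
    lift x h (X n i j) = x i j := by
  refine (Ideal.Quotient.lift_mk ..).trans ?_
  simp

lemma algHom_ext [Algebra ℂ A] {f g : OB n →ₐ[ℂ] A} (h : ∀ i j, f (X n i j) = g (X n i j)) : f = g := by
  apply Ideal.Quotient.algHom_ext
  apply MvPolynomial.algHom_ext
  intro p
  exact h p.1 p.2

lemma IsPoint.map [Algebra ℂ A] {B : Type*} [CommRing B] [Algebra ℂ B] {x : Matrix (Fin n) (Fin n) A}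
    (h : IsPoint x) (f : A →ₐ[ℂ] B) : IsPoint (x.map f) where
  orth i j := by
    have := congrArg f (h.orth i j)
    simpa [map_sum, apply_ite f] using this
  det := by
    have := AlgHom.map_det f x
    rw [h.det, map_one] at this
    exact this.symm
  tri i j hij := by simp [h.tri i j hij]

lemma IsPoint.one : IsPoint (1 : Matrix (Fin n) (Fin n) A) where
  orth i j := by
    rw [Finset.sum_eq_single j]
    · simp [Matrix.one_apply, eq_comm]
    · intro k _ hk; simp [Matrix.one_apply_ne hk]
    · simp
  det := Matrix.det_one
  tri i j hij := Matrix.one_apply_ne hij.ne'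

lemma IsPoint.mul {x y : Matrix (Fin n) (Fin n) A} (hx : IsPoint x) (hy : IsPoint y) :
    IsPoint (x * y) where
  orth i j := by
    have e : ∑ k : Fin n, (x * y) k j * (x * y) k.rev i.rev =
        ∑ a, ∑ b : Fin n, (∑ k : Fin n, x k a * x k.rev b) * (y a j * y b i.rev) := by
      have e1 : ∀ k : Fin n, (x * y) k j * (x * y) k.rev i.rev =
          ∑ a, ∑ b, (x k a * x k.rev b) * (y a j * y b i.rev) := by
        intro k
        rw [Matrix.mul_apply, Matrix.mul_apply, Finset.sum_mul_sum]
        refine Finset.sum_congr rfl fun a _ => Finset.sum_congr rfl fun b _ => ?_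
        ring
      simp only [e1, Finset.sum_mul]
      rw [Finset.sum_comm]
      exact Finset.sum_congr rfl fun a _ => Finset.sum_comm
    rw [e, ← hy.orth i j]
    refine Finset.sum_congr rfl fun a _ => ?_
    rw [Finset.sum_eq_single a.rev]
    · have := hx.orth a a
      rw [this]; simp
    · intro b _ hb
      have := hx.orth b.rev a
      rw [Fin.rev_rev] at this
      have hne : b.rev ≠ a := fun e => hb (by rw [← e, Fin.rev_rev])
      rw [this, if_neg hne, zero_mul]
    · simp
  det := by rw [Matrix.det_mul, hx.det, hy.det, one_mul]
  tri i j hij := by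
    rw [Matrix.mul_apply]
    refine Finset.sum_eq_zero fun k _ => ?_
    rcases lt_or_ge k i with h | h
    · rw [hx.tri i k h, zero_mul]
    · rw [hy.tri k j (hij.trans_le h), mul_zero]

/-- The matrix with entries `x_{j'i'}`, the inverse of `x` in `SO_n`. -/
def invMat (x : Matrix (Fin n) (Fin n) A) : Matrix (Fin n) (Fin n) A :=
  Matrix.of fun i j => x j.rev i.rev

lemma IsPoint.inv_mul {x : Matrix (Fin n) (Fin n) A} (hx : IsPoint x) : invMat x * x = 1 := by
  ext i j
  rw [Matrix.mul_apply, Matrix.one_apply, ← hx.orth i j]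
  exact Finset.sum_congr rfl fun k _ => mul_comm _ _

lemma IsPoint.mul_inv {x : Matrix (Fin n) (Fin n) A} (hx : IsPoint x) : x * invMat x = 1 :=
  mul_eq_one_comm.1 hx.inv_mul

lemma IsPoint.inv {x : Matrix (Fin n) (Fin n) A} (hx : IsPoint x) : IsPoint (invMat x) where
  orth i j := by
    have := congrFun (congrFun hx.mul_inv i) j
    rw [Matrix.mul_apply, Matrix.one_apply] at this
    rw [← this]
    refine Finset.sum_congr rfl fun k _ => ?_
    simp [invMat, mul_comm]
  det := by
    have := congrArg Matrix.det hx.inv_mul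
    rwa [Matrix.det_mul, hx.det, mul_one, Matrix.det_one] at this
  tri i j hij := hx.tri _ _ (Fin.rev_lt_rev.2 hij)

end Points

/-! ### The Hopf algebra structure of `O(B⁺)` -/

open Algebra.TensorProduct

variable (n : ℕ)

/-- The comultiplication, `Δ(X_{ij}) = ∑_k X_{ik} ⊗ X_{kj}`. -/
def comulHom : OB n →ₐ[ℂ] OB n ⊗[ℂ] OB n :=
  lift ((X n).map (includeLeft : OB n →ₐ[ℂ] OB n ⊗[ℂ] OB n) *
      (X n).map (includeRight : OB n →ₐ[ℂ] OB n ⊗[ℂ] OB n))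
    (((isPoint n).map _).mul ((isPoint n).map _))

/-- The counit, `ε(X_{ij}) = δ_{ij}`. -/
def counitHom : OB n →ₐ[ℂ] ℂ := lift 1 .one

/-- The antipode, `S(X_{ij}) = X_{j'i'}`. -/
def antipodeHom : OB n →ₐ[ℂ] OB n := lift (invMat (X n)) (isPoint n).inv

variable {n}

lemma comulHom_X (i j : Fin n) : comulHom n (X n i j) = ∑ k, X n i k ⊗ₜ X n k j := by
  simp [comulHom, Matrix.mul_apply]

lemma counitHom_X (i j : Fin n) : counitHom n (X n i j) = if i = j then 1 else 0 := by
  simp [counitHom, Matrix.one_apply]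

lemma antipodeHom_X (i j : Fin n) : antipodeHom n (X n i j) = X n j.rev i.rev := by
  simp [antipodeHom, invMat]

instance : Bialgebra ℂ (OB n) :=
  Bialgebra.ofAlgHom (comulHom n) (counitHom n)
    (by
      apply algHom_ext
      intro i j
      simp [comulHom_X, TensorProduct.sum_tmul, TensorProduct.tmul_sum]
      exact Finset.sum_comm)
    (by
      apply algHom_ext
      intro i j
      simp [comulHom_X, counitHom_X, TensorProduct.ite_tmul])
    (by
      apply algHom_ext
      intro i j
      simp [comulHom_X, counitHom_X, TensorProduct.tmul_ite])

@[simp] lemma comul_X (i j : Fin n) :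
    Coalgebra.comul (R := ℂ) (X n i j) = ∑ k, X n i k ⊗ₜ[ℂ] X n k j := comulHom_X i j

@[simp] lemma counit_X (i j : Fin n) :
    Coalgebra.counit (R := ℂ) (X n i j) = if i = j then 1 else 0 := counitHom_X i j

instance : HopfAlgebra ℂ (OB n) :=
  HopfAlgebra.ofAlgHom (antipodeHom n)
    (by
      apply algHom_ext
      intro i j
      have h := congrFun (congrFun (isPoint n).inv_mul i) j
      rw [Matrix.mul_apply, Matrix.one_apply] at h
      simp only [invMat, Matrix.of_apply] at h
      simp only [AlgHom.comp_apply, Bialgebra.comulAlgHom_apply, Bialgebra.counitAlgHom_apply,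
        comul_X, counit_X, map_sum, apply_ite (Algebra.ofId ℂ (OB n)), map_one, map_zero]
      rw [← h]
      refine Finset.sum_congr rfl fun k _ => ?_
      refine (Algebra.TensorProduct.lift_tmul ..).trans ?_
      rw [antipodeHom_X]
      rfl)
    (by
      apply algHom_ext
      intro i j
      have h := congrFun (congrFun (isPoint n).mul_inv i) j
      rw [Matrix.mul_apply, Matrix.one_apply] at h
      simp only [invMat, Matrix.of_apply] at h
      simp [antipodeHom_X, h])

lemma antipode_X (i j : Fin n) :
    HopfAlgebra.antipode ℂ (X n i j) = X n j.rev i.rev := antipodeHom_X i j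

end OB

end QSO

end

/-! Write `q = s ^ 2`. A matrix over an algebra satisfying the defining relations (a point) is the
same as a homomorphism out of `OqB`, so statements about the rescaled powers `y_ij = c_ij z_ij ^ N`
can be tested on points, provided one point is faithful.

A point is called Frobenius (`FrobPoint`) if its rescaled powers commute and if right multiplication
by it, and by its inverse in the opposite algebra, turns `N`-th powers of a quantum Euclidean row
into a classical matrix product. A product of Frobenius points with mutually commuting entries is
Frobenius (`FrobPoint.mul`), and so is a block `diag(1, w, 1)`. The building blocks are points
attached to simple roots, with entries made from operators `K E = q E K`. Their columns have at most
three nonzero entries. Two entries give terms to which a q-binomial theorem applies, so that `(a +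
b) ^ N = a ^ N + b ^ N`. The last column for the short root of type B has three, and the trinomial
theorem `add_add_pow_root` gives its middle term the coefficient `2 / (1 + q) ^ N`; this is the
origin of the factor `(1 + q) ^ N / 2`.

Faithfulness is proved by induction from `n` to `n + 2`. Up to powers of the invertible entry
`z_00`, every element is a combination of ordered monomials in the first row, without its last
entry, with coefficients from the inner block (`OqB.exists_rowSum`). The point `diag(1, z, 1) * v`
induces `OqB.coact`. It sends the first row to that of `v` and an inner element `a` to `a₁ ⊗ f(a₂)`;
the antipode undoes the latter. Hence it is injective as soon as the ordered monomials in the first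
row of `v` are independent. A Frobenius point `v` with this property is a product of simple root
points acting by shift operators, with independence read off from leading terms (`rowIndep`).

A faithful Frobenius point shows that the `y_ij` commute and have the matrix comultiplication. The
antipode axiom gives orthogonality, and pairing diagonal entries gives determinant one, so the map
out of `OB` exists. It is injective by a second induction: the classical algebra has the same
spanning monomials, and their images remain independent over the inner block because multiplying
exponents by `N` preserves independence (`OqB.powSum_injective`). -/

noncomputable section

namespace QSO

/-! ### Inner indices -/

section Inner

variable {n : ℕ}

/-- The embedding of `Fin n` as the inner indices of `Fin (n + 2)`. -/
def inn (k : Fin n) : Fin (n + 2) := k.succ.castSucc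

@[simp] lemma inn_val (k : Fin n) : (inn k).val = k.val + 1 := rfl

@[simp] lemma rev_inn (k : Fin n) : (inn k).rev = inn k.rev := by
  ext; simp [Fin.val_rev]; omega

@[simp] lemma inn_lt_inn {a b : Fin n} : inn a < inn b ↔ a < b := by
  simp only [Fin.lt_def, inn_val]; omega

@[simp] lemma inn_inj {a b : Fin n} : inn a = inn b ↔ a = b := by
  simp [Fin.ext_iff]

@[simp] lemma zero_lt_inn (k : Fin n) : (0 : Fin (n + 2)) < inn k := by
  simp [Fin.lt_def]

@[simp] lemma inn_lt_last (k : Fin n) : inn k < Fin.last (n + 1) := by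
  simp [Fin.lt_def]

@[simp] lemma inn_ne_zero (k : Fin n) : inn k ≠ 0 := (zero_lt_inn k).ne'

@[simp] lemma zero_ne_inn (k : Fin n) : 0 ≠ inn k := (zero_lt_inn k).ne

@[simp] lemma inn_ne_last (k : Fin n) : inn k ≠ Fin.last (n + 1) := (inn_lt_last k).ne

@[simp] lemma last_ne_inn (k : Fin n) : Fin.last (n + 1) ≠ inn k := (inn_lt_last k).ne'

@[simp] lemma zero_lt_last' : (0 : Fin (n + 2)) < Fin.last (n + 1) := by simp [Fin.lt_def]

@[simp] lemma not_last_lt (k : Fin (n + 2)) : ¬ Fin.last (n + 1) < k := (Fin.le_last k).not_gt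

@[simp] lemma rev_zero' : (0 : Fin (n + 2)).rev = Fin.last (n + 1) := by
  ext; simp

lemma inn_cases {P : Fin (n + 2) → Prop} (h0 : P 0) (hl : P (Fin.last (n + 1)))
    (hi : ∀ k, P (inn k)) (i : Fin (n + 2)) : P i := by
  induction i using Fin.lastCases with
  | last => exact hl
  | cast i =>
    induction i using Fin.cases with
    | zero => exact h0
    | succ i => exact hi i

lemma sum_inn {M : Type*} [AddCommMonoid M] (f : Fin (n + 2) → M) :
    ∑ k, f k = f 0 + ∑ k, f (inn k) + f (Fin.last (n + 1)) := by
  rw [Fin.sum_univ_castSucc, Fin.sum_univ_succ]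
  rfl

-- Adding an outer pair of indices raises both `n / 2` and the position by one. This stability of
-- `ρ` makes the R-matrix and the metric restrict to the inner indices, and so allows induction in
-- steps of two.
@[simp] lemma twoRho_inn (k : Fin n) : twoRho (inn k) = twoRho k := by
  simp only [twoRho, rev_inn, inn_lt_inn, inn_val]
  push_cast
  split_ifs <;> ring

lemma twoRho_zero : twoRho (0 : Fin (n + 2)) = n := by
  simp [twoRho]

lemma twoRho_last : twoRho (Fin.last (n + 1)) = -n := by
  rw [← rev_zero', twoRho_rev, twoRho_zero]

lemma twoRho_of_lt {i : Fin n} (h : i < i.rev) : twoRho i = n - 2 * ((i.val : ℤ) + 1) := by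
  rw [twoRho, if_pos h]

lemma twoRho_mid {i : Fin n} (h : i.rev = i) : twoRho i = 0 := by
  simp [twoRho, h]

variable (s : ℂˣ)

@[simp] lemma metricJ_inn (i j : Fin n) : metricJ s (inn i) (inn j) = metricJ s i j := by
  simp [metricJ]

lemma metricJ_of_ne {i j : Fin n} (h : i ≠ j.rev) : metricJ s i j = 0 := by
  simp [metricJ, h]

@[simp] lemma metricJ_rev_right (i : Fin n) : metricJ s i i.rev = (s : ℂ) ^ (-twoRho i) := by
  simp [metricJ]

@[simp] lemma metricJ_rev_left (i : Fin n) : metricJ s i.rev i = (s : ℂ) ^ (twoRho i) := by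
  simp [metricJ, twoRho_rev]

end Inner

/-! ### The two sides of the FRT relations -/

section Sides

variable {n : ℕ} {A : Type*} [Ring A] [Algebra ℂ A]

/-- The scalar `q - q⁻¹`. -/
def lam (s : ℂˣ) : ℂ := (s : ℂ) ^ 2 - ((s : ℂ) ^ 2)⁻¹

/-- The diagonal scalar `q ^ (δ_{ij} - δ_{ij'})`. -/
def qd (s : ℂˣ) (i j : Fin n) : ℂ :=
  ((s : ℂ) ^ 2) ^ ((if i = j then 1 else 0) - (if i = j.rev then 1 else 0) : ℤ)

/-- The truncated quadratic form `∑_{l > a} J_{l'l} x_{l'} y_l`. -/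
def upperForm (s : ℂˣ) (x y : Fin n → A) (a : Fin n) : A :=
  ∑ l, if a < l then (s : ℂ) ^ twoRho l • (x l.rev * y l) else 0

/-- The truncated quadratic form `∑_{k < j} J_{kk'} x_k y_{k'}`. -/
def lowerForm (s : ℂˣ) (x y : Fin n → A) (j : Fin n) : A :=
  ∑ k, if k < j then (s : ℂ) ^ (-twoRho k) • (x k * y k.rev) else 0

/-- The side `∑_{k,l} R^{lk}_{ab} x_k y_l` of the FRT relation, for two rows `x` and `y`. -/
def rowSide (s : ℂˣ) (x y : Fin n → A) (a b : Fin n) : A :=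
  ∑ k, ∑ l, coeffR s l k a b • (x k * y l)

/-- The side `∑_{k,l} R^{ji}_{kl} x_k y_l` of the FRT relation, for two columns `x` and `y`. -/
def colSide (s : ℂˣ) (x y : Fin n → A) (i j : Fin n) : A :=
  ∑ k, ∑ l, coeffR s j i k l • (x k * y l)

lemma frt_eq (s : ℂˣ) (z : Matrix (Fin n) (Fin n) A) (i b j a : Fin n) :
    frt s z i b j a = rowSide s (z i) (z j) a b - colSide s (fun k => z k a) (fun k => z k b) i j := by
  simp only [frt, rowSide, colSide, Finset.sum_sub_distrib]

lemma coeffR_eq (s : ℂˣ) (i j a b : Fin n) : coeffR s i j a b =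
    (if i = a then if j = b then qd s i j else 0 else 0)
    + (if a < i then (if j = a then if i = b then lam s else 0 else 0)
        - lam s * (metricJ s j i * metricJ s a b) else 0) := by
  unfold coeffR qd lam
  split_ifs <;> simp [mul_sub]

/-- The R-matrix is a diagonal term, a transposition term and a rank one metric term. The first two
pick out single products; the third leaves a quadratic form truncated at `a` by the factor `u(l -
a)`. -/
lemma rowSide_eq (s : ℂˣ) (x y : Fin n → A) (a b : Fin n) :
    rowSide s x y a b = qd s a b • (x b * y a) + (if a < b then lam s • (x a * y b) else 0)
      - (lam s * metricJ s a b) • upperForm s x y a := by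
  have e1 : ∀ k l : Fin n, coeffR s l k a b • (x k * y l) =
      (if l = a then if k = b then qd s a b • (x b * y a) else 0 else 0)
      + (if k = a then if l = b then if a < b then lam s • (x a * y b) else 0 else 0 else 0)
      - (if k = l.rev then (lam s * metricJ s a b) •
          (if a < l then (s : ℂ) ^ twoRho l • (x l.rev * y l) else 0) else 0) := by
    intro k l
    rw [coeffR_eq, add_smul, add_sub_assoc]
    congr 1
    · split_ifs with h1 h2
      · subst h1 h2; rfl
      · simp
      · simp
    · by_cases hk : k = l.rev
      · subst hk
        rw [metricJ_rev_left]
        split_ifs with h1 h2 h3 h4 <;> try (subst_vars; simp_all; done)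
        all_goals simp_all [sub_smul, smul_smul, mul_comm, mul_assoc]
      · rw [metricJ_of_ne s hk]
        split_ifs <;> simp_all
  simp only [rowSide, e1, Finset.sum_add_distrib, Finset.sum_sub_distrib]
  congr 1
  · simp
  · rw [Finset.sum_comm]
    simp [upperForm, Finset.smul_sum]

lemma colSide_eq (s : ℂˣ) (x y : Fin n → A) (i j : Fin n) :
    colSide s x y i j = qd s j i • (x j * y i) + (if i < j then lam s • (x i * y j) else 0)
      - (lam s * metricJ s i j) • lowerForm s x y j := by
  have e1 : ∀ k l : Fin n, coeffR s j i k l • (x k * y l) =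
      (if k = j then if l = i then qd s j i • (x j * y i) else 0 else 0)
      + (if k = i then if l = j then if i < j then lam s • (x i * y j) else 0 else 0 else 0)
      - (if l = k.rev then (lam s * metricJ s i j) •
          (if k < j then (s : ℂ) ^ (-twoRho k) • (x k * y k.rev) else 0) else 0) := by
    intro k l
    rw [coeffR_eq, add_smul, add_sub_assoc]
    congr 1
    · by_cases h1 : k = j
      · by_cases h2 : l = i
        · subst h1 h2; simp
        · simp [h2, Ne.symm h2]
      · simp [h1, Ne.symm h1]
    · by_cases hk : l = k.rev
      · subst hk
        rw [metricJ_rev_right]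
        by_cases h1 : k < j
        · rw [if_pos h1, if_pos rfl, if_pos h1, sub_smul, smul_smul, mul_assoc]
          congr 1
          by_cases h2 : k = i
          · subst h2
            by_cases h3 : j = k.rev
            · subst h3; simp only [if_pos h1, if_true]
            · simp [h3, Ne.symm h3]
          · simp [h2, Ne.symm h2]
        · rw [if_neg h1, if_neg h1, if_pos rfl]
          by_cases h2 : k = i
          · simp [h2 ▸ h1]
          · simp [h2]
      · rw [metricJ_of_ne s (i := k) (j := l) (fun h => hk (by rw [h, Fin.rev_rev]))]
        by_cases h1 : k < j
        · by_cases h2 : k = i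
          · by_cases h3 : l = j
            · simp_all
            · simp_all [Ne.symm h3]
          · simp_all [Ne.symm h2]
        · by_cases h2 : k = i
          · simp_all [h2 ▸ h1]
          · simp_all
  simp only [colSide, e1, Finset.sum_add_distrib, Finset.sum_sub_distrib]
  congr 1
  · simp
  · simp [lowerForm, Finset.smul_sum]

lemma IsPoint.sides {s : ℂˣ} {z : Matrix (Fin n) (Fin n) A} (h : IsPoint s z) (i j a b : Fin n) :
    rowSide s (z i) (z j) a b = colSide s (fun k => z k a) (fun k => z k b) i j := by
  have := h.frt i b j a
  rwa [frt_eq, sub_eq_zero] at this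

end Sides

/-! ### Quantum Euclidean rows -/

section RowRel

variable {n : ℕ} {A B : Type*} [Ring A] [Algebra ℂ A] [Ring B] [Algebra ℂ B] {s : ℂˣ}

/-- `x` satisfies the relations of the quantum Euclidean space: the row relations of a point
hold up to multiples of the metric. -/
def RowRel (s : ℂˣ) (x : Fin n → A) : Prop :=
  ∃ Q : A, ∀ a b, rowSide s x x a b = ((s : ℂ) ^ 2) • (x a * x b) + metricJ s a b • Q

lemma qd_self {i : Fin n} (h : i ≠ i.rev) : qd s i i = (s : ℂ) ^ 2 := by
  simp [qd, h]

lemma qd_of_ne {i j : Fin n} (h : i ≠ j) (h' : i ≠ j.rev) : qd s i j = 1 := by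
  simp [qd, h, h']

lemma qd_rev {i : Fin n} (h : i ≠ i.rev) : qd s i i.rev = ((s : ℂ) ^ 2)⁻¹ := by
  simp [qd, h]

lemma qd_comm (i j : Fin n) : qd s i j = qd s j i := by
  have h : i = j.rev ↔ j = i.rev :=
    ⟨fun h => by rw [h, Fin.rev_rev], fun h => by rw [h, Fin.rev_rev]⟩
  simp only [qd, eq_comm (a := i) (b := j), h]

@[simp] lemma qd_inn (i j : Fin n) : qd s (inn i) (inn j) = qd s i j := by
  simp [qd]

/-- On a row paired with itself the column side is `q` times the product, and its metric term
vanishes since `J_ii = 0` for `i ≠ i'`. Middle rows are excluded for this reason. -/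
lemma IsPoint.rowRel {z : Matrix (Fin n) (Fin n) A} (h : IsPoint s z) {i : Fin n}
    (hi : i ≠ i.rev) : RowRel s (z i) := by
  refine ⟨0, fun a b => ?_⟩
  rw [h.sides, colSide_eq, qd_self hi, metricJ_of_ne s hi]
  simp

lemma sq_ne_zero' (s : ℂˣ) : (s : ℂ) ^ 2 ≠ 0 := pow_ne_zero _ s.ne_zero

/-- Away from conjugate pairs the metric terms vanish, and `q - (q - q⁻¹) = q⁻¹`. -/
lemma RowRel.comm {x : Fin n → A} (h : RowRel s x) {a b : Fin n} (hab : a < b) (hr : a ≠ b.rev) :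
    x b * x a = ((s : ℂ) ^ 2)⁻¹ • (x a * x b) := by
  obtain ⟨Q, h⟩ := h
  have := h a b
  rw [rowSide_eq, qd_of_ne hab.ne hr, if_pos hab, metricJ_of_ne s hr] at this
  simp only [one_smul, mul_zero, zero_smul, sub_zero, add_zero] at this
  rw [← eq_sub_iff_add_eq, ← sub_smul] at this
  rw [this, lam]; congr 1; ring

lemma RowRel.comm' {x : Fin n → A} (h : RowRel s x) {a b : Fin n} (hab : a < b) (hr : a ≠ b.rev) :
    x a * x b = ((s : ℂ) ^ 2) • (x b * x a) := by
  rw [h.comm hab hr, smul_smul, mul_inv_cancel₀ (sq_ne_zero' s), one_smul]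

/-- The part of the quadratic form strictly between `a` and `a'`. -/
def midForm (s : ℂˣ) (x : Fin n → A) (a : Fin n) : A :=
  ∑ l, if a < l ∧ l < a.rev then (s : ℂ) ^ twoRho l • (x l.rev * x l) else 0

lemma upperForm_split (x : Fin n → A) {a : Fin n} (ha : a < a.rev) :
    upperForm s x x a = midForm s x a + (s : ℂ) ^ (-twoRho a) • (x a * x a.rev)
      + upperForm s x x a.rev := by
  have e : (s : ℂ) ^ (-twoRho a) • (x a * x a.rev) =
      ∑ l, if l = a.rev then (s : ℂ) ^ twoRho l • (x l.rev * x l) else 0 := by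
    simp [twoRho_rev]
  rw [e, midForm, upperForm, upperForm, ← Finset.sum_add_distrib, ← Finset.sum_add_distrib]
  refine Finset.sum_congr rfl fun l _ => ?_
  rcases lt_trichotomy l a.rev with h | h | h
  · simp [h, h.ne, h.asymm]
  · simp [h, ha]
  · simp [h, h.ne', h.asymm, ha.trans h]

/-- The relations at `(a, a')` and `(a', a)` share the unknown `Q`. Eliminating it also cancels the
forms truncated at `a'`, leaving only the part strictly between `a` and `a'`. -/
lemma RowRel.pair {x : Fin n → A} (h : RowRel s x) {a : Fin n} (ha : a < a.rev) :
    (((s : ℂ) ^ 2)⁻¹ + (s : ℂ) ^ 2 * (s : ℂ) ^ (-(2 * twoRho a))) • (x a.rev * x a - x a * x a.rev)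
      = (lam s * (s : ℂ) ^ (-twoRho a)) • midForm s x a := by
  obtain ⟨Q, h⟩ := h
  have h1 := h a a.rev
  have h2 := h a.rev a
  rw [rowSide_eq, qd_rev ha.ne, if_pos ha, upperForm_split x ha, metricJ_rev_right] at h1
  rw [rowSide_eq, qd_comm, qd_rev ha.ne, if_neg ha.asymm, metricJ_rev_left] at h2
  have hr : (s : ℂ) ^ (-(2 * twoRho a)) = (s : ℂ) ^ (-twoRho a) * (s : ℂ) ^ (-twoRho a) := by
    rw [← zpow_add₀ s.ne_zero]; congr 1; ring
  have hq := sq_ne_zero' s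
  have hx : (s : ℂ) ^ (twoRho a) = ((s : ℂ) ^ (-twoRho a))⁻¹ := by
    rw [zpow_neg, inv_inv]
  have hx0 : (s : ℂ) ^ (-twoRho a) ≠ 0 := zpow_ne_zero _ s.ne_zero
  rw [hr]
  rw [hx] at h2
  generalize (s : ℂ) ^ (-twoRho a) = r at *
  -- The relation at `(a', a)` solved for `Q`; the metric coefficients at the two positions are
  -- inverse to each other.
  have h3 : Q = r • (((s : ℂ) ^ 2)⁻¹ • (x a * x a.rev) - (s : ℂ) ^ 2 • (x a.rev * x a))
      - (lam s) • upperForm s x x a.rev := by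
    have := congrArg (fun t => r • t) h2
    simp only [smul_smul, smul_add, smul_sub, mul_left_comm r, mul_inv_cancel₀ hx0] at this
    linear_combination (norm := module) -this
  rw [h3] at h1
  simp only [lam] at h1 ⊢
  linear_combination (norm := (match_scalars <;> (field_simp; ring))) h1

end RowRel

/-! ### Consequences at roots of unity, inner rows and products -/

section RowRel2

variable {n : ℕ} {A B : Type*} [Ring A] [Algebra ℂ A] [Ring B] [Algebra ℂ B] {s : ℂˣ}

/-- Vanishing would make `-1` a power of `s`, whereas powers of `s` have `N`-th power `1` and `(-1)
^ N = -1` for odd `N`. -/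
lemma add_zpow_ne_zero {N : ℕ} (hodd : Odd N) (hs : (s : ℂ) ^ N = 1) (r : ℤ) :
    ((s : ℂ) ^ 2)⁻¹ + (s : ℂ) ^ 2 * (s : ℂ) ^ r ≠ 0 := by
  intro h
  have hz : ∀ m : ℤ, ((s : ℂ) ^ m) ^ N = 1 := fun m => by
    rw [← zpow_natCast, ← zpow_mul, mul_comm, zpow_mul, zpow_natCast, hs, one_zpow]
  have h1 : (s : ℂ) ^ (4 + r) = -1 := by
    have hq := sq_ne_zero' s
    rw [zpow_add₀ s.ne_zero, show ((s : ℂ) ^ (4 : ℤ)) = (s : ℂ) ^ 2 * (s : ℂ) ^ 2 by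
      rw [← pow_add]; norm_cast]
    have := congrArg (fun t => (s : ℂ) ^ 2 * t) h
    simp only [mul_add, mul_inv_cancel₀ hq, mul_zero] at this
    linear_combination this
  have h2 := hz (4 + r)
  rw [h1, hodd.neg_one_pow] at h2
  norm_num at h2

lemma RowRel.pair' {N : ℕ} (hodd : Odd N) (hs : (s : ℂ) ^ N = 1) {x : Fin n → A}
    (h : RowRel s x) {a : Fin n} (ha : a < a.rev) :
    ∃ c : ℂ, x a.rev * x a = x a * x a.rev + c • midForm s x a := by
  have h1 := h.pair ha
  have h0 := add_zpow_ne_zero hodd hs (-(2 * twoRho a))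
  refine ⟨(((s : ℂ) ^ 2)⁻¹ + (s : ℂ) ^ 2 * (s : ℂ) ^ (-(2 * twoRho a)))⁻¹ *
    (lam s * (s : ℂ) ^ (-twoRho a)), ?_⟩
  rw [← smul_smul, ← h1, smul_smul, inv_mul_cancel₀ h0, one_smul]
  abel

/-- For the index next to the middle, `2ρ_a = 1` and the form between `a` and `a'` is the single
square `x_m ^ 2`. This is the relation that feeds the trinomial theorem. -/
lemma RowRel.mid_pair {x : Fin n → A} (h : RowRel s x) (h1 : (1 : ℂ) + (s : ℂ) ^ 2 ≠ 0)
    {a m : Fin n} (hm : m.rev = m) (ham : a.val + 1 = m.val) :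
    x a * x a.rev = x a.rev * x a + ((s : ℂ)⁻¹ * (1 - (s : ℂ) ^ 2)) • x m ^ 2 := by
  have hv : (m.rev).val = m.val := by rw [hm]
  rw [Fin.val_rev] at hv
  have ha : a < a.rev := by rw [Fin.lt_def, Fin.val_rev]; omega
  have hmid : midForm s x a = x m ^ 2 := by
    rw [midForm, Finset.sum_eq_single m]
    · have h2 : a < m ∧ m < a.rev := by
        simp only [Fin.lt_def, Fin.val_rev]; omega
      rw [if_pos h2, twoRho_mid hm, hm, zpow_zero, one_smul, sq]
    · intro l _ hl
      refine if_neg fun h2 => hl ?_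
      simp only [Fin.lt_def, Fin.val_rev] at h2
      ext; omega
    · simp
  have hp := h.pair ha
  have hr : twoRho a = 1 := by
    rw [twoRho_of_lt ha]; omega
  rw [hmid, hr] at hp
  have hs0 := s.ne_zero
  have e1 : (s : ℂ) ^ (-(2 * 1) : ℤ) = ((s : ℂ) ^ 2)⁻¹ := by
    rw [zpow_neg]; norm_cast
  have e2 : (s : ℂ) ^ (-1 : ℤ) = (s : ℂ)⁻¹ := by rw [zpow_neg, zpow_one]
  rw [e1, e2, mul_inv_cancel₀ (sq_ne_zero' s)] at hp
  have h3 : ((s : ℂ) ^ 2)⁻¹ + 1 ≠ 0 := by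
    intro h3; apply h1
    have := congrArg (fun t => (s : ℂ) ^ 2 * t) h3
    simp only [mul_add, mul_inv_cancel₀ (sq_ne_zero' s), mul_zero, mul_one] at this
    exact this
  have hp' := congrArg (fun t => (((s : ℂ) ^ 2)⁻¹ + 1)⁻¹ • t) hp
  simp only [smul_smul, inv_mul_cancel₀ h3, one_smul] at hp'
  have e3 : (((s : ℂ) ^ 2)⁻¹ + 1)⁻¹ * (lam s * (s : ℂ)⁻¹) = -((s : ℂ)⁻¹ * (1 - (s : ℂ) ^ 2)) := by
    rw [inv_mul_eq_iff_eq_mul₀ h3, lam]; field_simp; ring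
  rw [e3] at hp'
  linear_combination (norm := module) -hp'

lemma upperForm_inn (x y : Fin (n + 2) → A) (a : Fin n) :
    upperForm s x y (inn a) = upperForm s (fun k => x (inn k)) (fun k => y (inn k)) a
      + (s : ℂ) ^ (-n : ℤ) • (x 0 * y (Fin.last (n + 1))) := by
  rw [upperForm, sum_inn]
  simp [upperForm, twoRho_last]

lemma lowerForm_inn (x y : Fin (n + 2) → A) (a : Fin n) :
    lowerForm s x y (inn a) = lowerForm s (fun k => x (inn k)) (fun k => y (inn k)) a
      + (s : ℂ) ^ (-n : ℤ) • (x 0 * y (Fin.last (n + 1))) := by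
  rw [lowerForm, sum_inn]
  simp [lowerForm, twoRho_zero, add_comm]

/-- The outer pair contributes the same product `x_0 x_last` to every truncated form at an inner
index, so it is absorbed in `Q`. This is why `RowRel` leaves `Q` unspecified. -/
lemma RowRel.inn {x : Fin (n + 2) → A} (h : RowRel s x) : RowRel s fun k => x (inn k) := by
  obtain ⟨Q, h⟩ := h
  refine ⟨Q + (lam s * (s : ℂ) ^ (-n : ℤ)) • (x 0 * x (Fin.last (n + 1))), fun a b => ?_⟩
  have := h (QSO.inn a) (QSO.inn b)
  rw [rowSide_eq, upperForm_inn] at this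
  rw [rowSide_eq]
  simp only [qd_inn, inn_lt_inn, metricJ_inn] at this
  linear_combination (norm := module) this

/-- The entries of the metric are preserved by a point. -/
lemma IsPoint.sum_metric {z : Matrix (Fin n) (Fin n) A} (h : IsPoint s z) (a b : Fin n) :
    ∑ k, ∑ l, metricJ s k l • (z k a * z l b) = algebraMap ℂ A (metricJ s a b) := by
  have h1 := congrFun (congrFun h.right a.rev) b
  rw [Matrix.mul_apply] at h1
  have h2 : ∑ k, ∑ l, metricJ s k l • (z k a * z l b) =
      ∑ l : Fin n, (s : ℂ) ^ (twoRho l) • (z l.rev a * z l b) := by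
    rw [Finset.sum_comm]
    refine Finset.sum_congr rfl fun l _ => ?_
    rw [Finset.sum_eq_single l.rev]
    · rw [metricJ_rev_left]
    · intro k _ hk; rw [metricJ_of_ne s hk, zero_smul]
    · simp
  rw [h2]
  simp only [metricInv_apply, Fin.rev_rev, twoRho_rev, sub_neg_eq_add, smul_mul_assoc] at h1
  have h3 : ∀ l : Fin n, (s : ℂ) ^ (twoRho l) • (z l.rev a * z l b) =
      (s : ℂ) ^ (-twoRho a) • (s : ℂ) ^ (twoRho l + twoRho a) • (z l.rev a * z l b) := by
    intro l
    rw [smul_smul, ← zpow_add₀ s.ne_zero]; congr 2; ring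
  rw [Finset.sum_congr rfl fun l _ => h3 l, ← Finset.smul_sum, h1]
  by_cases hab : a = b.rev
  · subst hab
    rw [Fin.rev_rev]
    simp [twoRho_rev, Algebra.algebraMap_eq_smul_one, metricJ]
  · rw [metricJ_of_ne s hab, Matrix.one_apply_ne (fun h => hab (by rw [← h, Fin.rev_rev]))]
    simp

lemma sum_four_comm {M : Type*} [AddCommMonoid M] (f : Fin n → Fin n → Fin n → Fin n → M) :
    ∑ i, ∑ j, ∑ k, ∑ l, f i j k l = ∑ k, ∑ l, ∑ i, ∑ j, f i j k l := by
  rw [Finset.sum_congr rfl fun i _ => Finset.sum_comm, Finset.sum_comm]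
  refine Finset.sum_congr rfl fun k _ => ?_
  rw [Finset.sum_congr rfl fun i _ => Finset.sum_comm, Finset.sum_comm]

/-- The FRT relation of `u` carries the R-matrix from the columns of `u` to its rows, hence onto the
pair `x`, `y`; commutation of `y` with `u` separates the factors. -/
lemma rowSide_comm_mul {x y : Fin n → A} {u : Matrix (Fin n) (Fin n) A}
    (hu : IsPoint s u) (hc : ∀ i j k, Commute (y i) (u j k)) (a b : Fin n) :
    rowSide s (fun j => ∑ k, x k * u k j) (fun j => ∑ k, y k * u k j) a b =
      ∑ i, ∑ j, rowSide s x y i j * (u i a * u j b) := by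
  have e1 : ∀ k l, (∑ i, x i * u i k) * (∑ j, y j * u j l) =
      ∑ i, ∑ j, (x i * y j) * (u i k * u j l) := by
    intro k l
    rw [Finset.sum_mul_sum]
    refine Finset.sum_congr rfl fun i _ => Finset.sum_congr rfl fun j _ => ?_
    rw [mul_assoc, ← mul_assoc (u i k), ← (hc j i k).eq]
    simp only [mul_assoc]
  have e2 : rowSide s (fun j => ∑ k, x k * u k j) (fun j => ∑ k, y k * u k j) a b =
      ∑ i, ∑ j, (x i * y j) * rowSide s (u i) (u j) a b := by
    simp only [rowSide, e1, Finset.smul_sum, Finset.mul_sum, mul_smul_comm]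
    exact sum_four_comm _
  rw [e2]
  simp only [hu.sides]
  simp only [colSide, rowSide, Finset.mul_sum, Finset.sum_mul, mul_smul_comm, smul_mul_assoc]
  exact sum_four_comm _

/-- The R-matrix passes through `u`, and the metric multiplying `Q` is preserved by `u`
(`IsPoint.sum_metric`), so the same `Q` serves. -/
lemma RowRel.mul {x : Fin n → A} (h : RowRel s x) {u : Matrix (Fin n) (Fin n) A}
    (hu : IsPoint s u) (hc : ∀ i j k, Commute (x i) (u j k)) :
    RowRel s fun j => ∑ k, x k * u k j := by
  obtain ⟨Q, h⟩ := h
  refine ⟨Q, fun a b => ?_⟩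
  rw [rowSide_comm_mul hu hc]
  simp only [h, add_mul, smul_mul_assoc, Finset.sum_add_distrib]
  congr 1
  · rw [Finset.sum_mul_sum]
    simp only [Finset.smul_sum]
    refine Finset.sum_congr rfl fun i _ => Finset.sum_congr rfl fun j _ => ?_
    rw [mul_assoc, mul_assoc, ← mul_assoc (u i a), ← (hc j i a).eq]
    simp only [mul_assoc]
  · have : ∀ i j, metricJ s i j • (Q * (u i a * u j b)) = Q * (metricJ s i j • (u i a * u j b)) :=
      fun i j => by rw [mul_smul_comm]
    simp only [this, ← Finset.mul_sum, hu.sum_metric]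
    rw [← Algebra.commutes, Algebra.smul_def]

end RowRel2

/-! ### A `q`-trinomial theorem at roots of unity -/

section Trinomial

/-- The quantum integer `(q ^ k - 1) / (q - 1)`. -/
def qint (q : ℂ) (k : ℕ) : ℂ := (q ^ k - 1) / (q - 1)

/-- The quantum factorial. -/
def qfac (q : ℂ) (k : ℕ) : ℂ := ∏ i ∈ Finset.range k, qint q (i + 1)

lemma qfac_succ (q : ℂ) (k : ℕ) : qfac q (k + 1) = qfac q k * qint q (k + 1) :=
  Finset.prod_range_succ ..

@[simp] lemma qfac_zero (q : ℂ) : qfac q 0 = 1 := rfl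

lemma qint_one {q : ℂ} (hq : q ≠ 1) : qint q 1 = 1 := by
  rw [qint, pow_one, div_self (sub_ne_zero.2 hq)]

lemma qint_ne_zero {q : ℂ} {N : ℕ} (hq : IsPrimitiveRoot q N) (hN : 1 < N) {k : ℕ} (h0 : 0 < k)
    (hk : k < N) : qint q k ≠ 0 :=
  div_ne_zero (sub_ne_zero.2 (hq.pow_ne_one_of_pos_of_lt h0.ne' hk)) (sub_ne_zero.2 (hq.ne_one hN))

lemma qfac_ne_zero {q : ℂ} {N : ℕ} (hq : IsPrimitiveRoot q N) (hN : 1 < N) {k : ℕ}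
    (hk : k < N) : qfac q k ≠ 0 :=
  Finset.prod_ne_zero_iff.2 fun i hi =>
    qint_ne_zero hq hN i.succ_pos (by have := Finset.mem_range.1 hi; omega)

lemma qint_add {q : ℂ} (i j : ℕ) : qint q (i + j) = qint q i + q ^ i * qint q j := by
  simp only [qint, pow_add]; ring

lemma qint_sq (q : ℂ) (k : ℕ) :
    qint (q ^ 2) k = qint q k * ((1 + q ^ k) / (1 + q)) := by
  have e1 : q ^ 2 - 1 = (q - 1) * (1 + q) := by ring
  have e2 : (q ^ 2) ^ k - 1 = (q ^ k - 1) * (1 + q ^ k) := by rw [← pow_mul, mul_comm, pow_mul]; ring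
  rw [qint, qint, e1, e2, mul_div_mul_comm]

/-- Evaluate `X ^ N - 1 = ∏ (X - q ^ r)` at `-1`. -/
lemma prod_one_add_pow {q : ℂ} {N : ℕ} (hq : IsPrimitiveRoot q N) (hodd : Odd N) :
    ∏ r ∈ Finset.range N, (1 + q ^ r) = 2 := by
  have hpos : 0 < N := hodd.pos
  have : NeZero N := ⟨hpos.ne'⟩
  have h1 := congrArg (Polynomial.eval (-1)) (Polynomial.X_pow_sub_one_eq_prod hpos hq)
  rw [Polynomial.eval_prod] at h1
  simp only [Polynomial.eval_sub, Polynomial.eval_pow, Polynomial.eval_X, Polynomial.eval_one,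
    Polynomial.eval_C, hodd.neg_one_pow] at h1
  have h2 : ∏ ζ ∈ Polynomial.nthRootsFinset N (1 : ℂ), (-1 - ζ) =
      ∏ r ∈ Finset.range N, (-1 - q ^ r) := by
    have hinj := hq.injOn_pow
    rw [← Finset.prod_image (g := fun r => q ^ r) (f := fun ζ => -1 - ζ)
      (fun a ha b hb h => hinj ha hb h)]
    congr 1
    ext ζ
    rw [Polynomial.mem_nthRootsFinset hpos, Finset.mem_image]
    constructor
    · intro h
      obtain ⟨i, hi, rfl⟩ := hq.eq_pow_of_pow_eq_one h
      exact ⟨i, Finset.mem_range.2 hi, rfl⟩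
    · rintro ⟨i, -, rfl⟩
      rw [← pow_mul, mul_comm, pow_mul, hq.pow_eq_one, one_pow]
  rw [h2] at h1
  have h3 : ∏ r ∈ Finset.range N, (-1 - q ^ r) = -∏ r ∈ Finset.range N, (1 + q ^ r) := by
    have : ∀ r, -1 - q ^ r = (-1) * (1 + q ^ r) := fun r => by ring
    rw [Finset.prod_congr rfl fun r _ => this r, Finset.prod_mul_distrib, Finset.prod_const,
      Finset.card_range, hodd.neg_one_pow, neg_one_mul]
  rw [h3] at h1
  linear_combination h1

lemma one_add_ne_zero {q : ℂ} {N : ℕ} (hq : q ^ N = 1) (hodd : Odd N) : 1 + q ≠ 0 := by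
  intro h
  have h1 : q = -1 := by linear_combination h
  rw [h1, hodd.neg_one_pow] at hq
  norm_num at hq

/-- By `qint_sq` the quotient of the two factorials is a product of `(1 + q ^ r) / (1 + q)`. The
numerators for `1 ≤ r < N` multiply to `1`, as `r = 0` accounts for the whole value `2`. -/
lemma qfac_sq_div {q : ℂ} {N : ℕ} (hq : IsPrimitiveRoot q N) (hodd : Odd N) (hN : 1 < N) :
    qfac (q ^ 2) (N - 1) * (1 + q) ^ (N - 1) = qfac q (N - 1) := by
  have h1 := one_add_ne_zero hq.pow_eq_one hodd
  obtain ⟨M, rfl⟩ : ∃ M, N = M + 1 := ⟨N - 1, by omega⟩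
  have h2 := prod_one_add_pow hq hodd
  rw [Finset.prod_range_succ', pow_zero] at h2
  have h3 : ∏ r ∈ Finset.range M, (1 + q ^ (r + 1)) = 1 := by
    linear_combination (1 / 2) * h2
  simp only [qfac, qint_sq, Finset.prod_mul_distrib, Nat.add_sub_cancel, Finset.prod_div_distrib,
    h3, Finset.prod_const, Finset.card_range]
  field_simp

variable {A : Type*} [Ring A] [Algebra ℂ A]

/-- The sum of `f i j k` over `i + j + k = m`. -/
def tri {M : Type*} [AddCommMonoid M] (m : ℕ) (f : ℕ → ℕ → ℕ → M) : M :=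
  ∑ x ∈ Finset.HasAntidiagonal.antidiagonal m, ∑ y ∈ Finset.HasAntidiagonal.antidiagonal x.2, f x.1 y.1 y.2

section tri
variable {M : Type*} [AddCommMonoid M]

lemma tri_add (m : ℕ) (f g : ℕ → ℕ → ℕ → M) :
    tri m (fun i j k => f i j k + g i j k) = tri m f + tri m g := by
  simp only [tri, Finset.sum_add_distrib]

lemma tri_congr {m : ℕ} {f g : ℕ → ℕ → ℕ → M} (h : ∀ i j k, i + j + k = m → f i j k = g i j k) :
    tri m f = tri m g := by
  refine Finset.sum_congr rfl fun x hx => Finset.sum_congr rfl fun y hy => h _ _ _ ?_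
  rw [Finset.HasAntidiagonal.mem_antidiagonal] at hx hy
  omega

lemma tri_shift_left (m : ℕ) (f : ℕ → ℕ → ℕ → M) (h : ∀ j k, f 0 j k = 0) :
    tri (m + 1) f = tri m fun i j k => f (i + 1) j k := by
  rw [tri, Finset.Nat.sum_antidiagonal_succ]
  simp [h, tri]

lemma tri_shift_mid (m : ℕ) (f : ℕ → ℕ → ℕ → M) (h : ∀ i k, f i 0 k = 0) :
    tri (m + 1) f = tri m fun i j k => f i (j + 1) k := by
  rw [tri, Finset.Nat.sum_antidiagonal_succ']
  simp [h, tri, Finset.Nat.sum_antidiagonal_succ]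

lemma tri_shift_right (m : ℕ) (f : ℕ → ℕ → ℕ → M) (h : ∀ i j, f i j 0 = 0) :
    tri (m + 1) f = tri m fun i j k => f i j (k + 1) := by
  rw [tri, Finset.Nat.sum_antidiagonal_succ']
  simp [h, tri, Finset.Nat.sum_antidiagonal_succ']

lemma tri_extremes {m : ℕ} {f : ℕ → ℕ → ℕ → M}
    (h : ∀ i j k, i + j + k = m + 1 → i ≠ m + 1 → j ≠ m + 1 → k ≠ m + 1 → f i j k = 0) :
    tri (m + 1) f = f 0 0 (m + 1) + f 0 (m + 1) 0 + f (m + 1) 0 0 := by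
  rw [tri, Finset.Nat.sum_antidiagonal_succ', add_comm, Finset.sum_eq_single (0, m)]
  · dsimp only
    rw [Finset.Nat.sum_antidiagonal_succ', Finset.sum_eq_single (0, m)]
    · simp [add_comm]
    · rintro ⟨j, k⟩ hy hne
      rw [Finset.HasAntidiagonal.mem_antidiagonal] at hy
      have : k ≠ m := fun hk => hne (by ext <;> dsimp only at * <;> omega)
      dsimp only at hy ⊢
      exact h _ _ _ (by omega) (by omega) (by omega) (by omega)
    · simp
  · rintro ⟨i, l⟩ hx hne
    rw [Finset.HasAntidiagonal.mem_antidiagonal] at hx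
    refine Finset.sum_eq_zero ?_
    rintro ⟨j, k⟩ hy
    rw [Finset.HasAntidiagonal.mem_antidiagonal] at hy
    have : i ≠ 0 := fun hi => hne (by ext <;> dsimp only at * <;> omega)
    dsimp only at hx hy ⊢
    exact h _ _ _ (by omega) (by omega) (by omega) (by omega)
  · simp

end tri

/-- The shifted sequence `0, u₀, u₁, …`. -/
def shiftSeq (u : ℕ → ℂ) : ℕ → ℂ
  | 0 => 0
  | k + 1 => u k

/-- Left multiplication by `a + t + b` in the normal order `b ^ i t ^ j a ^ k`. Moving `a` past `b ^
(i + 1)` trades one `b` and the new `a` for `t ^ 2`, which accounts for the last summand with `β (i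
+ 1)` and a double shift of `δ`. -/
lemma mul_tri {p μ : ℂ} (hp : p ≠ 1) {a b t : A} (h1 : a * t = p • (t * a)) (h2 : t * b = p • (b * t))
    (h3 : a * b = p • (b * a) + μ • t ^ 2) (β δ α : ℕ → ℂ) (m : ℕ) :
    (a + t + b) * tri m (fun i j k => (β i * δ j * α k) • (b ^ i * t ^ j * a ^ k)) =
      tri (m + 1) fun i j k => (shiftSeq β i * δ j * α k + p ^ i * (β i * shiftSeq δ j * α k)
        + p ^ (i + j) * (β i * δ j * shiftSeq α k)
        + μ * p ^ i * (qint p (i + 1) * β (i + 1) * shiftSeq (shiftSeq δ) j * α k)) •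
          (b ^ i * t ^ j * a ^ k) := by
  have hat : ∀ j, a * t ^ j = p ^ j • (t ^ j * a) := by
    intro j
    induction j with
    | zero => simp
    | succ j ih =>
      rw [pow_succ, ← mul_assoc, ih, smul_mul_assoc, mul_assoc, h1, mul_smul_comm, smul_smul,
        ← pow_succ, mul_assoc]
  have htb : ∀ i, t * b ^ i = p ^ i • (b ^ i * t) := by
    intro j
    induction j with
    | zero => simp
    | succ j ih =>
      rw [pow_succ, ← mul_assoc, ih, smul_mul_assoc, mul_assoc, h2, mul_smul_comm, smul_smul,
        ← pow_succ, mul_assoc]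
  -- Each of the `i + 1` factors `b` passed by `a` yields a term `t ^ 2`; collecting the powers of
  -- `p` gives the quantum integer.
  have hab : ∀ i, a * b ^ (i + 1) = p ^ (i + 1) • (b ^ (i + 1) * a)
      + (μ * p ^ i * qint p (i + 1)) • (b ^ i * t ^ 2) := by
    intro i
    induction i with
    | zero => simp [h3, qint_one hp]
    | succ i ih =>
      have ht2 : t ^ 2 * b = p ^ 2 • (b * t ^ 2) := by
        rw [sq, mul_assoc, h2, mul_smul_comm, ← mul_assoc, h2, smul_mul_assoc, smul_smul, mul_assoc,
          sq]
      rw [pow_succ _ (i + 1), ← mul_assoc, ih, add_mul, smul_mul_assoc, smul_mul_assoc, mul_assoc,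
        mul_assoc (b ^ i), h3, ht2, show i + 1 + 1 = 1 + (i + 1) by ring,
        qint_add 1 (i + 1), qint_one hp]
      simp only [mul_add, smul_add, mul_smul_comm, smul_smul, ← mul_assoc, ← pow_succ, pow_one]
      module
  have e1 : b * tri m (fun i j k => (β i * δ j * α k) • (b ^ i * t ^ j * a ^ k)) =
      tri (m + 1) fun i j k => (shiftSeq β i * δ j * α k) • (b ^ i * t ^ j * a ^ k) := by
    rw [tri_shift_left _ _ (by simp [shiftSeq])]
    simp only [tri, Finset.mul_sum, shiftSeq, mul_smul_comm, ← mul_assoc, ← pow_succ']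
  have e2 : t * tri m (fun i j k => (β i * δ j * α k) • (b ^ i * t ^ j * a ^ k)) =
      tri (m + 1) fun i j k => (p ^ i * (β i * shiftSeq δ j * α k)) • (b ^ i * t ^ j * a ^ k) := by
    rw [tri_shift_mid _ _ (by simp [shiftSeq])]
    simp only [tri, Finset.mul_sum, shiftSeq, mul_smul_comm, ← mul_assoc, htb, smul_mul_assoc,
      smul_smul]
    refine Finset.sum_congr rfl fun x _ => Finset.sum_congr rfl fun y _ => ?_
    rw [mul_assoc _ t, ← pow_succ']
    congr 1; ring
  have e3 : a * tri m (fun i j k => (β i * δ j * α k) • (b ^ i * t ^ j * a ^ k)) =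
      (tri (m + 1) fun i j k => (p ^ (i + j) * (β i * δ j * shiftSeq α k)) • (b ^ i * t ^ j * a ^ k))
      + tri (m + 1) fun i j k => (μ * p ^ i * (qint p (i + 1) * β (i + 1) *
          shiftSeq (shiftSeq δ) j * α k)) • (b ^ i * t ^ j * a ^ k) := by
    -- Reindexing from the target exponent `(i, j + 2)` to the source exponent `(i + 1, j)`; nothing
    -- comes from source exponent `0` of `b`.
    have e4 : (tri (m + 1) fun i j k => (μ * p ^ i * (qint p (i + 1) * β (i + 1) *
          shiftSeq (shiftSeq δ) j * α k)) • (b ^ i * t ^ j * a ^ k)) =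
        tri m fun i j k => match i with
          | 0 => 0
          | i + 1 => (μ * p ^ i * (qint p (i + 1) * β (i + 1) * δ j * α k)) •
              (b ^ i * t ^ (j + 2) * a ^ k) := by
      rw [tri_shift_mid _ _ (by simp [shiftSeq])]
      cases m with
      | zero => simp [tri, shiftSeq]
      | succ m =>
        rw [tri_shift_mid _ _ (by simp [shiftSeq]), tri_shift_left _ _ (by simp)]
        rfl
    rw [e4, tri_shift_right _ _ (by simp [shiftSeq]), ← tri_add]
    simp only [tri, Finset.mul_sum]
    refine Finset.sum_congr rfl fun x _ => Finset.sum_congr rfl fun y _ => ?_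
    rw [mul_smul_comm, ← mul_assoc, ← mul_assoc]
    rcases x with ⟨_ | i, x⟩
    · simp only [pow_zero, one_mul, mul_one, hat, smul_mul_assoc, smul_smul, shiftSeq, zero_add,
        add_zero]
      rw [mul_assoc _ a, ← pow_succ', mul_comm (p ^ _)]
    · simp only [hab, add_mul, smul_mul_assoc, smul_add, smul_smul, shiftSeq]
      rw [mul_assoc _ a, hat, mul_smul_comm, smul_mul_assoc, smul_smul, ← mul_assoc, mul_assoc _ a,
        ← pow_succ', mul_assoc _ (t ^ 2), ← pow_add, add_comm 2]
      congr 2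
      · rw [pow_add p (i + 1)]; ring
      · ring
  rw [add_mul, add_mul, e1, e2, e3]
  simp only [add_smul, tri_add]
  abel

/-- The `N`-th power of a sum of three elements, the outer of which `q ^ 2`-commute up to a multiple
of the square of the middle one. -/
theorem add_add_pow_root {q : ℂ} {N : ℕ} (hq : IsPrimitiveRoot q N) (hodd : Odd N) (hN : 1 < N)
    {a b t : A} (h1 : a * t = q ^ 2 • (t * a)) (h2 : t * b = q ^ 2 • (b * t))
    (h3 : a * b = q ^ 2 • (b * a) + (q * (q - 1) / (1 + q)) • t ^ 2) :
    (a + t + b) ^ N = a ^ N + (2 / (1 + q) ^ N) • t ^ N + b ^ N := by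
  have h1q := one_add_ne_zero hq.pow_eq_one hodd
  have hp : IsPrimitiveRoot (q ^ 2) N := hq.pow_of_coprime 2 (Nat.coprime_two_left.2 hodd)
  have hp1 := hp.ne_one hN
  set μ := q * (q - 1) / (1 + q) with hμ
  -- Divided powers: the outer variables use factorials at `q ^ 2`, the middle one at `q`. Both are
  -- cut off at `N`, where the factorials vanish.
  set β : ℕ → ℂ := fun i => if i < N then (qfac (q ^ 2) i)⁻¹ else 0 with hβ
  set δ : ℕ → ℂ := fun i => if i < N then (qfac q i)⁻¹ else 0 with hδ
  have hβs : ∀ i, i < N → shiftSeq β i = qint (q ^ 2) i * β i := by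
    intro i hi
    cases i with
    | zero => simp [shiftSeq, qint]
    | succ i =>
      have := qint_ne_zero hp hN i.succ_pos hi
      simp only [shiftSeq, hβ, if_pos hi, if_pos (show i < N by omega), qfac_succ]
      field_simp
  have hδs : ∀ i, i < N → shiftSeq δ i = qint q i * δ i := by
    intro i hi
    cases i with
    | zero => simp [shiftSeq, qint]
    | succ i =>
      have := qint_ne_zero hq hN i.succ_pos hi
      simp only [shiftSeq, hδ, if_pos hi, if_pos (show i < N by omega), qfac_succ]
      field_simp
  -- The value of `μ` is exactly what makes `1 + μ [j-1]_q = (1 + q ^ j) / (1 + q)`, turning `[j]_q`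
  -- into `[j]_{q²}`.
  have hδ2 : ∀ j, j < N → shiftSeq δ j + μ * shiftSeq (shiftSeq δ) j = qint (q ^ 2) j * δ j := by
    intro j hj
    have hq1 := sub_ne_zero.2 (hq.ne_one hN)
    cases j with
    | zero => simp [shiftSeq, qint]
    | succ j =>
      have e : shiftSeq (shiftSeq δ) (j + 1) = shiftSeq δ j := rfl
      have e' : shiftSeq δ (j + 1) = δ j := rfl
      have := hδs (j + 1) hj
      rw [e'] at this
      rw [e, hδs j (by omega), e', this, qint_sq, hμ, qint, qint]
      field_simp
      ring
  have hcoef : ∀ i j k m, i < N → j < N → k < N → m ≤ N → i + j + k = m →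
      shiftSeq β i * δ j * β k + (q ^ 2) ^ i * (β i * shiftSeq δ j * β k)
        + (q ^ 2) ^ (i + j) * (β i * δ j * shiftSeq β k)
        + μ * (q ^ 2) ^ i * (qint (q ^ 2) (i + 1) * β (i + 1) * shiftSeq (shiftSeq δ) j * β k) =
      qint (q ^ 2) m * (β i * δ j * β k) := by
    intro i j k m hi hj hk hmN hm
    -- At the cutoff `i + 1 = N` the bound on the total degree forces `j ≤ 1`, where the double
    -- shift of `δ` is zero.
    have h4 : qint (q ^ 2) (i + 1) * β (i + 1) * shiftSeq (shiftSeq δ) j =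
        β i * shiftSeq (shiftSeq δ) j := by
      rcases lt_or_ge (i + 1) N with h | h
      · rw [← hβs _ h]; rfl
      · have : j = 0 ∨ j = 1 := by omega
        rcases this with rfl | rfl <;> simp [shiftSeq]
    rw [h4, hβs i hi, hβs k hk, ← hm, qint_add (i + j) k, qint_add i j]
    linear_combination (q ^ 2) ^ i * β i * β k * hδ2 j hj
  -- Below degree `N` this is the q-trinomial formula in divided powers.
  have hpow : ∀ m, m < N → (a + t + b) ^ m = qfac (q ^ 2) m •
      tri m (fun i j k => (β i * δ j * β k) • (b ^ i * t ^ j * a ^ k)) := by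
    intro m
    induction m with
    | zero => intro _; simp [tri, hβ, hδ, show 0 < N by omega]
    | succ m ih =>
      intro hm
      rw [pow_succ', ih (by omega), mul_smul_comm, mul_tri hp1 h1 h2 h3, qfac_succ, mul_smul]
      congr 1
      have : ∀ f : ℕ → ℕ → ℕ → A, qint (q ^ 2) (m + 1) • tri (m + 1) f =
          tri (m + 1) fun i j k => qint (q ^ 2) (m + 1) • f i j k := by
        intro f; simp only [tri, Finset.smul_sum]
      rw [this]
      refine tri_congr fun i j k h => ?_
      rw [hcoef i j k (m + 1) (by omega) (by omega) (by omega) hm.le h, mul_smul]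
  obtain ⟨M, rfl⟩ : ∃ M, N = M + 1 := ⟨N - 1, by omega⟩
  have hM : 0 < M := by omega
  have hf := qfac_ne_zero hp hN (show M < M + 1 by omega)
  have hf' := qfac_ne_zero hq hN (show M < M + 1 by omega)
  have hfd := qfac_sq_div hq hodd hN
  rw [Nat.add_sub_cancel] at hfd
  have hβ0 : β 0 = 1 := by simp [hβ]
  have hδ0 : δ 0 = 1 := by simp [hδ]
  have hβM : β M = (qfac (q ^ 2) M)⁻¹ := by simp [hβ]
  have hδM : δ M = (qfac q M)⁻¹ := by simp [hδ]
  have hβN : β (M + 1) = 0 := by simp [hβ]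
  have hδN : δ (M + 1) = 0 := by simp [hδ]
  have hβ1 : β 1 = 1 := by simp [hβ, hM.ne', qfac, qint_one hp1]
  have hqN : qint (q ^ 2) (M + 1) = 0 := by rw [qint, hp.pow_eq_one, sub_self, zero_div]
  rw [pow_succ', hpow M (by omega), mul_smul_comm, mul_tri hp1 h1 h2 h3]
  set f : ℕ → ℕ → ℕ → ℂ := fun i j k => shiftSeq β i * δ j * β k
    + (q ^ 2) ^ i * (β i * shiftSeq δ j * β k) + (q ^ 2) ^ (i + j) * (β i * δ j * shiftSeq β k)
    + μ * (q ^ 2) ^ i * (qint (q ^ 2) (i + 1) * β (i + 1) * shiftSeq (shiftSeq δ) j * β k) with hfdef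
  have key : tri (M + 1) (fun i j k => f i j k • (b ^ i * t ^ j * a ^ k)) =
      f 0 0 (M + 1) • a ^ (M + 1) + f 0 (M + 1) 0 • t ^ (M + 1) + f (M + 1) 0 0 • b ^ (M + 1) := by
    -- In degree `N` every exponent triple other than the three pure powers carries the factor
    -- `[N]_{q²} = 0`. The pure powers meet the cutoff and are computed separately.
    have hz : ∀ i j k, i + j + k = M + 1 → i ≠ M + 1 → j ≠ M + 1 → k ≠ M + 1 → f i j k = 0 := by
      intro i j k h hi hj hk
      simp only [hfdef]
      rw [hcoef i j k (M + 1) (by omega) (by omega) (by omega) le_rfl h, hqN, zero_mul]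
    rw [tri_extremes fun i j k h h1 h2 h3 => by rw [hz i j k h h1 h2 h3, zero_smul]]
    simp only [pow_zero, one_mul, mul_one]
  rw [key]
  have s0 : shiftSeq β 0 = 0 := rfl
  have s1 : shiftSeq δ 0 = 0 := rfl
  have s2 : shiftSeq (shiftSeq δ) 0 = 0 := rfl
  have s3 : shiftSeq β (M + 1) = β M := rfl
  have s4 : shiftSeq δ (M + 1) = δ M := rfl
  have s5 : shiftSeq (shiftSeq δ) (M + 1) = shiftSeq δ M := rfl
  have k1 : f 0 0 (M + 1) = (qfac (q ^ 2) M)⁻¹ := by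
    simp [hfdef, s0, s1, s2, s3, hβ0, hδ0, hβM]
  have k2 : f (M + 1) 0 0 = (qfac (q ^ 2) M)⁻¹ := by
    simp [hfdef, s0, s1, s2, s3, hβ0, hδ0, hβM]
  -- The coefficient of `t ^ N` is `(1 + μ [N-1]_q) / [N-1]_q!`. The bracket equals `2 / (1 + q)`
  -- because `q ^ N = 1`, and `qfac_sq_div` converts the factorial.
  have k3 : f 0 (M + 1) 0 = (qfac (q ^ 2) M)⁻¹ * (2 / (1 + q) ^ (M + 1)) := by
    have hqM : q ^ M * q = 1 := by rw [← pow_succ, hq.pow_eq_one]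
    have hq1 := sub_ne_zero.2 (hq.ne_one hN)
    have e : 1 + μ * qint q M = 2 / (1 + q) := by
      rw [hμ, qint]; field_simp; linear_combination hqM
    simp only [hfdef, s0, s4, s5, hβ0, hβ1, hδs M (by omega), hδM, zero_add, pow_zero,
      qint_one hp1, one_mul, mul_one, mul_zero, zero_mul, add_zero]
    rw [← hfd, show (qfac (q ^ 2) M * (1 + q) ^ M)⁻¹ + μ * (qint q M *
      (qfac (q ^ 2) M * (1 + q) ^ M)⁻¹) = (qfac (q ^ 2) M * (1 + q) ^ M)⁻¹ * (1 + μ * qint q M) by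
        ring, e]
    field_simp
    ring
  rw [k1, k2, k3]
  simp only [smul_add, smul_smul]
  rw [← mul_assoc, mul_inv_cancel₀ hf]
  simp

end Trinomial

/-! ### Block embedding of points -/

section Block

variable {n : ℕ} {A B : Type*} [Ring A] [Ring B]

/-- The function on `Fin (n + 2)` with given values at the first, inner and last indices. -/
def ext3 {α : Type*} (a : α) (f : Fin n → α) (c : α) : Fin (n + 2) → α :=
  Fin.snoc (α := fun _ => α) (Fin.cons (α := fun _ => α) a f) c

@[simp] lemma ext3_zero {α : Type*} (a : α) (f : Fin n → α) (c : α) : ext3 a f c 0 = a := by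
  rw [ext3, show (0 : Fin (n + 2)) = Fin.castSucc 0 from rfl, Fin.snoc_castSucc, Fin.cons_zero]

@[simp] lemma ext3_inn {α : Type*} (a : α) (f : Fin n → α) (c : α) (k : Fin n) :
    ext3 a f c (inn k) = f k := by
  rw [ext3, inn, Fin.snoc_castSucc, Fin.cons_succ]

@[simp] lemma ext3_last {α : Type*} (a : α) (f : Fin n → α) (c : α) :
    ext3 a f c (Fin.last (n + 1)) = c := Fin.snoc_last _ _

/-- The block diagonal matrix `diag(1, w, 1)`. -/
def bd (w : Matrix (Fin n) (Fin n) A) : Matrix (Fin (n + 2)) (Fin (n + 2)) A :=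
  ext3 (ext3 1 0 0) (fun i => ext3 0 (w i) 0) (ext3 0 0 1)

@[simp] lemma bd_zero (w : Matrix (Fin n) (Fin n) A) : bd w 0 = ext3 1 0 0 := ext3_zero ..
@[simp] lemma bd_inn (w : Matrix (Fin n) (Fin n) A) (i : Fin n) :
    bd w (inn i) = ext3 0 (w i) 0 := ext3_inn ..
@[simp] lemma bd_last (w : Matrix (Fin n) (Fin n) A) : bd w (Fin.last _) = ext3 0 0 1 :=
  ext3_last ..

variable [Algebra ℂ A] [Algebra ℂ B] {s : ℂˣ}

/-- The quadratic form `∑_l J_{l'l} x_{l'} y_l`. -/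
def fullForm (s : ℂˣ) (x y : Fin n → A) : A :=
  ∑ l, (s : ℂ) ^ twoRho l • (x l.rev * y l)

lemma fullForm_eq (x y : Fin n → A) :
    fullForm s x y = ∑ k : Fin n, (s : ℂ) ^ (-twoRho k) • (x k * y k.rev) := by
  rw [fullForm, ← Equiv.sum_comp Fin.revPerm]
  simp [twoRho_rev]

lemma fullForm_sum_inn (x y : Fin (n + 2) → A) :
    fullForm s x y = (s : ℂ) ^ (n : ℤ) • (x (Fin.last _) * y 0)
      + fullForm s (fun k => x (inn k)) (fun k => y (inn k))
      + (s : ℂ) ^ (-n : ℤ) • (x 0 * y (Fin.last _)) := by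
  rw [fullForm, sum_inn]
  simp [fullForm, twoRho_zero, twoRho_last]

lemma upperForm_zero (x y : Fin (n + 2) → A) :
    upperForm s x y 0 = fullForm s (fun k => x (inn k)) (fun k => y (inn k))
      + (s : ℂ) ^ (-n : ℤ) • (x 0 * y (Fin.last (n + 1))) := by
  rw [upperForm, sum_inn]
  simp [fullForm, twoRho_last]

lemma upperForm_last (x y : Fin (n + 2) → A) : upperForm s x y (Fin.last _) = 0 := by
  simp [upperForm]

lemma lowerForm_last (x y : Fin (n + 2) → A) :
    lowerForm s x y (Fin.last _) = fullForm s (fun k => x (inn k)) (fun k => y (inn k))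
      + (s : ℂ) ^ (-n : ℤ) • (x 0 * y (Fin.last (n + 1))) := by
  rw [lowerForm, sum_inn]
  simp [fullForm_eq, twoRho_zero, add_comm]

lemma lowerForm_zero (x y : Fin (n + 2) → A) : lowerForm s x y 0 = 0 := by
  simp [lowerForm]

lemma IsPoint.fullForm_col {z : Matrix (Fin n) (Fin n) A} (h : IsPoint s z) (a b : Fin n) :
    fullForm s (fun k => z k a) (fun k => z k b) = algebraMap ℂ A (metricJ s a b) := by
  rw [← h.sum_metric, Finset.sum_comm, fullForm]
  refine Finset.sum_congr rfl fun l _ => ?_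
  rw [Finset.sum_eq_single l.rev]
  · rw [metricJ_rev_left]
  · intro k _ hk; rw [metricJ_of_ne s hk, zero_smul]
  · simp

lemma IsPoint.fullForm_row {z : Matrix (Fin n) (Fin n) A} (h : IsPoint s z) (i j : Fin n) :
    fullForm s (z i) (z j) = algebraMap ℂ A (metricJ s i j) := by
  have h1 := congrFun (congrFun h.left i) j.rev
  rw [metricL_eq, Matrix.mul_apply] at h1
  simp only [metricInv_apply, Fin.rev_rev, twoRho_rev, mul_smul_comm] at h1
  have h3 : ∀ l : Fin n, (s : ℂ) ^ (-twoRho l) • (z i l * z j l.rev) =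
      (s : ℂ) ^ (twoRho j) • (s : ℂ) ^ (-twoRho j - twoRho l) • (z i l * z j l.rev) := by
    intro l
    rw [smul_smul, ← zpow_add₀ s.ne_zero]; congr 2; ring
  rw [fullForm_eq, Finset.sum_congr rfl fun l _ => h3 l, ← Finset.smul_sum, h1]
  by_cases hab : i = j.rev
  · subst hab
    simp [twoRho_rev, Algebra.algebraMap_eq_smul_one, metricJ]
  · rw [metricJ_of_ne s hab, Matrix.one_apply_ne hab]
    simp

@[simp] lemma qd_zero_zero : qd s (0 : Fin (n + 2)) 0 = (s : ℂ) ^ 2 := by simp [qd]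
@[simp] lemma qd_last_last : qd s (Fin.last (n + 1)) (Fin.last (n + 1)) = (s : ℂ) ^ 2 := by
  simp [qd]
@[simp] lemma qd_zero_last : qd s (0 : Fin (n + 2)) (Fin.last (n + 1)) = ((s : ℂ) ^ 2)⁻¹ := by
  simp [qd]
@[simp] lemma qd_last_zero : qd s (Fin.last (n + 1)) (0 : Fin (n + 2)) = ((s : ℂ) ^ 2)⁻¹ := by
  simp [qd]
@[simp] lemma qd_zero_inn (k : Fin n) : qd s 0 (inn k) = 1 := by simp [qd]
@[simp] lemma qd_inn_zero (k : Fin n) : qd s (inn k) 0 = 1 := by simp [qd]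
@[simp] lemma qd_last_inn (k : Fin n) : qd s (Fin.last (n + 1)) (inn k) = 1 := by simp [qd]
@[simp] lemma qd_inn_last (k : Fin n) : qd s (inn k) (Fin.last (n + 1)) = 1 := by simp [qd]

@[simp] lemma metricJ_zero_last : metricJ s (0 : Fin (n + 2)) (Fin.last (n + 1)) =
    (s : ℂ) ^ (-n : ℤ) := by
  simp [metricJ, twoRho_zero]
@[simp] lemma metricJ_last_zero : metricJ s (Fin.last (n + 1)) (0 : Fin (n + 2)) =
    (s : ℂ) ^ (n : ℤ) := by
  simp [metricJ, twoRho_last]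
@[simp] lemma metricJ_zero_zero : metricJ s (0 : Fin (n + 2)) 0 = 0 := by simp [metricJ]
@[simp] lemma metricJ_last_last : metricJ s (Fin.last (n + 1)) (Fin.last (n + 1)) = 0 := by
  simp [metricJ]
@[simp] lemma metricJ_zero_inn (k : Fin n) : metricJ s 0 (inn k) = 0 := by simp [metricJ]
@[simp] lemma metricJ_inn_zero (k : Fin n) : metricJ s (inn k) 0 = 0 := by simp [metricJ]
@[simp] lemma metricJ_last_inn (k : Fin n) : metricJ s (Fin.last (n + 1)) (inn k) = 0 := by
  simp [metricJ]
@[simp] lemma metricJ_inn_last (k : Fin n) : metricJ s (inn k) (Fin.last (n + 1)) = 0 := by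
  simp [metricJ]

@[simp] lemma fullForm_zero_left' (y : Fin n → A) : fullForm s (fun _ => (0 : A)) y = 0 := by
  simp [fullForm]
@[simp] lemma fullForm_zero_right' (y : Fin n → A) : fullForm s y (fun _ => (0 : A)) = 0 := by
  simp [fullForm]

lemma lowerForm_zero_left (y : Fin n → A) (j : Fin n) : lowerForm s (fun _ => (0 : A)) y j = 0 := by
  simp [lowerForm]
lemma lowerForm_zero_right (y : Fin n → A) (j : Fin n) : lowerForm s y (fun _ => (0 : A)) j = 0 := by
  simp [lowerForm]
lemma upperForm_zero_left (y : Fin n → A) (j : Fin n) : upperForm s (fun _ => (0 : A)) y j = 0 := by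
  simp [upperForm]
lemma upperForm_zero_right (y : Fin n → A) (j : Fin n) : upperForm s y (fun _ => (0 : A)) j = 0 := by
  simp [upperForm]

lemma frt_of_sides {z : Matrix (Fin n) (Fin n) A}
    (h : ∀ i j a b, rowSide s (z i) (z j) a b = colSide s (fun k => z k a) (fun k => z k b) i j)
    (i b j a : Fin n) : frt s z i b j a = 0 := by
  rw [frt_eq, h, sub_self]

lemma metricInv_bd (w : Matrix (Fin n) (Fin n) A) : metricInv s (bd w) = bd (metricInv s w) := by
  ext i j
  rw [metricInv_apply]
  revert i j; refine inn_cases ?_ ?_ (fun i => ?_) <;>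
  refine inn_cases ?_ ?_ (fun j => ?_) <;>
  simp [metricInv_apply]

lemma bd_mul (w w' : Matrix (Fin n) (Fin n) A) : bd w * bd w' = bd (w * w') := by
  ext i j
  rw [Matrix.mul_apply, sum_inn]
  revert i j; refine inn_cases ?_ ?_ (fun i => ?_) <;>
  refine inn_cases ?_ ?_ (fun j => ?_) <;>
  simp [Matrix.mul_apply]

lemma bd_one : bd (1 : Matrix (Fin n) (Fin n) A) = 1 := by
  ext i j
  revert i j; refine inn_cases ?_ ?_ (fun i => ?_) <;>
  refine inn_cases ?_ ?_ (fun j => ?_) <;>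
  simp [Matrix.one_apply]

lemma bd_map (f : A → B) (h0 : f 0 = 0) (h1 : f 1 = 1) (w : Matrix (Fin n) (Fin n) A) :
    (bd w).map f = bd (w.map f) := by
  ext i j
  revert i j; refine inn_cases ?_ ?_ (fun i => ?_) <;>
  refine inn_cases ?_ ?_ (fun j => ?_) <;>
  simp [h0, h1]

/-- Since `ρ` is stable, the inner relations are those of `w`. The relations pairing an outer
conjugate pair with inner indices involve a full quadratic form of rows or columns of `w`, whose
value is the metric by orthogonality. -/
lemma IsPoint.bd {w : Matrix (Fin n) (Fin n) A} (h : IsPoint s w) : IsPoint s (bd w) where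
  frt := by
    refine frt_of_sides fun i j a b => ?_
    rw [rowSide_eq, colSide_eq]
    revert i j a b
    refine inn_cases ?_ ?_ (fun i => ?_) <;>
    refine inn_cases ?_ ?_ (fun j => ?_) <;>
    refine inn_cases ?_ ?_ (fun a => ?_) <;>
    refine inn_cases ?_ ?_ (fun b => ?_) <;>
    simp [upperForm_zero, upperForm_last, lowerForm_zero, lowerForm_last, upperForm_inn,
      lowerForm_inn, lowerForm_zero_left, lowerForm_zero_right, upperForm_zero_left,
      upperForm_zero_right]
    · rw [h.fullForm_col, Algebra.algebraMap_eq_smul_one, smul_smul, smul_smul]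
      congr 1; ring
    · have := h.fullForm_row i j
      rw [show (fun k => w i k) = w i from rfl, show (fun k => w j k) = w j from rfl, this,
        Algebra.algebraMap_eq_smul_one, smul_smul, smul_smul]
      congr 1; ring
    · have := h.sides i j a b
      rwa [rowSide_eq, colSide_eq] at this
  left := by rw [metricL_eq, metricInv_bd, bd_mul, ← metricL_eq, h.left, bd_one]
  right := by rw [metricInv_bd, bd_mul, h.right, bd_one]
  tri := by
    refine inn_cases ?_ ?_ (fun i => ?_) <;>
    refine inn_cases ?_ ?_ (fun j => ?_) <;>
    simp
    exact h.tri i j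
  mid := by
    refine inn_cases ?_ ?_ (fun i => ?_) <;> simp
    exact h.mid i

end Block

/-! ### Points compatible with `N`-th powers -/

section Frobenius

/-- The running assumptions: `s` is the square root of order `N` of a primitive root of unity `s ^ 2`
of odd order `N > 1`. -/
structure IsOddRoot (s : ℂˣ) (N : ℕ) : Prop where
  odd : Odd N
  one_lt : 1 < N
  prim : IsPrimitiveRoot ((s : ℂ) ^ 2) N
  pow : (s : ℂ) ^ N = 1

variable {n N : ℕ} {s : ℂˣ}

lemma IsOddRoot.one_add_ne (hN : IsOddRoot s N) : 1 + (s : ℂ) ^ 2 ≠ 0 :=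
  one_add_ne_zero hN.prim.pow_eq_one hN.odd

lemma IsOddRoot.zpow_pow (hN : IsOddRoot s N) (m : ℤ) : ((s : ℂ) ^ m) ^ N = 1 := by
  rw [← zpow_natCast, ← zpow_mul, mul_comm, zpow_mul, zpow_natCast, hN.pow, one_zpow]

/-- The scalar `(1 + q) ^ N / 2`. -/
def gam (s : ℂˣ) (N : ℕ) : ℂ := (1 + (s : ℂ) ^ 2) ^ N / 2

lemma IsOddRoot.gam_ne_zero (hN : IsOddRoot s N) : gam s N ≠ 0 :=
  div_ne_zero (pow_ne_zero _ hN.one_add_ne) two_ne_zero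

/-- The factor of `z_{ij} ^ N`: it is `(1 + q) ^ N / 2` if the middle index is strictly between
`i` and `j`. -/
def powScale (N : ℕ) (s : ℂˣ) (i j : Fin n) : ℂ :=
  if ∃ k : Fin n, k.rev = k ∧ i < k ∧ k < j then gam s N else 1

/-- The factor for the entries of a row: `(1 + q) ^ N / 2` beyond the middle index. -/
def rowScale (N : ℕ) (s : ℂˣ) (j : Fin n) : ℂ :=
  if ∃ k : Fin n, k.rev = k ∧ k < j then gam s N else 1

lemma eq_mid {i k : Fin n} (hi : i.rev = i) (hk : k.rev = k) : i = k := by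
  have h1 := congrArg Fin.val hi
  have h2 := congrArg Fin.val hk
  rw [Fin.val_rev] at h1 h2
  ext; omega

/-- Reversal fixes the middle index and exchanges the two conditions on it. -/
lemma powScale_rev (i j : Fin n) : powScale N s j.rev i.rev = powScale N s i j := by
  have : (∃ k : Fin n, k.rev = k ∧ j.rev < k ∧ k < i.rev) ↔ ∃ k : Fin n, k.rev = k ∧ i < k ∧ k < j := by
    refine exists_congr fun k => and_congr_right fun hk => ?_
    have h1 : j.rev < k ↔ k < j := by
      rw [← Fin.rev_lt_rev, Fin.rev_rev, hk]
    have h2 : k < i.rev ↔ i < k := by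
      rw [← Fin.rev_lt_rev, Fin.rev_rev, hk]
    rw [h1, h2, and_comm]
  simp only [powScale, this]

@[simp] lemma exists_mid_inn {P : Fin (n + 2) → Prop} :
    (∃ k : Fin (n + 2), k.rev = k ∧ P k) ↔ ∃ k : Fin n, k.rev = k ∧ P (inn k) := by
  constructor
  · rintro ⟨k, hk, hP⟩
    revert k
    refine inn_cases ?_ ?_ (fun k => ?_)
    · simp
    · simp
    · intro hk hP
      exact ⟨k, by simpa using hk, hP⟩
  · rintro ⟨k, hk, hP⟩
    exact ⟨inn k, by simp [hk], hP⟩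

@[simp] lemma powScale_inn (i j : Fin n) : powScale N s (inn i) (inn j) = powScale N s i j := by
  simp only [powScale, exists_mid_inn, inn_lt_inn]

@[simp] lemma rowScale_inn (j : Fin n) : rowScale N s (inn j) = rowScale N s j := by
  simp only [rowScale, exists_mid_inn, inn_lt_inn]

lemma rowScale_zero : rowScale N s (0 : Fin (n + 2)) = 1 := by
  simp [rowScale]

variable {A B : Type} [Ring A] [Algebra ℂ A] [Ring B] [Algebra ℂ B]

/-- The matrix of the rescaled `N`-th powers of the entries. -/
def powMat (N : ℕ) (s : ℂˣ) (z : Matrix (Fin n) (Fin n) A) : Matrix (Fin n) (Fin n) A :=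
  Matrix.of fun i j => powScale N s i j • z i j ^ N

lemma powMat_apply (z : Matrix (Fin n) (Fin n) A) (i j : Fin n) :
    powMat N s z i j = powScale N s i j • z i j ^ N := rfl

lemma powMat_map (φ : A →ₐ[ℂ] B) (z : Matrix (Fin n) (Fin n) A) :
    powMat N s (z.map φ) = (powMat N s z).map φ := by
  ext i j; simp [powMat_apply]

/-- The inverse of a point, with entries in the opposite algebra. -/
def opPoint (s : ℂˣ) (z : Matrix (Fin n) (Fin n) A) : Matrix (Fin n) (Fin n) Aᵐᵒᵖ :=
  (metricInv s z).map MulOpposite.op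

lemma opPoint_apply (z : Matrix (Fin n) (Fin n) A) (i j : Fin n) :
    opPoint s z i j = MulOpposite.op ((s : ℂ) ^ (twoRho j - twoRho i) • z j.rev i.rev) := by
  rw [opPoint, Matrix.map_apply, metricInv_apply]

/-- The powers of `s` in the antipode disappear on `N`-th powers since `s ^ N = 1`. -/
lemma powMat_opPoint (hN : IsOddRoot s N) (z : Matrix (Fin n) (Fin n) A) (i j : Fin n) :
    powMat N s (opPoint s z) i j = MulOpposite.op (powMat N s z j.rev i.rev) := by
  rw [powMat_apply, opPoint_apply, powMat_apply, ← MulOpposite.op_pow, ← MulOpposite.op_smul,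
    smul_pow, hN.zpow_pow, one_smul, powScale_rev]

lemma opPoint_map (φ : A →ₐ[ℂ] B) (z : Matrix (Fin n) (Fin n) A) :
    opPoint s (z.map φ) = (opPoint s z).map φ.op := by
  ext i j
  simp [opPoint_apply]

/-- Multiplication of rows by `z` is compatible with (rescaled) `N`-th powers. -/
def RowFrob (N : ℕ) (s : ℂˣ) (z : Matrix (Fin n) (Fin n) A) : Prop :=
  ∀ (B : Type) [Ring B] [Algebra ℂ B] (φ : A →ₐ[ℂ] B) (x : Fin n → B), RowRel s x →
    (∀ i a, Commute (x i) (φ a)) → ∀ j,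
      rowScale N s j • (∑ k, x k * φ (z k j)) ^ N =
        ∑ k, (rowScale N s k • x k ^ N) * φ (powMat N s z k j)

/-- A point whose multiplication with other points is compatible with `N`-th powers. -/
structure FrobPoint (N : ℕ) (s : ℂˣ) (z : Matrix (Fin n) (Fin n) A) : Prop where
  point : IsPoint s z
  comm : ∀ i j k l, Commute (powMat N s z i j) (powMat N s z k l)
  row : RowFrob N s z
  opRow : RowFrob N s (opPoint s z)

lemma RowFrob.map {z : Matrix (Fin n) (Fin n) A} (h : RowFrob N s z) (φ : A →ₐ[ℂ] B) :
    RowFrob N s (z.map φ) := by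
  intro C _ _ ψ x hx hc j
  have := h C (ψ.comp φ) x hx (fun i a => hc i _) j
  rw [powMat_map]
  exact this

lemma FrobPoint.map {z : Matrix (Fin n) (Fin n) A} (h : FrobPoint N s z) (φ : A →ₐ[ℂ] B) :
    FrobPoint N s (z.map φ) where
  point := h.point.map φ
  comm i j k l := by
    rw [powMat_map]
    exact (h.comm i j k l).map φ
  row := h.row.map φ
  opRow := by
    rw [opPoint_map]
    exact h.opRow.map φ.op

/-- Row `i` of `u` is a quantum Euclidean row, so only the scale of a row has to be compared with
the scale of the matrix entries. The two agree for `i < i'` and differ by a common factor on the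
relevant entries for `i > i'`. -/
lemma RowFrob.powMat_row (hN : IsOddRoot s N) {u : Matrix (Fin n) (Fin n) B}
    {v₀ : Matrix (Fin n) (Fin n) A} {φ : A →ₐ[ℂ] B} (hu : IsPoint s u) (hvp : IsPoint s v₀)
    (hv : RowFrob N s v₀) (hc : ∀ i j a, Commute (u i j) (φ a)) {i : Fin n} (hi : i ≠ i.rev)
    (j : Fin n) : powMat N s (u * v₀.map φ) i j =
      ∑ k, powMat N s u i k * powMat N s (v₀.map φ) k j := by
  have h := hv B φ (u i) (hu.rowRel hi) (fun a b => hc i a b) j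
  replace hvp := hvp.map φ
  have hmap : ∀ k j, φ (powMat N s v₀ k j) = powMat N s (v₀.map φ) k j := by
    intro k j; rw [powMat_map, Matrix.map_apply]
  simp only [hmap] at h
  have hmap' : ∀ k j, φ (v₀ k j) = (v₀.map φ) k j := fun _ _ => rfl
  simp only [hmap'] at h
  generalize v₀.map φ = v at *
  rw [powMat_apply, Matrix.mul_apply]
  have hval := Fin.val_rev i
  have hne : i.val ≠ i.rev.val := fun h => hi (Fin.ext h)
  rcases lt_or_gt_of_ne hi with hlt | hgt
  · have e : ∀ k, powScale N s i k = rowScale N s k := by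
      intro k
      have : ∀ m : Fin n, (m.rev = m ∧ i < m ∧ m < k) ↔ (m.rev = m ∧ m < k) := by
        intro m
        refine and_congr_right fun hm => and_iff_right_of_imp fun _ => ?_
        have h1 := congrArg Fin.val hm
        rw [Fin.val_rev] at h1
        rw [Fin.lt_def] at hlt ⊢
        omega
      simp only [powScale, rowScale, this]
    simp only [e, powMat_apply (z := u), h]
  · have e : ∀ k, powScale N s i k = 1 := by
      intro k
      refine if_neg ?_
      rintro ⟨m, hm, h1, -⟩
      have h2 := congrArg Fin.val hm
      rw [Fin.val_rev] at h2
      rw [Fin.lt_def] at hgt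
      rw [Fin.lt_def] at h1
      omega
    by_cases hmid : ∃ k : Fin n, k.rev = k
    · obtain ⟨m, hm⟩ := hmid
      have hmi : m < i := by
        have h2 := congrArg Fin.val hm
        rw [Fin.val_rev] at h2
        rw [Fin.lt_def] at hgt
        rw [Fin.lt_def]
        omega
      -- On the triangular support of row `i` the row scale is constantly `gam`, a nonzero factor to
      -- be cancelled.
      have er : ∀ k, i ≤ k → rowScale N s k = gam s N := fun k hk => if_pos ⟨m, hm, hmi.trans_le hk⟩
      have e2 : ∀ k, (rowScale N s k • u i k ^ N) * powMat N s v k j =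
          gam s N • (powMat N s u i k * powMat N s v k j) := by
        intro k
        rw [powMat_apply (z := u), e, one_smul]
        rcases lt_or_ge k i with hk | hk
        · rw [hu.tri i k hk, zero_pow (by have := hN.one_lt; omega)]; simp
        · rw [er k hk, smul_mul_assoc]
      rw [Finset.sum_congr rfl fun k _ => e2 k, ← Finset.smul_sum] at h
      rcases lt_or_ge j i with hj | hj
      · have hN0 : N ≠ 0 := by have := hN.one_lt; omega
        have hz : ∀ k, u i k = 0 ∨ v k j = 0 := by
          intro k
          rcases lt_or_ge k i with hk | hk
          · exact Or.inl (hu.tri i k hk)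
          · exact Or.inr (hvp.tri k j (hj.trans_le hk))
        rw [Finset.sum_eq_zero fun k _ => ?_, Finset.sum_eq_zero fun k _ => ?_, zero_pow hN0,
          smul_zero]
        · rw [powMat_apply, powMat_apply]
          rcases hz k with h | h <;> simp [h, hN0]
        · rcases hz k with h | h <;> simp [h]
      · rw [er j hj] at h
        rw [e, one_smul]
        have := congrArg (fun t => (gam s N)⁻¹ • t) h
        simpa only [smul_smul, inv_mul_cancel₀ hN.gam_ne_zero, one_smul] using this
    · have er : ∀ k : Fin n, rowScale N s k = 1 := fun k => if_neg fun ⟨m, hm, _⟩ => hmid ⟨m, hm⟩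
      simp only [er, one_smul] at h
      rw [e, one_smul, h]
      simp only [powMat_apply (z := u), e, one_smul]

lemma metricInv_mul {u v : Matrix (Fin n) (Fin n) A} (hc : ∀ i j k l, Commute (u i j) (v k l)) :
    metricInv s (u * v) = metricInv s v * metricInv s u := by
  have ht : (u * v).transpose = v.transpose * u.transpose := by
    ext i j
    simp only [Matrix.transpose_apply, Matrix.mul_apply]
    exact Finset.sum_congr rfl fun k _ => (hc j k k i).eq
  have hJ : ∀ X : Matrix (Fin n) (Fin n) A,
      scal A (metricJ s)⁻¹ * (scal A (metricJ s) * X) = X := by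
    intro X
    rw [metricJ_inv, ← Matrix.mul_assoc, scal, ← Matrix.map_mul, metricJ_mul_self,
      Matrix.map_one _ (map_zero _) (map_one _), Matrix.one_mul]
  simp only [metricInv, ht, Matrix.mul_assoc, hJ]

lemma opPoint_mul {u v : Matrix (Fin n) (Fin n) A} (hc : ∀ i j k l, Commute (u i j) (v k l)) :
    opPoint s (u * v) = opPoint s v * opPoint s u := by
  ext i j
  rw [opPoint, metricInv_mul hc, Matrix.map_apply, Matrix.mul_apply, Matrix.mul_apply,
    Finset.op_sum]
  refine Finset.sum_congr rfl fun k _ => ?_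
  rw [opPoint, opPoint, Matrix.map_apply, Matrix.map_apply, ← MulOpposite.op_mul]
  congr 1
  rw [metricInv_apply, metricInv_apply]
  exact (((hc _ _ _ _).smul_left _).smul_right _).symm.eq

lemma commute_powMat {u v : Matrix (Fin n) (Fin n) A} (hc : ∀ i j k l, Commute (u i j) (v k l))
    (i j k l : Fin n) : Commute (powMat N s u i j) (powMat N s v k l) :=
  (((hc i j k l).pow_pow N N).smul_left _).smul_right _

/-! ### Products of commuting Frobenius points -/

section Mul

variable {A₁ A₂ : Type} [Ring A₁] [Algebra ℂ A₁] [Ring A₂] [Algebra ℂ A₂]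
  {φ : A₁ →ₐ[ℂ] A} {ψ : A₂ →ₐ[ℂ] A}
  {u : Matrix (Fin n) (Fin n) A₁} {v : Matrix (Fin n) (Fin n) A₂}

/-- Rows off the middle are quantum Euclidean rows. For the middle row, the inverse in the opposite
algebra turns column `j` into row `j'`, to which `opRow` applies when `j` is not the middle; the
remaining central entry is `1`. -/
lemma FrobPoint.powMat_mul (hN : IsOddRoot s N) (hu : FrobPoint N s u) (hv : FrobPoint N s v)
    (hc : ∀ a b, Commute (φ a) (ψ b)) :
    powMat N s (u.map φ * v.map ψ) = powMat N s (u.map φ) * powMat N s (v.map ψ) := by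
  ext i j
  have hc' : ∀ i j k l, Commute (u.map φ i j) (v.map ψ k l) := fun i j k l => hc _ _
  have hup := hu.point.map φ
  have hvp := hv.point.map ψ
  rw [Matrix.mul_apply]
  by_cases hi : i = i.rev
  · by_cases hj : j = j.rev
    · have hij := eq_mid hi.symm hj.symm
      subst hij
      have hs : powScale N s i i = 1 := if_neg fun ⟨k, _, h1, h2⟩ => h1.asymm h2
      rw [powMat_apply, (hup.mul hvp hc').mid i hi.symm, one_pow, hs, one_smul,
        Finset.sum_eq_single i]
      · rw [powMat_apply, powMat_apply, hs, hup.mid i hi.symm, hvp.mid i hi.symm]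
        simp
      · intro k _ hk
        have hN0 : N ≠ 0 := by have := hN.one_lt; omega
        rw [powMat_apply, powMat_apply]
        rcases lt_or_gt_of_ne hk with h | h
        · rw [hup.tri i k h]; simp [hN0]
        · rw [hvp.tri k i h]; simp [hN0]
      · simp
    · have hj' : j.rev ≠ j.rev.rev := fun h => hj (by rwa [Fin.rev_rev, eq_comm] at h)
      -- Inversion into the opposite algebra reverses the product, so `v` now provides the row and
      -- `u` the matrix acting on it.
      have h := RowFrob.powMat_row (u := opPoint s (v.map ψ)) (φ := φ.op) hN hvp.op hu.point.op
        hu.opRow (fun a b c => by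
          rw [opPoint_apply]
          exact ((hc c.unop _).smul_right _).symm.op) hj' i.rev
      change powMat N s (opPoint s (v.map ψ) * (opPoint s u).map φ.op) _ _ =
        ∑ k, _ * powMat N s ((opPoint s u).map φ.op) _ _ at h
      rw [← opPoint_map, ← opPoint_mul hc'] at h
      simp only [powMat_opPoint hN, Fin.rev_rev, ← MulOpposite.op_mul, ← Finset.op_sum] at h
      rw [MulOpposite.op_injective h, ← Equiv.sum_comp Fin.revPerm]
      simp
  · exact RowFrob.powMat_row hN hup hv.point hv.row (fun i j a => hc _ a) hi j

/-- Associativity: `x (u v) = (x u) v`, where `x u` is again a quantum Euclidean row by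
`RowRel.mul`. -/
lemma RowFrob.mul (hu : RowFrob N s u) (hv : RowFrob N s v) (hup : IsPoint s u)
    (hc : ∀ a b, Commute (φ a) (ψ b))
    (h : powMat N s (u.map φ * v.map ψ) = powMat N s (u.map φ) * powMat N s (v.map ψ)) :
    RowFrob N s (u.map φ * v.map ψ) := by
  intro B _ _ χ x hx hcx j
  have hx' := hx.mul ((hup.map φ).map χ) fun i j k => hcx i _
  have h1 := hv B (χ.comp ψ) _ hx' (fun i b => ?_) j
  · have e1 : ∑ k, x k * χ ((u.map φ * v.map ψ) k j) =
        ∑ k, (∑ l, x l * ((u.map φ).map χ) l k) * (χ.comp ψ) (v k j) := by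
      simp only [Matrix.mul_apply, map_sum, Finset.mul_sum, Finset.sum_mul, map_mul, mul_assoc]
      exact Finset.sum_comm
    rw [e1, h1, h]
    have h2 := hu B (χ.comp φ) x hx (fun i a => hcx i _)
    simp only [AlgHom.comp_apply] at h2
    simp only [Matrix.map_apply, h2, Matrix.mul_apply, map_sum, Finset.mul_sum, Finset.sum_mul,
      powMat_map, map_mul, mul_assoc, AlgHom.comp_apply]
    exact Finset.sum_comm
  · refine Commute.sum_left _ _ _ fun k _ => Commute.mul_left (hcx _ _) ?_
    exact (hc _ b).map χ

/-- Products of commuting points are compatible with `N`-th powers. -/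
lemma FrobPoint.mul (hN : IsOddRoot s N) (hu : FrobPoint N s u) (hv : FrobPoint N s v)
    (hc : ∀ a b, Commute (φ a) (ψ b)) : FrobPoint N s (u.map φ * v.map ψ) := by
  have hc' : ∀ i j k l, Commute (u.map φ i j) (v.map ψ k l) := fun i j k l => hc _ _
  have hp := FrobPoint.powMat_mul hN hu hv hc
  refine ⟨(hu.point.map φ).mul (hv.point.map ψ) hc', ?_, ?_, ?_⟩
  · intro i j k l
    rw [hp, Matrix.mul_apply, Matrix.mul_apply]
    refine Commute.sum_left _ _ _ fun a _ => Commute.sum_right _ _ _ fun b _ => ?_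
    have h1 := (hu.map φ).comm i a k b
    have h2 := (hv.map ψ).comm a j b l
    -- Rescaled powers of the product are sums of products of those of the factors, which commute
    -- within each factor and across them.
    exact (h1.mul_right (commute_powMat hc' _ _ _ _)).mul_left
      ((commute_powMat hc' _ _ _ _).symm.mul_right h2)
  · exact hu.row.mul hv.row hu.point hc hp
  · rw [opPoint_mul hc', opPoint_map, opPoint_map]
    refine hv.opRow.mul hu.opRow hv.point.op (fun a b => (hc _ _).symm.op) ?_
    rw [← opPoint_map, ← opPoint_map, ← opPoint_mul hc']
    ext i j
    rw [powMat_opPoint hN, hp, Matrix.mul_apply, Matrix.mul_apply, Finset.op_sum,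
      ← Equiv.sum_comp Fin.revPerm]
    refine Finset.sum_congr rfl fun k _ => ?_
    rw [powMat_opPoint hN, powMat_opPoint hN, ← MulOpposite.op_mul]
    rfl

end Mul

lemma powScale_self (i : Fin n) : powScale N s i i = 1 :=
  if_neg fun ⟨_, _, h1, h2⟩ => h1.asymm h2

lemma powMat_bd (hN : IsOddRoot s N) (w : Matrix (Fin n) (Fin n) A) :
    powMat N s (bd w) = bd (powMat N s w) := by
  have hN0 : N ≠ 0 := by have := hN.one_lt; omega
  ext i j
  rw [powMat_apply]
  revert i j; refine inn_cases ?_ ?_ (fun i => ?_) <;>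
  refine inn_cases ?_ ?_ (fun j => ?_) <;>
  simp [hN0, powScale_self, powMat_apply]

lemma opPoint_bd (w : Matrix (Fin n) (Fin n) A) : opPoint s (bd w) = bd (opPoint s w) := by
  rw [opPoint, metricInv_bd, bd_map _ rfl rfl]; rfl

/-- The inner part of a quantum Euclidean row is one again, with the same scales; the outer columns
are those of the identity. -/
lemma RowFrob.bd (hN : IsOddRoot s N) {w : Matrix (Fin n) (Fin n) A} (h : RowFrob N s w) :
    RowFrob N s (bd w) := by
  intro B _ _ φ x hx hc j
  rw [powMat_bd hN]
  have h1 := h B φ _ hx.inn (fun i a => hc _ a)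
  simp only [sum_inn]
  revert j
  refine inn_cases ?_ ?_ (fun j => ?_)
  · simp
  · simp
  · simpa using h1 j

lemma FrobPoint.bd (hN : IsOddRoot s N) {w : Matrix (Fin n) (Fin n) A} (h : FrobPoint N s w) :
    FrobPoint N s (bd w) where
  point := h.point.bd
  comm i j k l := by
    rw [powMat_bd hN]
    have h1 := h.comm
    revert i j k l
    refine inn_cases ?_ ?_ (fun i => ?_) <;>
    refine inn_cases ?_ ?_ (fun j => ?_) <;>
    refine inn_cases ?_ ?_ (fun k => ?_) <;>
    refine inn_cases ?_ ?_ (fun l => ?_) <;>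
    simp [h1]
  row := h.row.bd hN
  opRow := by
    rw [opPoint_bd]
    exact h.opRow.bd hN

end Frobenius

/-! ### Rank one points -/

section RankOne

variable {m : ℕ} {A : Type*} [Ring A] [Algebra ℂ A] {s : ℂˣ}

/-- The relations `K E = q E K`, `K' = K⁻¹`. -/
structure QTorus (s : ℂˣ) (K K' E : A) : Prop where
  right : K * K' = 1
  left : K' * K = 1
  comm : K * E = (s : ℂ) ^ 2 • (E * K)

lemma QTorus.comm' {K K' E : A} (h : QTorus s K K' E) :
    K' * E = ((s : ℂ) ^ 2)⁻¹ • (E * K') := by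
  have h1 : E * K' = K' * (K * E) * K' := by
    rw [← mul_assoc, h.left, one_mul]
  rw [h.comm, mul_smul_comm, smul_mul_assoc, ← mul_assoc, mul_assoc _ K, h.right, mul_one] at h1
  rw [h1, smul_smul, inv_mul_cancel₀ (sq_ne_zero' s), one_smul]

/-- The point of the first simple root. -/
def rootPt (m : ℕ) (K K' E : A) : Matrix (Fin (m + 2 + 2)) (Fin (m + 2 + 2)) A :=
  ext3 (ext3 K (ext3 E 0 0) 0)
    (ext3 (ext3 0 (ext3 K' 0 0) 0)
      (fun k => ext3 0 (ext3 0 ((1 : Matrix (Fin m) (Fin m) A) k) 0) 0)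
      (ext3 0 (ext3 0 0 K) (-E)))
    (ext3 0 0 K')


lemma one_entry_comm {n : ℕ} (X : A) (i j : Fin n) :
    (1 : Matrix (Fin n) (Fin n) A) i j * X = X * (1 : Matrix (Fin n) (Fin n) A) i j := by
  by_cases h : i = j <;> simp [Matrix.one_apply, h]

lemma fullForm_one_col {n : ℕ} (a b : Fin n) :
    fullForm s (fun k => (1 : Matrix (Fin n) (Fin n) A) k a) (fun k => (1 : Matrix _ _ A) k b) =
      metricJ s a b • (1 : A) := by
  rw [IsPoint.one.fullForm_col, Algebra.algebraMap_eq_smul_one]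

lemma IsPoint.sides' {n : ℕ} {z : Matrix (Fin n) (Fin n) A} (h : IsPoint s z) (i j a b : Fin n) :
    (qd s a b • (z i b * z j a) + if a < b then lam s • (z i a * z j b) else 0) -
      (lam s * metricJ s a b) • upperForm s (fun k => z i k) (fun k => z j k) a =
    (qd s j i • (z j a * z i b) + if i < j then lam s • (z i a * z j b) else 0) -
      (lam s * metricJ s i j) • lowerForm s (fun k => z k a) (fun k => z k b) j := by
  have := h.sides i j a b
  rw [rowSide_eq, colSide_eq] at this
  simpa using this

lemma fullForm_one_row {n : ℕ} (a b : Fin n) :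
    fullForm s (fun k => (1 : Matrix (Fin n) (Fin n) A) a k) (fun k => (1 : Matrix _ _ A) b k) =
      metricJ s a b • (1 : A) := by
  rw [← Algebra.algebraMap_eq_smul_one, ← IsPoint.one.fullForm_row]

-- A case check over the positions `0`, `1`, inner, `1'`, `0'` of the four indices. Entirely inner
-- relations are those of the identity point, and the others reduce to the q-commutation of `K`,
-- `K'`, `E` or to centrality of the entries of the identity.
set_option maxHeartbeats 4000000 in
lemma rootPt_sides {K K' E : A} (h : QTorus s K K' E) (i j a b : Fin (m + 2 + 2)) :
    rowSide s (rootPt m K K' E i) (rootPt m K K' E j) a b =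
      colSide s (fun k => rootPt m K K' E k a) (fun k => rootPt m K K' E k b) i j := by
  have h1 := h.right
  have h2 := h.left
  have h3 := h.comm
  have h4 := h.comm'
  have hs := s.ne_zero
  have hz : (s : ℂ) ^ (-2 + -(m : ℤ)) = ((s : ℂ) ^ 2)⁻¹ * ((s : ℂ) ^ m)⁻¹ := by
    rw [zpow_add₀ hs, zpow_neg, zpow_neg]; norm_cast
  rw [rowSide_eq, colSide_eq]
  revert i j a b
  refine inn_cases ?_ ?_ (inn_cases ?_ ?_ (fun i => ?_)) <;>
    refine inn_cases ?_ ?_ (inn_cases ?_ ?_ (fun j => ?_)) <;>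
    refine inn_cases ?_ ?_ (inn_cases ?_ ?_ (fun a => ?_)) <;>
    refine inn_cases ?_ ?_ (inn_cases ?_ ?_ (fun b => ?_)) <;>
    simp [rootPt, upperForm_zero, upperForm_last, lowerForm_zero, lowerForm_last, upperForm_inn,
      lowerForm_inn, lowerForm_zero_left, lowerForm_zero_right, upperForm_zero_left,
      upperForm_zero_right, h1, h2, h3, h4, fullForm_sum_inn, fullForm_one_col, fullForm_one_row,
      hz]
  all_goals first
    | exact one_entry_comm _ _ _
    | exact (one_entry_comm _ _ _).symm
    | exact IsPoint.one.sides' i j a b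
    | (match_scalars <;> simp only [lam] <;> field_simp <;> ring)

end RankOne

/-! ### Frobenius property of the long root points -/

section RankOneFrob

variable {A : Type} [Ring A] [Algebra ℂ A] {s : ℂˣ} {N m : ℕ}

lemma QTorus.op {K K' E : A} (h : QTorus s K K' E) (c : ℂ) :
    QTorus s (MulOpposite.op K') (MulOpposite.op K) (c • MulOpposite.op E) where
  right := by rw [← MulOpposite.op_mul, h.right, MulOpposite.op_one]
  left := by rw [← MulOpposite.op_mul, h.left, MulOpposite.op_one]
  comm := by
    rw [mul_smul_comm, smul_mul_assoc, smul_comm ((s : ℂ) ^ 2), ← MulOpposite.op_mul,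
      ← MulOpposite.op_mul, h.comm', MulOpposite.op_smul, smul_smul ((s : ℂ) ^ 2),
      mul_inv_cancel₀ (sq_ne_zero' s), one_smul]

lemma QTorus.pow_comm {K K' E : A} (h : QTorus s K K' E) (hN : IsOddRoot s N) :
    Commute (K ^ N) (E ^ N) ∧ Commute (K' ^ N) (E ^ N) ∧ Commute (K ^ N) (K' ^ N) := by
  have key : ∀ (c : ℂ) (X Y : A), X * Y = c • (Y * X) → ∀ i, X * Y ^ i = c ^ i • (Y ^ i * X) := by
    intro c X Y hXY i
    induction i with
    | zero => simp
    | succ i ih =>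
      rw [pow_succ, ← mul_assoc, ih, smul_mul_assoc, mul_assoc, hXY, mul_smul_comm, smul_smul,
        mul_assoc, pow_succ]
  refine ⟨Commute.pow_left ?_ _, Commute.pow_left ?_ _, Commute.pow_pow ?_ _ _⟩
  · have := key _ _ _ h.comm N
    rwa [hN.prim.pow_eq_one, one_smul] at this
  · have := key _ _ _ h.comm' N
    rwa [inv_pow, hN.prim.pow_eq_one, inv_one, one_smul] at this
  · rw [commute_iff_eq, h.right, h.left]

/-- The trinomial theorem with `t = 0`. -/
lemma add_pow_root (hN : IsOddRoot s N) {a b : A} (h : a * b = ((s : ℂ) ^ 2) ^ 2 • (b * a)) :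
    (a + b) ^ N = a ^ N + b ^ N := by
  have hN0 : N ≠ 0 := by have := hN.one_lt; omega
  have := add_add_pow_root (a := a) (t := 0) (b := b) hN.prim hN.odd hN.one_lt (by simp) (by simp)
    (by simpa using h)
  simpa [hN0] using this

lemma metricInv_rootPt (K K' E : A) :
    metricInv s (rootPt m K K' E) = rootPt m K' K (-((s : ℂ) ^ 2)⁻¹ • E) := by
  have hs := s.ne_zero
  ext i j
  rw [metricInv_apply]
  revert i j
  refine inn_cases ?_ ?_ (inn_cases ?_ ?_ (fun i => ?_)) <;>
    refine inn_cases ?_ ?_ (inn_cases ?_ ?_ (fun j => ?_)) <;>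
    simp [rootPt, twoRho_zero, twoRho_last, twoRho_inn]
  by_cases h : i = j
  · subst h; simp
  · have : j.rev ≠ i.rev := fun e => h (Fin.rev_injective e).symm
    simp [h, this]

lemma powMat_rootPt (hN : IsOddRoot s N) (K K' E : A) :
    powMat N s (rootPt m K K' E) = rootPt m (K ^ N) (K' ^ N) (E ^ N) := by
  have hN0 : N ≠ 0 := by have := hN.one_lt; omega
  ext i j
  rw [powMat_apply]
  revert i j
  refine inn_cases ?_ ?_ (inn_cases ?_ ?_ (fun i => ?_)) <;>
    refine inn_cases ?_ ?_ (inn_cases ?_ ?_ (fun j => ?_)) <;>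
    simp [rootPt, powScale_self, hN0, hN.odd.neg_pow]
  · simp [powScale]
  · simp [powScale]
  · by_cases h : i = j
    · subst h; simp [powScale_self]
    · simp [h, hN0]

lemma isPoint_rootPt {K K' E : A} (h : QTorus s K K' E) : IsPoint s (rootPt m K K' E) where
  frt i b j a := by rw [frt_eq, rootPt_sides h, sub_self]
  left := by
    rw [metricL_eq, metricInv_rootPt]
    ext i j
    rw [Matrix.mul_apply, sum_inn, sum_inn]
    revert i j
    refine inn_cases ?_ ?_ (inn_cases ?_ ?_ (fun i => ?_)) <;>
    refine inn_cases ?_ ?_ (inn_cases ?_ ?_ (fun j => ?_)) <;>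
    simp [rootPt, h.right, h.left, h.comm]
    rw [← Matrix.mul_apply, Matrix.one_mul]
    simp [Matrix.one_apply]
  right := by
    rw [metricInv_rootPt]
    ext i j
    rw [Matrix.mul_apply, sum_inn, sum_inn]
    revert i j
    refine inn_cases ?_ ?_ (inn_cases ?_ ?_ (fun i => ?_)) <;>
    refine inn_cases ?_ ?_ (inn_cases ?_ ?_ (fun j => ?_)) <;>
    simp [rootPt, h.right, h.left, h.comm']
    rw [← Matrix.mul_apply, Matrix.one_mul]
    simp [Matrix.one_apply]
  tri := by
    refine inn_cases ?_ ?_ (inn_cases ?_ ?_ (fun i => ?_)) <;>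
    refine inn_cases ?_ ?_ (inn_cases ?_ ?_ (fun j => ?_)) <;>
    simp [rootPt]
    exact fun hij => Matrix.one_apply_ne hij.ne'
  mid := by
    refine inn_cases ?_ ?_ (inn_cases ?_ ?_ (fun i => ?_)) <;> simp [rootPt]

/-- One factor `q` comes from the row and another from moving `K'` past `E`, so the two summands `q
^ 2`-commute. The sign in the second form survives because `N` is odd. -/
lemma RowRel.add_pow (hN : IsOddRoot s N) {n : ℕ} {K K' E : A} (h : QTorus s K K' E)
    {C : Type} [Ring C] [Algebra ℂ C] (φ : A →ₐ[ℂ] C) {x : Fin n → C} (hx : RowRel s x)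
    (hc : ∀ i a, Commute (x i) (φ a)) {a b : Fin n} (hab : a < b) (hr : a ≠ b.rev) :
    (x a * φ E + x b * φ K') ^ N = x a ^ N * φ E ^ N + x b ^ N * φ K' ^ N ∧
    (-(x a * φ E) + x b * φ K') ^ N = -(x a ^ N * φ E ^ N) + x b ^ N * φ K' ^ N := by
  have hE : φ K' * φ E = ((s : ℂ) ^ 2)⁻¹ • (φ E * φ K') := by
    rw [← map_mul, h.comm', map_smul, map_mul]
  have key : (x a * φ E) * (x b * φ K') =
      ((s : ℂ) ^ 2) ^ 2 • ((x b * φ K') * (x a * φ E)) := by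
    rw [(hc b E).symm.mul_mul_mul_comm, (hc a K').symm.mul_mul_mul_comm, hE, hx.comm' hab hr,
      smul_mul_assoc, mul_smul_comm, smul_smul]
    congr 1
    have := sq_ne_zero' s
    field_simp
  constructor
  · rw [add_pow_root hN key, (hc _ _).mul_pow, (hc _ _).mul_pow]
  · rw [add_pow_root hN (by rw [neg_mul, mul_neg, key, smul_neg]), hN.odd.neg_pow,
      (hc _ _).mul_pow, (hc _ _).mul_pow]

lemma rowFrob_rootPt (hN : IsOddRoot s N) {K K' E : A} (h : QTorus s K K' E) :
    RowFrob N s (rootPt m K K' E) := by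
  intro C _ _ φ x hx hc j
  have hN0 : N ≠ 0 := by have := hN.one_lt; omega
  -- The last column combines the entries at `1'` and `0'`; no middle index separates them, so their
  -- scales agree.
  have hl : rowScale N s (Fin.last (m + 2 + 1)) = rowScale N s (Fin.last (m + 1)) := by
    have h1 : (∃ k : Fin (m + 2 + 2), k.rev = k ∧ k < Fin.last (m + 2 + 1)) ↔
        ∃ k : Fin (m + 2), k.rev = k ∧ k < Fin.last (m + 1) := by
      rw [exists_mid_inn, exists_mid_inn, exists_mid_inn]
      simp
    simp only [rowScale, h1]
  rw [powMat_rootPt hN]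
  simp only [sum_inn]
  revert j
  refine inn_cases ?_ ?_ (inn_cases ?_ ?_ (fun j => ?_)) <;>
    simp [rootPt, rowScale_zero, (hc _ _).mul_pow, hl]
  · rw [(hx.add_pow hN h φ hc (by simp) (by simp)).2, smul_add, smul_neg]
  · rw [(hx.add_pow hN h φ hc (by simp) (by simp)).1]
  · simp only [Matrix.one_apply, apply_ite φ, map_one, map_zero, mul_ite, mul_one, mul_zero,
      smul_ite, smul_zero, Finset.sum_ite_eq', Finset.mem_univ, if_true]

lemma opPoint_rootPt (K K' E : A) : opPoint s (rootPt m K K' E) =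
    rootPt m (MulOpposite.op K') (MulOpposite.op K) (-((s : ℂ) ^ 2)⁻¹ • MulOpposite.op E) := by
  ext i j
  rw [opPoint, metricInv_rootPt, Matrix.map_apply]
  revert i j
  refine inn_cases ?_ ?_ (inn_cases ?_ ?_ (fun i => ?_)) <;>
    refine inn_cases ?_ ?_ (inn_cases ?_ ?_ (fun j => ?_)) <;>
    simp [rootPt, Matrix.one_apply, apply_ite MulOpposite.op]

lemma frobPoint_rootPt (hN : IsOddRoot s N) {K K' E : A} (h : QTorus s K K' E) :
    FrobPoint N s (rootPt m K K' E) where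
  point := isPoint_rootPt h
  row := rowFrob_rootPt hN h
  opRow := by
    rw [opPoint_rootPt]
    exact rowFrob_rootPt hN (h.op _)
  comm := by
    obtain ⟨h1, h2, h3⟩ := h.pow_comm hN
    have ho : ∀ i j, Commute ((1 : Matrix (Fin m) (Fin m) A) i j) (K ^ N) ∧
        Commute ((1 : Matrix (Fin m) (Fin m) A) i j) (K' ^ N) ∧
        Commute ((1 : Matrix (Fin m) (Fin m) A) i j) (E ^ N) := fun i j =>
      ⟨one_entry_comm _ _ _, one_entry_comm _ _ _, one_entry_comm _ _ _⟩
    rw [powMat_rootPt hN]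
    -- Only a few distinct entries occur, which reduces commutation to a finite list of pairs.
    have key : ∀ i j, rootPt m (K ^ N) (K' ^ N) (E ^ N) i j ∈
        ({0, 1, K ^ N, K' ^ N, E ^ N, -E ^ N} : Set A) := by
      refine inn_cases ?_ ?_ (inn_cases ?_ ?_ (fun i => ?_)) <;>
        refine inn_cases ?_ ?_ (inn_cases ?_ ?_ (fun j => ?_)) <;>
        simp [rootPt]
      by_cases h : i = j
      · subst h; simp
      · simp [h]
    intro i j k l
    obtain hi | hi | hi | hi | hi | hi := key i j <;> obtain hk | hk | hk | hk | hk | hk := key k l <;>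
      rw [hi, hk] <;> simp [h1, h2, h3, h1.symm, h2.symm, h3.symm]

/-- The point of the second of the two conjugate simple roots in type `D₂`. -/
def forkPt (m : ℕ) (K K' E : A) : Matrix (Fin (m + 2 + 2)) (Fin (m + 2 + 2)) A :=
  ext3 (ext3 K (ext3 0 0 E) 0)
    (ext3 (ext3 0 (ext3 K 0 0) (-E)) 0 (ext3 0 (ext3 0 0 K') 0))
    (ext3 0 0 K')

/-! ### The second simple root in type `D₂` -/

section Fork

/-- Type `D₂` is treated with `m` a variable such that `Fin m` is empty, which keeps the indices in
the form `0`, `inn`, `last` used throughout. -/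
lemma eq_zero_of_isEmpty_fin [IsEmpty (Fin m)] : m = 0 := by
  cases m with
  | zero => rfl
  | succ m => exact isEmptyElim (0 : Fin (m + 1))

lemma fullForm_of_isEmpty [IsEmpty (Fin m)] (x y : Fin m → A) : fullForm s x y = 0 := by
  simp [fullForm]

set_option maxHeartbeats 4000000 in
lemma forkPt_sides [IsEmpty (Fin m)] {K K' E : A} (h : QTorus s K K' E) (i j a b : Fin (m + 2 + 2)) :
    rowSide s (forkPt m K K' E i) (forkPt m K K' E j) a b =
      colSide s (fun k => forkPt m K K' E k a) (fun k => forkPt m K K' E k b) i j := by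
  have h1 := h.right
  have h2 := h.left
  have h3 := h.comm
  have h4 := h.comm'
  have hs := s.ne_zero
  have hm : m = 0 := eq_zero_of_isEmpty_fin
  have hz : (s : ℂ) ^ (-2 + -(m : ℤ)) = ((s : ℂ) ^ 2)⁻¹ := by
    rw [hm, Nat.cast_zero, neg_zero, add_zero, zpow_neg]; norm_cast
  have hmz : (s : ℂ) ^ m = 1 := by rw [hm, pow_zero]
  rw [rowSide_eq, colSide_eq]
  revert i j a b
  refine inn_cases ?_ ?_ (inn_cases ?_ ?_ (fun i => isEmptyElim i)) <;>
    refine inn_cases ?_ ?_ (inn_cases ?_ ?_ (fun j => isEmptyElim j)) <;>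
    refine inn_cases ?_ ?_ (inn_cases ?_ ?_ (fun a => isEmptyElim a)) <;>
    refine inn_cases ?_ ?_ (inn_cases ?_ ?_ (fun b => isEmptyElim b)) <;>
    simp [forkPt, upperForm_zero, upperForm_last, lowerForm_zero, lowerForm_last, upperForm_inn,
      lowerForm_inn, h1, h2, h3, h4, fullForm_sum_inn, fullForm_of_isEmpty, hz,
      hmz]
  all_goals match_scalars <;> simp only [lam] <;> field_simp <;> ring

lemma metricInv_forkPt [IsEmpty (Fin m)] (K K' E : A) :
    metricInv s (forkPt m K K' E) = forkPt m K' K (-((s : ℂ) ^ 2)⁻¹ • E) := by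
  have hs := s.ne_zero
  ext i j
  have hm : (m : ℤ) = 0 := by rw [eq_zero_of_isEmpty_fin (m := m)]; rfl
  rw [metricInv_apply]
  revert i j
  refine inn_cases ?_ ?_ (inn_cases ?_ ?_ (fun i => isEmptyElim i)) <;>
    refine inn_cases ?_ ?_ (inn_cases ?_ ?_ (fun j => isEmptyElim j)) <;>
    simp [forkPt, twoRho_zero, twoRho_last, twoRho_inn, hm]

lemma powMat_forkPt [IsEmpty (Fin m)] (hN : IsOddRoot s N) (K K' E : A) :
    powMat N s (forkPt m K K' E) = forkPt m (K ^ N) (K' ^ N) (E ^ N) := by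
  have hN0 : N ≠ 0 := by have := hN.one_lt; omega
  ext i j
  rw [powMat_apply]
  revert i j
  refine inn_cases ?_ ?_ (inn_cases ?_ ?_ (fun i => isEmptyElim i)) <;>
    refine inn_cases ?_ ?_ (inn_cases ?_ ?_ (fun j => isEmptyElim j)) <;>
    simp [forkPt, powScale, powScale_self, hN0, hN.odd.neg_pow]

lemma isPoint_forkPt [IsEmpty (Fin m)] {K K' E : A} (h : QTorus s K K' E) : IsPoint s (forkPt m K K' E) where
  frt i b j a := by rw [frt_eq, forkPt_sides h, sub_self]
  left := by
    rw [metricL_eq, metricInv_forkPt]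
    ext i j
    rw [Matrix.mul_apply, sum_inn, sum_inn]
    revert i j
    refine inn_cases ?_ ?_ (inn_cases ?_ ?_ (fun i => isEmptyElim i)) <;>
    refine inn_cases ?_ ?_ (inn_cases ?_ ?_ (fun j => isEmptyElim j)) <;>
    simp [forkPt, h.right, h.left, h.comm]
  right := by
    rw [metricInv_forkPt]
    ext i j
    rw [Matrix.mul_apply, sum_inn, sum_inn]
    revert i j
    refine inn_cases ?_ ?_ (inn_cases ?_ ?_ (fun i => isEmptyElim i)) <;>
    refine inn_cases ?_ ?_ (inn_cases ?_ ?_ (fun j => isEmptyElim j)) <;>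
    simp [forkPt, h.right, h.left, h.comm']
  tri := by
    refine inn_cases ?_ ?_ (inn_cases ?_ ?_ (fun i => isEmptyElim i)) <;>
    refine inn_cases ?_ ?_ (inn_cases ?_ ?_ (fun j => isEmptyElim j)) <;>
    simp [forkPt]
  mid := by
    refine inn_cases ?_ ?_ (inn_cases ?_ ?_ (fun i => isEmptyElim i)) <;> simp [forkPt]

lemma rowFrob_forkPt [IsEmpty (Fin m)] (hN : IsOddRoot s N) {K K' E : A} (h : QTorus s K K' E) :
    RowFrob N s (forkPt m K K' E) := by
  intro C _ _ φ x hx hc j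
  have hm : ∀ j : Fin (m + 2 + 2), rowScale N s j = 1 := fun j => by
    exact if_neg (by rw [exists_mid_inn, exists_mid_inn]; simp)
  rw [powMat_forkPt hN]
  simp only [sum_inn, hm, one_smul]
  revert j
  refine inn_cases ?_ ?_ (inn_cases ?_ ?_ (fun j => isEmptyElim j)) <;>
    simp [forkPt, (hc _ _).mul_pow]
  · rw [(hx.add_pow hN h φ hc (by simp) (by simp)).2]
  · rw [(hx.add_pow hN h φ hc (by simp) (by simp)).1]

lemma opPoint_forkPt [IsEmpty (Fin m)] (K K' E : A) : opPoint s (forkPt m K K' E) =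
    forkPt m (MulOpposite.op K') (MulOpposite.op K) (-((s : ℂ) ^ 2)⁻¹ • MulOpposite.op E) := by
  ext i j
  rw [opPoint, metricInv_forkPt, Matrix.map_apply]
  revert i j
  refine inn_cases ?_ ?_ (inn_cases ?_ ?_ (fun i => isEmptyElim i)) <;>
    refine inn_cases ?_ ?_ (inn_cases ?_ ?_ (fun j => isEmptyElim j)) <;>
    simp [forkPt]

lemma frobPoint_forkPt [IsEmpty (Fin m)] (hN : IsOddRoot s N) {K K' E : A} (h : QTorus s K K' E) :
    FrobPoint N s (forkPt m K K' E) where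
  point := isPoint_forkPt h
  row := rowFrob_forkPt hN h
  opRow := by
    rw [opPoint_forkPt]
    exact rowFrob_forkPt hN (h.op _)
  comm := by
    obtain ⟨h1, h2, h3⟩ := h.pow_comm hN
    rw [powMat_forkPt hN]
    have key : ∀ i j, forkPt m (K ^ N) (K' ^ N) (E ^ N) i j ∈
        ({0, K ^ N, K' ^ N, E ^ N, -E ^ N} : Set A) := by
      refine inn_cases ?_ ?_ (inn_cases ?_ ?_ (fun i => isEmptyElim i)) <;>
        refine inn_cases ?_ ?_ (inn_cases ?_ ?_ (fun j => isEmptyElim j)) <;>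
        simp [forkPt]
    intro i j k l
    obtain hi | hi | hi | hi | hi := key i j <;> obtain hk | hk | hk | hk | hk := key k l <;>
      rw [hi, hk] <;> simp [h1, h2, h3, h1.symm, h2.symm, h3.symm]

end Fork

end RankOneFrob

/-! ### The short simple root in type `B₁` -/

section MidPoint

variable {A : Type} [Ring A] [Algebra ℂ A] {s : ℂˣ} {N m : ℕ}

/-- The upper triangular matrix of size three with middle entry `1`. -/
def midMat (a b c d e : A) : Matrix (Fin (1 + 2)) (Fin (1 + 2)) A :=
  ext3 (ext3 a (fun _ => b) c) (fun _ => ext3 0 (fun _ => 1) d) (ext3 0 0 e)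

/-- The point of the short simple root, in type `B₁`. -/
def midPt (s : ℂˣ) (K K' E : A) : Matrix (Fin (1 + 2)) (Fin (1 + 2)) A :=
  midMat K E (-((s : ℂ)⁻¹ * (1 + (s : ℂ) ^ 2)⁻¹) • (E * (E * K'))) (-(s : ℂ)⁻¹ • (E * K')) K'

lemma qd_one (i j : Fin 1) : qd s i j = 1 := by
  rw [Subsingleton.elim i 0, Subsingleton.elim j 0]; simp [qd]

lemma metricJ_one (i j : Fin 1) : metricJ s i j = 1 := by
  rw [Subsingleton.elim i 0, Subsingleton.elim j 0]; simp [metricJ, twoRho]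

lemma twoRho_one (i : Fin 1) : twoRho i = 0 := by
  rw [Subsingleton.elim i 0]; simp [twoRho]

lemma fullForm_fin_one (x y : Fin 1 → A) : fullForm s x y = x 0 * y 0 := by
  simp [fullForm, twoRho_one]

lemma upperForm_fin_one (x y : Fin 1 → A) (i : Fin 1) : upperForm s x y i = 0 := by
  simp [upperForm, Subsingleton.elim i 0]

lemma lowerForm_fin_one (x y : Fin 1 → A) (i : Fin 1) : lowerForm s x y i = 0 := by
  simp [lowerForm, Subsingleton.elim i 0]

lemma fin_one_lt (i j : Fin 1) : ¬ i < j := by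
  rw [Subsingleton.elim i j]; exact lt_irrefl _

lemma QTorus.assoc {K K' E : A} (h : QTorus s K K' E) (x : A) :
    K * (K' * x) = x ∧ K' * (K * x) = x ∧ K * (E * x) = (s : ℂ) ^ 2 • (E * (K * x)) ∧
      K' * (E * x) = ((s : ℂ) ^ 2)⁻¹ • (E * (K' * x)) := by
  refine ⟨?_, ?_, ?_, ?_⟩
  · rw [← mul_assoc, h.right, one_mul]
  · rw [← mul_assoc, h.left, one_mul]
  · rw [← mul_assoc, h.comm, smul_mul_assoc, mul_assoc]
  · rw [← mul_assoc, h.comm', smul_mul_assoc, mul_assoc]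

set_option maxHeartbeats 4000000 in
lemma midPt_sides (h1 : 1 + (s : ℂ) ^ 2 ≠ 0) {K K' E : A} (h : QTorus s K K' E)
    (i j a b : Fin (1 + 2)) :
    rowSide s (midPt s K K' E i) (midPt s K K' E j) a b =
      colSide s (fun k => midPt s K K' E k a) (fun k => midPt s K K' E k b) i j := by
  have hr := h.right
  have hl := h.left
  have hc := h.comm
  have hc' := h.comm'
  have a3 := fun x => (h.assoc x).2.2.1
  have a4 := fun x => (h.assoc x).2.2.2
  have hs := s.ne_zero
  rw [rowSide_eq, colSide_eq]
  revert i j a b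
  refine inn_cases ?_ ?_ (fun i => ?_) <;>
    refine inn_cases ?_ ?_ (fun j => ?_) <;>
    refine inn_cases ?_ ?_ (fun a => ?_) <;>
    refine inn_cases ?_ ?_ (fun b => ?_) <;>
    simp [midPt, midMat, upperForm_zero, upperForm_last, lowerForm_zero, lowerForm_last, upperForm_inn,
      lowerForm_inn, fullForm_fin_one, upperForm_fin_one, lowerForm_fin_one, qd_one,
      metricJ_one, mul_assoc, hr, hl, hc, hc', a3, a4, fin_one_lt,
      -Fin.reduceLast, -Nat.reduceAdd]
  all_goals match_scalars <;> (try simp only [lam]) <;> field_simp <;> ring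

lemma metricInv_midPt (K K' E : A) :
    metricInv s (midPt s K K' E) =
      midMat K' (-((s : ℂ) ^ 2)⁻¹ • (E * K'))
        (-((s : ℂ) ^ 2)⁻¹ • ((s : ℂ)⁻¹ * (1 + (s : ℂ) ^ 2)⁻¹) • (E * (E * K')))
        ((s : ℂ)⁻¹ • E) K := by
  have hs := s.ne_zero
  ext i j
  rw [metricInv_apply]
  revert i j
  refine inn_cases ?_ ?_ (fun i => ?_) <;> refine inn_cases ?_ ?_ (fun j => ?_) <;>
    simp [midPt, midMat, twoRho_zero, twoRho_last, twoRho_inn, twoRho_one, -Fin.reduceLast,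
      -Nat.reduceAdd]
  all_goals match_scalars
  all_goals field_simp

lemma powMat_midPt (hN : IsOddRoot s N) (K K' E : A) :
    powMat N s (midPt s K K' E) = midMat (K ^ N) (E ^ N)
      (gam s N • (-((s : ℂ)⁻¹ * (1 + (s : ℂ) ^ 2)⁻¹) • (E * (E * K'))) ^ N)
      ((-(s : ℂ)⁻¹ • (E * K')) ^ N) (K' ^ N) := by
  have hN0 : N ≠ 0 := by have := hN.one_lt; omega
  ext i j
  rw [powMat_apply]
  revert i j
  refine inn_cases ?_ ?_ (fun i => ?_) <;> refine inn_cases ?_ ?_ (fun j => ?_) <;>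
    simp [midPt, midMat, powScale, hN0, fin_one_lt, -Fin.reduceLast, -Nat.reduceAdd]

lemma isPoint_midPt (h1 : 1 + (s : ℂ) ^ 2 ≠ 0) {K K' E : A} (h : QTorus s K K' E) :
    IsPoint s (midPt s K K' E) := by
  have hr := h.right
  have hl := h.left
  have a3 := fun x => (h.assoc x).2.2.1
  have a4 := fun x => (h.assoc x).2.2.2
  have hs := s.ne_zero
  refine ⟨fun i b j a => by rw [frt_eq, midPt_sides h1 h, sub_self], ?_, ?_, ?_, ?_⟩
  · rw [metricL_eq, metricInv_midPt]
    ext i j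
    rw [Matrix.mul_apply, sum_inn]
    revert i j
    refine inn_cases ?_ ?_ (fun i => ?_) <;> refine inn_cases ?_ ?_ (fun j => ?_) <;>
      simp [midPt, midMat, mul_assoc, hr, hl, a3,
        -Fin.reduceLast, -Nat.reduceAdd]
    all_goals first
      | rw [Subsingleton.elim i j, Matrix.one_apply_eq]
      | (match_scalars <;> field_simp <;> ring)
  · rw [metricInv_midPt]
    ext i j
    rw [Matrix.mul_apply, sum_inn]
    revert i j
    refine inn_cases ?_ ?_ (fun i => ?_) <;> refine inn_cases ?_ ?_ (fun j => ?_) <;>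
      simp [midPt, midMat, mul_assoc, hr, hl, h.comm', a4,
        -Fin.reduceLast, -Nat.reduceAdd]
    all_goals first
      | rw [Subsingleton.elim i j, Matrix.one_apply_eq]
      | (match_scalars <;> field_simp <;> ring)
  · refine inn_cases ?_ ?_ (fun i => ?_) <;> refine inn_cases ?_ ?_ (fun j => ?_) <;>
      simp [midPt, midMat, fin_one_lt, -Fin.reduceLast, -Nat.reduceAdd]
  · refine inn_cases ?_ ?_ (fun i => ?_) <;> simp [midPt, midMat, -Fin.reduceLast, -Nat.reduceAdd]

/-- The family is closed under opposite inversion, with `E` replaced by a multiple of `E K'`, which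
has the same commutation with `K`. The row property of the inverse therefore needs no new
computation. -/
lemma opPoint_midPt (h1 : 1 + (s : ℂ) ^ 2 ≠ 0) {K K' E : A} (h : QTorus s K K' E) :
    opPoint s (midPt s K K' E) = midPt s (MulOpposite.op K') (MulOpposite.op K)
      (-((s : ℂ) ^ 2)⁻¹ • MulOpposite.op (E * K')) := by
  have hs := s.ne_zero
  ext i j
  rw [opPoint, metricInv_midPt, Matrix.map_apply]
  revert i j
  refine inn_cases ?_ ?_ (fun i => ?_) <;> refine inn_cases ?_ ?_ (fun j => ?_) <;>
    apply MulOpposite.unop_injective <;>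
    simp [midPt, midMat, -Fin.reduceLast, -Nat.reduceAdd, mul_assoc, h.comm, h.right]
  all_goals match_scalars <;> field_simp

lemma QTorus.op_mid {K K' E : A} (h : QTorus s K K' E) :
    QTorus s (MulOpposite.op K') (MulOpposite.op K)
      (-((s : ℂ) ^ 2)⁻¹ • MulOpposite.op (E * K')) := by
  refine QTorus.op ⟨h.right, h.left, ?_⟩ _
  rw [(h.assoc _).2.2.1, h.right, mul_assoc, h.left]

lemma QTorus.map {K K' E : A} (h : QTorus s K K' E) {B : Type} [Ring B] [Algebra ℂ B]
    (φ : A →ₐ[ℂ] B) : QTorus s (φ K) (φ K') (φ E) where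
  right := by rw [← map_mul, h.right, map_one]
  left := by rw [← map_mul, h.left, map_one]
  comm := by rw [← map_mul, h.comm, map_smul, map_mul]

lemma mul_mul_mul_eq_smul {B : Type} [Ring B] [Algebra ℂ B] {x x' y y' : B} {c d : ℂ}
    (h : Commute x' y) (h' : Commute x y') (h1 : x * x' = c • (x' * x)) (h2 : y * y' = d • (y' * y)) :
    (x * y) * (x' * y') = (c * d) • ((x' * y') * (x * y)) := by
  rw [h.symm.mul_mul_mul_comm, h'.symm.mul_mul_mul_comm, h1, h2, smul_mul_smul_comm]

/-- Any power of `s` equal to `1` gives the same power of `s ^ 2` equal to `1`. -/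
lemma IsOddRoot.isPrimitiveRoot (hN : IsOddRoot s N) : IsPrimitiveRoot (s : ℂ) N := by
  refine ⟨hN.pow, fun l hl => hN.prim.dvd_of_pow_eq_one l ?_⟩
  rw [← pow_mul, mul_comm, pow_mul, hl, one_pow]

/-- The relations within the last column of the short root point. The last one, expressing `x K'` by
`y ^ 2`, produces the `t ^ 2` term of the trinomial theorem. -/
lemma QTorus.mid_rel {K K' E : A} (h : QTorus s K K' E) {x y : A} {c d : ℂ}
    (hx : x = c • (E * (E * K'))) (hy : y = d • (E * K')) (hd : d ≠ 0) :
    x * y = (s : ℂ) ^ 2 • (y * x) ∧ y * K' = (s : ℂ) ^ 2 • (K' * y) ∧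
      x * K' = ((s : ℂ) ^ 2) ^ 2 • (K' * x) ∧
      x * K' = (c * (s : ℂ) ^ 2 * (d ^ 2)⁻¹) • y ^ 2 := by
  have hs := s.ne_zero
  have a4 := fun x => (h.assoc x).2.2.2
  refine ⟨?_, ?_, ?_, ?_⟩ <;> simp only [hx, hy, sq, smul_mul_assoc, mul_smul_comm, mul_assoc, a4] <;>
    match_scalars <;> field_simp

lemma commute_pow_of_mul_eq_smul {x y : A} {c : ℂ} (hc : c ^ N = 1) (h : x * y = c • (y * x)) :
    Commute x (y ^ N) := by
  have : ∀ i, x * y ^ i = c ^ i • (y ^ i * x) := by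
    intro i
    induction i with
    | zero => simp
    | succ i ih =>
      rw [pow_succ, ← mul_assoc, ih, smul_mul_assoc, mul_assoc, h, mul_smul_comm, smul_smul,
        mul_assoc, pow_succ]
  have := this N
  rwa [hc, one_smul] at this

lemma QTorus.pow_commute {K K' E : A} (h : QTorus s K K' E) (hN : IsOddRoot s N) :
    Commute (K ^ N) E ∧ Commute (K' ^ N) E ∧ Commute K (E ^ N) ∧ Commute K' (E ^ N) := by
  have key := fun c X Y => commute_pow_of_mul_eq_smul (N := N) (A := A) (c := c) (x := X) (y := Y)
  have h0 := sq_ne_zero' s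
  have hq := hN.prim.pow_eq_one
  have hq' : (((s : ℂ) ^ 2)⁻¹) ^ N = 1 := by rw [inv_pow, hq, inv_one]
  refine ⟨(key _ _ _ hq' ?_).symm, (key _ _ _ hq ?_).symm, key _ _ _ hq h.comm,
    key _ _ _ hq' h.comm'⟩
  · rw [h.comm, smul_smul, inv_mul_cancel₀ h0, one_smul]
  · rw [h.comm', smul_smul, mul_inv_cancel₀ h0, one_smul]

/-- The last column has three nonzero entries, and its three summands satisfy the hypotheses of
`add_add_pow_root`; this is the source of the scale `gam`. The middle column has two nonzero entries
and is binomial. -/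
lemma rowFrob_midPt (hN : IsOddRoot s N) {K K' E : A} (h : QTorus s K K' E) :
    RowFrob N s (midPt s K K' E) := by
  intro C _ _ φ x hx hc j
  have h1 := hN.one_add_ne
  have hs := s.ne_zero
  have hN0 : N ≠ 0 := by have := hN.one_lt; omega
  have hφ := h.map φ
  have h01 : x 0 * x (inn 0) = (s : ℂ) ^ 2 • (x (inn 0) * x 0) := hx.comm' (by simp) (by simp)
  have h12 : x (inn 0) * x (Fin.last _) = (s : ℂ) ^ 2 • (x (Fin.last _) * x (inn 0)) :=
    hx.comm' (by simp [-Fin.reduceLast, -Nat.reduceAdd]) (by simp [-Fin.reduceLast, -Nat.reduceAdd])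
  have h02 : x 0 * x (Fin.last _) = x (Fin.last _) * x 0 +
      ((s : ℂ)⁻¹ * (1 - (s : ℂ) ^ 2)) • x (inn 0) ^ 2 := by
    have := hx.mid_pair h1 (a := 0) (m := inn 0) (by simp) (by simp)
    simpa [-Fin.reduceLast, -Nat.reduceAdd] using this
  rw [powMat_midPt hN]
  simp only [sum_inn]
  revert j
  refine inn_cases ?_ ?_ (fun j => ?_)
  · simp [midPt, midMat, (hc _ _).mul_pow, rowScale, -Fin.reduceLast, -Nat.reduceAdd]
  · have hl : rowScale N s (Fin.last (1 + 1)) = gam s N := by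
      simp [rowScale, -Fin.reduceLast, -Nat.reduceAdd]
    have hm : rowScale N s (inn (0 : Fin 1)) = 1 := by simp [rowScale]
    have hrel := h.mid_rel (c := -((s : ℂ)⁻¹ * (1 + (s : ℂ) ^ 2)⁻¹)) (d := -(s : ℂ)⁻¹) rfl rfl
      (neg_ne_zero.2 (inv_ne_zero s.ne_zero))
    simp only [midPt, midMat, ext3_zero, ext3_inn, ext3_last, Finset.univ_unique, Fin.default_eq_zero,
      Finset.sum_singleton, hl, hm, rowScale_zero, one_smul]
    set w02 := -((s : ℂ)⁻¹ * (1 + (s : ℂ) ^ 2)⁻¹) • (E * (E * K')) with hw02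
    set w12 := -(s : ℂ)⁻¹ • (E * K') with hw12
    obtain ⟨e1, e2, e3, e4⟩ := hrel
    replace e1 := congrArg φ e1
    replace e2 := congrArg φ e2
    replace e3 := congrArg φ e3
    replace e4 := congrArg φ e4
    simp only [map_mul, map_smul, map_pow] at e1 e2 e3 e4
    rw [add_add_pow_root hN.prim hN.odd hN.one_lt]
    · simp only [(hc _ _).mul_pow, smul_add, map_smul, map_pow, smul_smul, mul_smul_comm,
        smul_mul_assoc]
      congr 2
      -- The trinomial coefficient `2 / (1 + q) ^ N` cancels `gam`, so the middle summand enters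
      -- unscaled while the outer two keep `gam`.
      rw [gam, div_mul_div_cancel₀ two_ne_zero, div_self (pow_ne_zero _ h1), one_smul]
    · rw [mul_mul_mul_eq_smul (hc _ _) (hc _ _) h01 e1, ← sq]
    · rw [mul_mul_mul_eq_smul (hc _ _) (hc _ _) h12 e2, ← sq]
    -- The correction from `x_0 x_last`, a multiple of the middle square, combines with `x K' ∈ ℂ y
    -- ^ 2`; the constants multiply to `q (q - 1) / (1 + q)`.
    · rw [(hc _ _).symm.mul_mul_mul_comm, (hc _ _).symm.mul_mul_mul_comm, h02, add_mul,
        smul_mul_assoc, (hc _ _).mul_pow, ← mul_smul_comm (((s : ℂ) ^ 2) ^ 2), ← e3]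
      congr 1
      rw [e4, mul_smul_comm, smul_smul]
      congr 1
      field_simp
      ring
  · rw [Subsingleton.elim j 0]
    have key : (x 0 * φ E) * x (inn 0) = (s : ℂ) ^ 2 • (x (inn 0) * (x 0 * φ E)) := by
      rw [mul_assoc, ← (hc (inn 0) E).eq, ← mul_assoc, h01, smul_mul_assoc, mul_assoc]
    -- These two terms commute only up to `q = s ^ 2`, so the theorem is applied with `s` in the
    -- role of `q`.
    have := add_add_pow_root (a := x 0 * φ E) (t := 0) (b := x (inn 0)) hN.isPrimitiveRoot hN.odd hN.one_lt (by simp) (by simp)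
      (by simpa using key)
    simpa [midPt, midMat, rowScale, hN0, (hc _ _).mul_pow, fin_one_lt, -Fin.reduceLast,
      -Nat.reduceAdd] using this

lemma frobPoint_midPt (hN : IsOddRoot s N) {K K' E : A} (h : QTorus s K K' E) :
    FrobPoint N s (midPt s K K' E) where
  point := isPoint_midPt hN.one_add_ne h
  row := rowFrob_midPt hN h
  opRow := by
    rw [opPoint_midPt hN.one_add_ne h]
    exact rowFrob_midPt hN h.op_mid
  comm := by
    obtain ⟨h1, h2, h3, h4⟩ := h.pow_commute hN
    have hKK : Commute K K' := by rw [commute_iff_eq, h.right, h.left]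
    rw [powMat_midPt hN]
    have hrel := (h.mid_rel (c := -((s : ℂ)⁻¹ * (1 + (s : ℂ) ^ 2)⁻¹)) (d := -(s : ℂ)⁻¹) rfl rfl
      (neg_ne_zero.2 (inv_ne_zero s.ne_zero))).1
    have key : ∀ i j, midMat (K ^ N) (E ^ N)
        (gam s N • (-((s : ℂ)⁻¹ * (1 + (s : ℂ) ^ 2)⁻¹) • (E * (E * K'))) ^ N)
        ((-(s : ℂ)⁻¹ • (E * K')) ^ N) (K' ^ N) i j ∈ ({0, 1, K ^ N, K' ^ N, E ^ N,
          gam s N • (-((s : ℂ)⁻¹ * (1 + (s : ℂ) ^ 2)⁻¹) • (E * (E * K'))) ^ N,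
          (-(s : ℂ)⁻¹ • (E * K')) ^ N} : Set A) := by
      refine inn_cases ?_ ?_ (fun i => ?_) <;> refine inn_cases ?_ ?_ (fun j => ?_) <;>
        simp [midMat, -Fin.reduceLast, -Nat.reduceAdd]
    have hE : ∀ y, Commute y E → Commute y K' → ∀ c : ℂ, Commute y (c • (E * K')) ∧
        Commute y (c • (E * (E * K'))) := fun y h1 h2 c =>
      ⟨(h1.mul_right h2).smul_right c, (h1.mul_right (h1.mul_right h2)).smul_right c⟩
    have hK := hE _ h1 (hKK.pow_left _)
    have hK' := hE _ h2 ((Commute.refl K').pow_left N)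
    have hEE := hE _ ((Commute.refl E).pow_left N) h4.symm
    have hEK := h3.pow_left N
    have hEK' := h4.pow_left N
    have hKKN := hKK.pow_pow N N
    set w02 := -((s : ℂ)⁻¹ * (1 + (s : ℂ) ^ 2)⁻¹) • (E * (E * K')) with hw02
    set w12 := -(s : ℂ)⁻¹ • (E * K') with hw12
    -- All other pairs involve a power of `K`, `K'` or `E`; this pair needs the q-commutation of the
    -- two compound entries.
    have hww : Commute (w02 ^ N) (w12 ^ N) := 
      (commute_pow_of_mul_eq_smul hN.prim.pow_eq_one hrel).pow_left N
    have e1 := ((hK (-((s : ℂ)⁻¹ * (1 + (s : ℂ) ^ 2)⁻¹))).2.pow_right N).smul_right (gam s N)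
    have e2 := ((hK' (-((s : ℂ)⁻¹ * (1 + (s : ℂ) ^ 2)⁻¹))).2.pow_right N).smul_right (gam s N)
    have e3 := ((hEE (-((s : ℂ)⁻¹ * (1 + (s : ℂ) ^ 2)⁻¹))).2.pow_right N).smul_right (gam s N)
    have f1 := (hK (-(s : ℂ)⁻¹)).1.pow_right N
    have f2 := (hK' (-(s : ℂ)⁻¹)).1.pow_right N
    have f3 := (hEE (-(s : ℂ)⁻¹)).1.pow_right N
    have g := hww.smul_left (gam s N)
    intro i j k l
    obtain hi | hi | hi | hi | hi | hi | hi := key i j <;>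
    obtain hk | hk | hk | hk | hk | hk | hk := key k l <;>
      rw [hi, hk] <;> first
        | exact Commute.refl _ | exact Commute.zero_left _ | exact Commute.zero_right _
        | exact Commute.one_left _ | exact Commute.one_right _ | assumption
        | (apply Commute.symm; assumption)

end MidPoint

/-! ### The identity point and the torus point of type `D₁` -/

section TorusPoint

variable {A : Type} [Ring A] [Algebra ℂ A] {s : ℂˣ} {N m : ℕ}

lemma powMat_one (hN : IsOddRoot s N) : powMat N s (1 : Matrix (Fin m) (Fin m) A) = 1 := by
  have hN0 : N ≠ 0 := by have := hN.one_lt; omega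
  ext i j
  rw [powMat_apply]
  by_cases h : i = j
  · subst h; simp [powScale_self]
  · simp [Matrix.one_apply, h, hN0]

lemma opPoint_one : opPoint s (1 : Matrix (Fin m) (Fin m) A) = 1 := by
  ext i j
  rw [opPoint_apply]
  by_cases h : i = j
  · subst h; simp
  · have : j.rev ≠ i.rev := fun e => h (Fin.rev_injective e).symm
    simp [Matrix.one_apply, h, this]

lemma rowFrob_one (hN : IsOddRoot s N) : RowFrob N s (1 : Matrix (Fin m) (Fin m) A) := by
  intro C _ _ φ x hx hc j
  rw [powMat_one hN]
  simp [Matrix.one_apply, apply_ite φ]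

lemma frobPoint_one (hN : IsOddRoot s N) : FrobPoint N s (1 : Matrix (Fin m) (Fin m) A) where
  point := IsPoint.one
  comm i j k l := by
    rw [powMat_one hN]
    exact one_entry_comm _ _ _
  row := rowFrob_one hN
  opRow := by rw [opPoint_one]; exact rowFrob_one hN

/-- The diagonal point, in type `D₁`. -/
def torusPt (m : ℕ) (t t' : A) : Matrix (Fin (m + 2)) (Fin (m + 2)) A :=
  ext3 (ext3 t 0 0) 0 (ext3 0 0 t')

variable [IsEmpty (Fin m)] {t t' : A}

lemma opPoint_torusPt : opPoint s (torusPt m t t') =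
    torusPt m (MulOpposite.op t') (MulOpposite.op t) := by
  ext i j
  rw [opPoint_apply]
  revert i j
  refine inn_cases ?_ ?_ (fun i => isEmptyElim i) <;>
    refine inn_cases ?_ ?_ (fun j => isEmptyElim j) <;> simp [torusPt]

lemma powMat_torusPt (hN : IsOddRoot s N) :
    powMat N s (torusPt m t t') = torusPt m (t ^ N) (t' ^ N) := by
  have hN0 : N ≠ 0 := by have := hN.one_lt; omega
  ext i j
  rw [powMat_apply]
  revert i j
  refine inn_cases ?_ ?_ (fun i => isEmptyElim i) <;>
    refine inn_cases ?_ ?_ (fun j => isEmptyElim j) <;> simp [torusPt, powScale_self, hN0]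

lemma isPoint_torusPt (h : t * t' = 1) (h' : t' * t = 1) : IsPoint s (torusPt m t t') := by
  have hm : m = 0 := eq_zero_of_isEmpty_fin
  have hi : metricInv s (torusPt m t t') = torusPt m t' t := by
    ext i j
    rw [metricInv_apply]
    revert i j
    refine inn_cases ?_ ?_ (fun i => isEmptyElim i) <;>
      refine inn_cases ?_ ?_ (fun j => isEmptyElim j) <;> simp [torusPt]
  refine ⟨fun i b j a => ?_, ?_, ?_, ?_, ?_⟩
  · rw [frt_eq, sub_eq_zero, rowSide_eq, colSide_eq]
    revert i j a b
    refine inn_cases ?_ ?_ (fun i => isEmptyElim i) <;>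
      refine inn_cases ?_ ?_ (fun j => isEmptyElim j) <;>
      refine inn_cases ?_ ?_ (fun j => isEmptyElim j) <;>
      refine inn_cases ?_ ?_ (fun j => isEmptyElim j) <;>
      simp [torusPt, upperForm_zero, upperForm_last, lowerForm_zero, lowerForm_last,
        fullForm_of_isEmpty, fullForm_sum_inn, h, h', hm]
  · rw [metricL_eq, hi]
    ext i j
    rw [Matrix.mul_apply, sum_inn]
    revert i j
    refine inn_cases ?_ ?_ (fun i => isEmptyElim i) <;>
      refine inn_cases ?_ ?_ (fun j => isEmptyElim j) <;> simp [torusPt, h, h']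
  · rw [hi]
    ext i j
    rw [Matrix.mul_apply, sum_inn]
    revert i j
    refine inn_cases ?_ ?_ (fun i => isEmptyElim i) <;>
      refine inn_cases ?_ ?_ (fun j => isEmptyElim j) <;> simp [torusPt, h, h']
  · refine inn_cases ?_ ?_ (fun i => isEmptyElim i) <;>
      refine inn_cases ?_ ?_ (fun j => isEmptyElim j) <;> simp [torusPt]
  · refine inn_cases ?_ ?_ (fun i => isEmptyElim i) <;> simp [torusPt]

lemma rowFrob_torusPt (hN : IsOddRoot s N) : RowFrob N s (torusPt m t t') := by
  intro C _ _ φ x hx hc j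
  rw [powMat_torusPt hN]
  simp only [sum_inn]
  revert j
  refine inn_cases ?_ ?_ (fun j => isEmptyElim j) <;> simp [torusPt, (hc _ _).mul_pow]

lemma frobPoint_torusPt (hN : IsOddRoot s N) (h : t * t' = 1) (h' : t' * t = 1) :
    FrobPoint N s (torusPt m t t') where
  point := isPoint_torusPt h h'
  row := rowFrob_torusPt hN
  opRow := by rw [opPoint_torusPt]; exact rowFrob_torusPt hN
  comm := by
    rw [powMat_torusPt hN]
    have hK : Commute (t ^ N) (t' ^ N) := Commute.pow_pow (by rw [commute_iff_eq, h, h']) _ _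
    refine inn_cases ?_ ?_ (fun i => isEmptyElim i) <;>
      refine inn_cases ?_ ?_ (fun i => isEmptyElim i) <;>
      refine inn_cases ?_ ?_ (fun i => isEmptyElim i) <;>
      refine inn_cases ?_ ?_ (fun i => isEmptyElim i) <;> simp [torusPt, hK, hK.symm]

end TorusPoint

/-! ### Shift operators and leading terms -/

section Shift

variable {D : Type} [Ring D] [Algebra ℂ D] {s : ℂˣ}

/-- The algebra of operators on doubly indexed families of elements of `D`. -/
abbrev ShiftAlg (D : Type) [Ring D] [Algebra ℂ D] : Type := Module.End ℂ (ℤ → ℤ → D)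

/-- Left multiplication by elements of `D`. -/
def leftOp (D : Type) [Ring D] [Algebra ℂ D] : D →ₐ[ℂ] ShiftAlg D :=
  AlgHom.ofLinearMap
    { toFun := fun d =>
        { toFun := fun f m c => d * f m c
          map_add' := fun f g => by ext; simp [mul_add]
          map_smul' := fun r f => by ext; simp }
      map_add' := fun d e => by ext; simp [add_mul]
      map_smul' := fun r d => by ext; simp }
    (by ext; simp) (fun d e => by ext; simp [mul_assoc])

/-- The shift of the first index. -/
def opE (D : Type) [Ring D] [Algebra ℂ D] : ShiftAlg D where
  toFun f m c := f (m - 1) c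
  map_add' _ _ := rfl
  map_smul' _ _ := rfl

/-- The shift of the second index, twisted by powers of `q`. -/
def opK (D : Type) [Ring D] [Algebra ℂ D] (s : ℂˣ) : ShiftAlg D where
  toFun f m c := ((s : ℂ) ^ 2) ^ m • f m (c - 1)
  map_add' f g := by ext; simp
  map_smul' r f := by ext m c; simp [smul_comm r]

/-- The inverse of `opK`. -/
def opK' (D : Type) [Ring D] [Algebra ℂ D] (s : ℂˣ) : ShiftAlg D where
  toFun f m c := ((s : ℂ) ^ 2) ^ (-m) • f m (c + 1)
  map_add' f g := by ext; simp
  map_smul' r f := by ext m c; simp [smul_comm r]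

@[simp] lemma leftOp_apply (d : D) (f : ℤ → ℤ → D) (m c : ℤ) :
    leftOp D d f m c = d * f m c := rfl
@[simp] lemma opE_apply (f : ℤ → ℤ → D) (m c : ℤ) : opE D f m c = f (m - 1) c := rfl
@[simp] lemma opK_apply (f : ℤ → ℤ → D) (m c : ℤ) :
    opK D s f m c = ((s : ℂ) ^ 2) ^ m • f m (c - 1) := rfl
@[simp] lemma opK'_apply (f : ℤ → ℤ → D) (m c : ℤ) :
    opK' D s f m c = ((s : ℂ) ^ 2) ^ (-m) • f m (c + 1) := rfl

lemma qTorus_op : QTorus s (opK D s) (opK' D s) (opE D) where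
  right := by
    ext f m c
    simp [smul_smul, mul_inv_cancel₀ (zpow_ne_zero m (sq_ne_zero' s))]
  left := by
    ext f m c
    simp [smul_smul, inv_mul_cancel₀ (zpow_ne_zero m (sq_ne_zero' s))]
  comm := by
    ext f m c
    simp only [Module.End.mul_apply, opK_apply, opE_apply, LinearMap.smul_apply, Pi.smul_apply,
      smul_smul]
    congr 1
    rw [← zpow_one_add₀ (sq_ne_zero' s)]; congr 1; ring

/-- The operators commuting with left multiplications. -/
abbrev ShiftComm (D : Type) [Ring D] [Algebra ℂ D] : Subalgebra ℂ (ShiftAlg D) :=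
  Subalgebra.centralizer ℂ (Set.range (leftOp D))

lemma mem_shiftComm {P : ShiftAlg D} (h : ∀ d, leftOp D d * P = P * leftOp D d) :
    P ∈ ShiftComm D := by
  rw [Subalgebra.mem_centralizer_iff]
  rintro _ ⟨d, rfl⟩
  exact h d

/-- A point over `D` acting by left multiplication and a simple root point over the commutant have
commuting entries, as `FrobPoint.mul` requires. -/
lemma shiftComm_commute (P : ShiftComm D) (d : D) :
    Commute ((ShiftComm D).val P) (leftOp D d) :=
  ((Subalgebra.mem_centralizer_iff ℂ).1 P.2 _ ⟨d, rfl⟩).symm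

/-- The operator `opE`, in the commutant of the left multiplications. -/
def cE (D : Type) [Ring D] [Algebra ℂ D] : ShiftComm D :=
  ⟨opE D, mem_shiftComm fun d => by ext; simp⟩
/-- The operator `opK`, in the commutant of the left multiplications. -/
def cK (D : Type) [Ring D] [Algebra ℂ D] (s : ℂˣ) : ShiftComm D :=
  ⟨opK D s, mem_shiftComm fun d => by ext; simp⟩
/-- The operator `opK'`, in the commutant of the left multiplications. -/
def cK' (D : Type) [Ring D] [Algebra ℂ D] (s : ℂˣ) : ShiftComm D :=
  ⟨opK' D s, mem_shiftComm fun d => by ext; simp⟩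

lemma qTorus_c : QTorus s (cK D s) (cK' D s) (cE D) where
  right := Subtype.ext qTorus_op.right
  left := Subtype.ext qTorus_op.left
  comm := Subtype.ext qTorus_op.comm

/-- The family `f` has a single term of first index at least `d`: a nonzero multiple of `u`, with
indices `(d, b)`. -/
def Lead (f : ℤ → ℤ → D) (d b : ℤ) (u : D) : Prop :=
  ∃ r : ℂ, r ≠ 0 ∧ ∀ m c, d ≤ m → f m c = if m = d ∧ c = b then r • u else 0

/-- The operator `P` multiplies leading terms by `w` and shifts their indices by `(g, c)`. -/
def Shifts (P : ShiftAlg D) (g c : ℤ) (w : D) : Prop :=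
  ∀ f d b u, Lead f d b u → Lead (P f) (d + g) (b + c) (w * u)

lemma Shifts.mul {P Q : ShiftAlg D} {g c g' c' : ℤ} {w w' : D} (h : Shifts P g c w)
    (h' : Shifts Q g' c' w') : Shifts (P * Q) (g + g') (c + c') (w * w') := by
  intro f d b u hf
  have := h _ _ _ _ (h' f d b u hf)
  rwa [mul_assoc, add_comm g, add_comm c, ← add_assoc, ← add_assoc]

lemma Shifts.pow {P : ShiftAlg D} {g c : ℤ} {w : D} (h : Shifts P g c w) (k : ℕ) :
    Shifts (P ^ k) (k * g) (k * c) (w ^ k) := by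
  induction k with
  | zero => intro f d b u hf; simpa using hf
  | succ k ih =>
    rw [pow_succ, pow_succ]
    have := ih.mul h
    rwa [Nat.cast_succ, add_one_mul, add_one_mul]

lemma shifts_leftOp (w : D) : Shifts (leftOp D w) 0 0 w := by
  rintro f d b u ⟨r, hr, hf⟩
  refine ⟨r, hr, fun m c hm => ?_⟩
  rw [add_zero] at hm
  simp [hf m c hm]

lemma shifts_opE : Shifts (opE D) 1 0 1 := by
  rintro f d b u ⟨r, hr, hf⟩
  refine ⟨r, hr, fun m c hm => ?_⟩
  simp [hf (m - 1) c (by omega), sub_eq_iff_eq_add]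

lemma shifts_opK : Shifts (opK D s) 0 1 1 := by
  rintro f d b u ⟨r, hr, hf⟩
  refine ⟨((s : ℂ) ^ 2) ^ d * r, mul_ne_zero (zpow_ne_zero _ (sq_ne_zero' s)) hr, fun m c hm => ?_⟩
  rw [add_zero] at hm
  rw [opK_apply, hf m (c - 1) hm, add_zero, one_mul]
  by_cases h : m = d ∧ c = b + 1
  · rw [if_pos h, if_pos ⟨h.1, by omega⟩, h.1, smul_smul]
  · rw [if_neg h, if_neg (fun h' => h ⟨h'.1, by omega⟩), smul_zero]

lemma shifts_opK' : Shifts (opK' D s) 0 (-1) 1 := by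
  rintro f d b u ⟨r, hr, hf⟩
  refine ⟨((s : ℂ) ^ 2) ^ (-d) * r, mul_ne_zero (zpow_ne_zero _ (sq_ne_zero' s)) hr,
    fun m c hm => ?_⟩
  rw [add_zero] at hm
  rw [opK'_apply, hf m (c + 1) hm, add_zero, one_mul]
  by_cases h : m = d ∧ c = b + -1
  · rw [if_pos h, if_pos ⟨h.1, by omega⟩, h.1, smul_smul]
  · rw [if_neg h, if_neg (fun h' => h ⟨h'.1, by omega⟩), smul_zero]

lemma Shifts.smul {P : ShiftAlg D} {g c : ℤ} {w : D} (h : Shifts P g c w) {x : ℂ} (hx : x ≠ 0) :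
    Shifts (x • P) g c w := by
  intro f d b u hf
  obtain ⟨r, hr, h'⟩ := h f d b u hf
  refine ⟨x * r, mul_ne_zero hx hr, fun m c hm => ?_⟩
  simp [h' m c hm, mul_smul]

/-- A term of smaller first shift does not contribute to the leading term. -/
lemma Shifts.add {P Q : ShiftAlg D} {g c g' c' : ℤ} {w w' : D} (h : Shifts P g c w)
    (h' : Shifts Q g' c' w') (hg : g' < g) : Shifts (P + Q) g c w := by
  intro f d b u hf
  obtain ⟨r, hr, h1⟩ := h f d b u hf
  obtain ⟨r', hr', h2⟩ := h' f d b u hf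
  refine ⟨r, hr, fun m c hm => ?_⟩
  rw [LinearMap.add_apply, Pi.add_apply, Pi.add_apply, h1 m c hm, h2 m c (by omega),
    if_neg (c := m = d + g' ∧ _) (by omega), add_zero]

/-- The family with the single term `1`. -/
def vac (D : Type) [Ring D] [Algebra ℂ D] : ℤ → ℤ → D := fun m c => if m = 0 ∧ c = 0 then 1 else 0

lemma lead_vac : Lead (vac D) 0 0 1 := ⟨1, one_ne_zero, fun m c _ => by simp [vac]⟩

/-- Apply a relation to the vacuum and look at the highest first index that occurs. Only operators
with the same shifts contribute at the chosen position, and their coefficients are distinct members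
of the independent family `U`. -/
lemma linearIndependent_of_shifts {ι κ : Type} {U : κ → D} (hU : LinearIndependent ℂ U)
    {P : ι → ShiftAlg D} {d b : ι → ℤ} {h : ι → κ} (hP : ∀ e, Shifts (P e) (d e) (b e) (U (h e)))
    (hinj : ∀ e e', d e = d e' → b e = b e' → h e = h e' → e = e') : LinearIndependent ℂ P := by
  classical
  rw [linearIndependent_iff']
  intro t g hg
  by_contra! hne
  obtain ⟨e1, he1, hge1⟩ := hne
  obtain ⟨e0, he0, hmax⟩ := (t.filter fun e => g e ≠ 0).exists_max_image d
    ⟨e1, Finset.mem_filter.2 ⟨he1, hge1⟩⟩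
  rw [Finset.mem_filter] at he0
  have hlead := fun e => hP e _ _ _ _ (lead_vac (D := D))
  choose r hr hf using hlead
  simp only [zero_add, mul_one] at hf
  have h1 := congrFun (congrFun (LinearMap.congr_fun hg (vac D)) (d e0)) (b e0)
  simp only [LinearMap.sum_apply, LinearMap.smul_apply, Finset.sum_apply, Pi.smul_apply,
    LinearMap.zero_apply, Pi.zero_apply] at h1
  -- By maximality each surviving term is evaluated in its leading range, where it vanishes unless
  -- both indices match.
  have h2 : ∑ e ∈ t, g e • P e (vac D) (d e0) (b e0) =
      ∑ e ∈ t with d e0 = d e ∧ b e0 = b e, (g e * r e) • U (h e) := by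
    rw [Finset.sum_filter]
    refine Finset.sum_congr rfl fun e he => ?_
    by_cases hz : g e = 0
    · simp [hz]
    · rw [hf e _ _ (hmax e (Finset.mem_filter.2 ⟨he, hz⟩)), smul_ite, smul_zero, smul_smul]
  rw [h2] at h1
  set t' := t.filter fun e => d e0 = d e ∧ b e0 = b e
  have hinj' : Set.InjOn h t' := by
    intro e he e' he' hee
    have ha := (Finset.mem_filter.1 he).2
    have hb := (Finset.mem_filter.1 he').2
    exact hinj e e' (ha.1.symm.trans hb.1) (ha.2.symm.trans hb.2) hee
  have hi := hU.comp (fun e : t' => h e) (fun a b hab => Subtype.ext (hinj' a.2 b.2 hab))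
  rw [← Finset.sum_coe_sort] at h1
  have h3 := Fintype.linearIndependent_iff.1 hi (fun e => g e * r e) h1
    ⟨e0, Finset.mem_filter.2 ⟨he0.1, rfl, rfl⟩⟩
  exact mul_ne_zero he0.2 (hr e0) h3

end Shift

/-! ### Points whose first row has linearly independent ordered monomials -/

section Mono

/-- The ordered monomial `x₀ ^ e₀ x₁ ^ e₁ ⋯`. -/
def mono {M : Type*} [Monoid M] {n : ℕ} (x : Fin n → M) (e : Fin n → ℕ) : M :=
  (List.ofFn fun k => x k ^ e k).prod

lemma mono_zero {M : Type*} [Monoid M] (x : Fin 0 → M) (e : Fin 0 → ℕ) : mono x e = 1 := by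
  simp [mono]

lemma mono_one {M : Type*} [Monoid M] (x : Fin 1 → M) (e : Fin 1 → ℕ) : mono x e = x 0 ^ e 0 := by
  simp [mono]

lemma mono_inn {M : Type*} [Monoid M] {n : ℕ} (x : Fin (n + 2) → M) (e : Fin (n + 2) → ℕ) :
    mono x e = x 0 ^ e 0 * mono (fun k => x (inn k)) (fun k => e (inn k)) *
      x (Fin.last (n + 1)) ^ e (Fin.last (n + 1)) := by
  rw [mono, List.ofFn_succ, List.ofFn_succ', List.concat_eq_append, List.prod_cons, List.prod_append,
    List.prod_singleton, ← mul_assoc]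
  rfl

lemma map_mono {M M' : Type*} [Monoid M] [Monoid M'] (φ : M →* M') {n : ℕ} (x : Fin n → M)
    (e : Fin n → ℕ) : φ (mono x e) = mono (fun k => φ (x k)) e := by
  rw [mono, map_list_prod, List.map_ofFn, mono]
  congr 2
  funext k
  simp

variable {D : Type} [Ring D] [Algebra ℂ D] {s : ℂˣ}

lemma shifts_mono {n : ℕ} {x : Fin n → ShiftAlg D} {g c : ℤ} {w : Fin n → D}
    (h : ∀ k, Shifts (x k) g c (w k)) (e : Fin n → ℕ) :
    Shifts (mono x e) ((∑ k, e k : ℕ) * g) ((∑ k, e k : ℕ) * c) (mono w e) := by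
  have key : ∀ (n : ℕ) (x : Fin n → ShiftAlg D) (w : Fin n → D) (e : Fin n → ℕ),
      (∀ k, Shifts (x k) g c (w k)) →
      Shifts (mono x e) ((∑ k, e k : ℕ) * g) ((∑ k, e k : ℕ) * c) (mono w e) := by
    intro n
    induction n with
    | zero =>
      intro x w e _ f d b u hf
      simpa [mono_zero] using hf
    | succ n ih =>
      intro x w e h
      have := ((h 0).pow (e 0)).mul (ih _ _ (fun k => e k.succ) fun k => h k.succ)
      rw [mono, mono, List.ofFn_succ, List.ofFn_succ, List.prod_cons, List.prod_cons,
        Fin.sum_univ_succ]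
      push_cast
      rw [add_mul, add_mul]
      simpa [mono] using this
  exact key n x w e h

/-- A Frobenius point whose first row has linearly independent ordered monomials `e` with `p e`. -/
def RowIndep (N : ℕ) (s : ℂˣ) (m : ℕ) (p : (Fin (m + 2) → ℕ) → Prop) : Prop :=
  ∃ (D : Type) (_ : Ring D) (_ : Algebra ℂ D) (v : Matrix (Fin (m + 2)) (Fin (m + 2)) D),
    FrobPoint N s v ∧ LinearIndependent ℂ fun e : {e // p e} => mono (v 0) e.1

variable {N : ℕ}

lemma linearIndependent_unit (D : Type) [Ring D] [Algebra ℂ D] [Nontrivial D] :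
    LinearIndependent ℂ fun _ : Unit => (1 : D) :=
  LinearIndependent.of_subsingleton () one_ne_zero

/-- In type `D₁` the first row is `(K, 0)`, so only powers of `K` are needed. -/
lemma rowIndep_zero (hN : IsOddRoot s N) : RowIndep N s 0 fun e => e (Fin.last 1) = 0 := by
  refine ⟨ShiftAlg ℂ, inferInstance, inferInstance, torusPt 0 (opK ℂ s) (opK' ℂ s),
    frobPoint_torusPt hN qTorus_op.right qTorus_op.left, ?_⟩
  refine linearIndependent_of_shifts (linearIndependent_unit ℂ) (h := fun _ => ())
    (d := fun e => 0) (b := fun e => (e.1 0 : ℤ)) (fun e => ?_) ?_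
  · have := (shifts_opK (D := ℂ) (s := s)).pow (e.1 0)
    rw [mono_inn, mono_zero, e.2]
    simpa [torusPt] using this
  · rintro ⟨e, he⟩ ⟨e', he'⟩ - hb -
    ext k
    revert k
    refine inn_cases ?_ ?_ (fun k => k.elim0)
    · exact_mod_cast hb
    · exact he.trans he'.symm

/-- The first row is `K`, `E` and a multiple of `E E K'`. The second index records `e_0 - e_last`;
as one of the two exponents is zero, this determines both, and the first index then gives the middle
exponent. -/
lemma rowIndep_one (hN : IsOddRoot s N) :
    RowIndep N s 1 fun e => e 0 * e (Fin.last 2) = 0 := by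
  refine ⟨ShiftAlg ℂ, inferInstance, inferInstance, midPt s (opK ℂ s) (opK' ℂ s) (opE ℂ),
    frobPoint_midPt hN qTorus_op, ?_⟩
  refine linearIndependent_of_shifts (linearIndependent_unit ℂ) (h := fun _ => ())
    (d := fun e => (e.1 (inn 0) : ℤ) + 2 * e.1 (Fin.last 2))
    (b := fun e => (e.1 0 : ℤ) - e.1 (Fin.last 2)) (fun e => ?_) ?_
  · have h1 := (shifts_opK (D := ℂ) (s := s)).pow (e.1 0)
    have h2 := (shifts_opE (D := ℂ)).pow (e.1 (inn 0))
    have h3 := (((shifts_opE (D := ℂ)).mul ((shifts_opE (D := ℂ)).mul (shifts_opK' (D := ℂ) (s := s)))).smul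
      (x := -((s : ℂ)⁻¹ * (1 + (s : ℂ) ^ 2)⁻¹)) (neg_ne_zero.2 (mul_ne_zero (inv_ne_zero s.ne_zero)
        (inv_ne_zero hN.one_add_ne)))).pow (e.1 (Fin.last 2))
    have := (h1.mul h2).mul h3
    rw [mono_inn, mono_one]
    convert this using 1
    · simp only [midPt, midMat, ext3_zero, ext3_inn]
      rfl
    · simp; ring
    · simp; ring
    · simp
  · rintro ⟨e, he⟩ ⟨e', he'⟩ hd hb -
    simp only [mul_eq_zero] at he he' hd hb
    ext k
    revert k
    refine inn_cases ?_ ?_ (fun k => ?_)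
    · show e 0 = e' 0
      omega
    · show e (Fin.last 2) = e' (Fin.last 2)
      omega
    · rw [Subsingleton.elim k 0]
      show e (inn 0) = e' (inn 0)
      omega

lemma Shifts.of_smul {P : ShiftAlg D} {g c : ℤ} {w : D} {r : ℂ} (hr : r ≠ 0)
    (h : Shifts P g c (r • w)) : Shifts P g c w := by
  intro f d b u hf
  obtain ⟨r', hr', h'⟩ := h f d b u hf
  exact ⟨r' * r, mul_ne_zero hr' hr, fun m c hm => by
    rw [h' m c hm, smul_mul_assoc, smul_smul]⟩

lemma QTorus.pow_mul_pow {A : Type} [Ring A] [Algebra ℂ A] {K K' E : A} (h : QTorus s K K' E)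
    (i j : ℕ) : ∃ r : ℂ, r ≠ 0 ∧ E ^ i * K ^ j = r • (K ^ j * E ^ i) := by
  have hq := sq_ne_zero' s
  have h1 : ∀ j, ∃ r : ℂ, r ≠ 0 ∧ E * K ^ j = r • (K ^ j * E) := by
    intro j
    induction j with
    | zero => exact ⟨1, one_ne_zero, by simp⟩
    | succ j ih =>
      obtain ⟨r, hr, e⟩ := ih
      refine ⟨r * ((s : ℂ) ^ 2)⁻¹, mul_ne_zero hr (inv_ne_zero hq), ?_⟩
      rw [pow_succ, ← mul_assoc, e, mul_assoc, mul_smul, h.comm, mul_smul_comm,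
        inv_smul_smul₀ hq, smul_mul_assoc, mul_assoc]
  induction i with
  | zero => exact ⟨1, one_ne_zero, by simp⟩
  | succ i ih =>
    obtain ⟨r, hr, e⟩ := ih
    obtain ⟨r', hr', e'⟩ := h1 j
    refine ⟨r' * r, mul_ne_zero hr' hr, ?_⟩
    rw [pow_succ, mul_assoc, e', mul_smul_comm, ← mul_assoc, e, smul_mul_assoc, smul_smul, mul_assoc]

lemma val_cK : (ShiftComm D).val (cK D s) = opK D s := rfl
lemma val_cK' : (ShiftComm D).val (cK' D s) = opK' D s := rfl
lemma val_cE : (ShiftComm D).val (cE D) = opE D := rfl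

/-- The new first row is `u_0 K`, `u_1 K`, `u_0 E`, `-u_1 E`. Two sums of exponents are seen in the
coefficient and two in the shifts; these determine `e_0 - e_last`, and `e_0 e_last = 0` does the
rest. The hypothesis `hc` reorders the coefficients. -/
lemma RowIndep.of_fork (hN : IsOddRoot s N) {u : Matrix (Fin (0 + 2 + 2)) (Fin (0 + 2 + 2)) D}
    (hu : FrobPoint N s u)
    (hU : LinearIndependent ℂ fun e : ℕ × ℕ => u 0 0 ^ e.1 * u 0 (inn 0) ^ e.2)
    (h2 : u 0 (inn (Fin.last 1)) = 0) (h3 : u 0 (Fin.last 3) = 0)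
    (hc : ∀ i j : ℕ, ∃ r : ℂ, r ≠ 0 ∧ u 0 (inn 0) ^ i * u 0 0 ^ j = r • (u 0 0 ^ j * u 0 (inn 0) ^ i)) :
    RowIndep N s 2 fun e => e 0 * e (Fin.last 3) = 0 := by
  have hf := frobPoint_forkPt (m := 0) hN (qTorus_c (D := D) (s := s))
  refine ⟨ShiftAlg D, inferInstance, inferInstance, _,
    FrobPoint.mul hN hu hf (φ := leftOp D) (ψ := (ShiftComm D).val)
      (fun a b => (shiftComm_commute b a).symm), ?_⟩
  set y := (u.map (leftOp D) * (forkPt 0 (cK D s) (cK' D s) (cE D)).map (ShiftComm D).val) with hy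
  have y0 : y 0 0 = leftOp D (u 0 0) * opK D s := by
    rw [hy, Matrix.mul_apply, sum_inn, sum_inn]
    simp only [Matrix.map_apply, h2, h3]
    simp [forkPt, ← val_cK, -Subalgebra.coe_val]
  have y1 : y 0 (inn 0) = leftOp D (u 0 (inn 0)) * opK D s := by
    rw [hy, Matrix.mul_apply, sum_inn, sum_inn]
    simp only [Matrix.map_apply, h2, h3]
    simp [forkPt, ← val_cK, -Subalgebra.coe_val]
  have y2 : y 0 (inn (Fin.last 1)) = leftOp D (u 0 0) * opE D := by
    rw [hy, Matrix.mul_apply, sum_inn, sum_inn]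
    simp only [Matrix.map_apply, h2, h3]
    simp [forkPt, ← val_cE, -Subalgebra.coe_val, -Fin.reduceLast]
  have y3 : y 0 (Fin.last 3) = (-1 : ℂ) • (leftOp D (u 0 (inn 0)) * opE D) := by
    rw [hy, Matrix.mul_apply, sum_inn, sum_inn]
    simp only [Matrix.map_apply, h2, h3]
    simp [forkPt, ← val_cE, -Subalgebra.coe_val, -Fin.reduceLast]
    exact (mul_neg (leftOp D (u 0 (inn 0))) (opE D)).trans
      (neg_one_smul ℂ (leftOp D (u 0 (inn 0)) * opE D)).symm
  refine linearIndependent_of_shifts hU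
    (h := fun e => (e.1 0 + e.1 (inn (Fin.last 1)), e.1 (inn 0) + e.1 (Fin.last 3)))
    (d := fun e => (e.1 (inn (Fin.last 1)) : ℤ) + e.1 (Fin.last 3))
    (b := fun e => (e.1 0 : ℤ) + e.1 (inn 0)) (fun e => ?_) ?_
  · have hk := shifts_opK (D := D) (s := s)
    have he := shifts_opE (D := D)
    have h1 := ((shifts_leftOp (u 0 0)).mul hk).pow (e.1 0)
    have h2 := ((shifts_leftOp (u 0 (inn 0))).mul hk).pow (e.1 (inn 0))
    have h3 := ((shifts_leftOp (u 0 0)).mul he).pow (e.1 (inn (Fin.last 1)))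
    have h4 := (((shifts_leftOp (u 0 (inn 0))).mul he).smul (x := -1) (by simp)).pow
      (e.1 (Fin.last 3))
    have := (h1.mul (h2.mul h3)).mul h4
    obtain ⟨r, hr, hcomm⟩ := hc (e.1 (inn 0)) (e.1 (inn (Fin.last 1)))
    refine Shifts.of_smul hr ?_
    rw [mono_inn, mono_inn, mono_zero, mul_one]
    refine Eq.mp ?_ this
    congr 1
    · rw [y0]
      erw [y1, y2, y3]
    · simp
    · simp
    · simp only [mul_one, pow_add]
      rw [hcomm]
      simp [mul_assoc]
  · rintro ⟨e, he⟩ ⟨e', he'⟩ hd hb hh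
    simp only [mul_eq_zero, Prod.mk.injEq] at he he' hd hb hh
    ext k
    revert k
    refine inn_cases ?_ ?_ (inn_cases ?_ ?_ (fun k => k.elim0))
    · show e 0 = e' 0
      omega
    · show e (Fin.last 3) = e' (Fin.last 3)
      omega
    · show e (inn 0) = e' (inn 0)
      omega
    · show e (inn (Fin.last 1)) = e' (inn (Fin.last 1))
      omega

/-- Type `D₂` is a separate base case, built from both simple roots: the root point gives the row
`(K, E, 0, 0)`, and the fork point fills in the other half. -/
lemma rowIndep_two (hN : IsOddRoot s N) :
    RowIndep N s 2 fun e => e 0 * e (Fin.last 3) = 0 := by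
  refine RowIndep.of_fork hN (frobPoint_rootPt (m := 0) hN (qTorus_op (D := ℂ) (s := s))) ?_ ?_ ?_ ?_
  · refine linearIndependent_of_shifts (linearIndependent_unit ℂ) (h := fun _ => ())
      (d := fun e => (e.2 : ℤ)) (b := fun e => (e.1 : ℤ)) (fun e => ?_) ?_
    · have := ((shifts_opK (D := ℂ) (s := s)).pow e.1).mul ((shifts_opE (D := ℂ)).pow e.2)
      simpa [rootPt] using this
    · rintro ⟨a, b⟩ ⟨a', b'⟩ h1 h2 -
      simp only [Nat.cast_inj] at h1 h2
      rw [h1, h2]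
  · simp [rootPt, -Fin.reduceLast]
  · simp only [rootPt, ext3_zero]; rfl
  · simpa [rootPt] using (qTorus_op (D := ℂ) (s := s)).pow_mul_pow

/-- Multiplying by the root point spreads `u_0` and `u_1'` over two entries each. Independence for
rows with exponents `0` at `1` and `0'` thereby becomes independence under the weaker constraint
`e_0 e_last = 0`. -/
lemma RowIndep.of_root {m : ℕ} (hN : IsOddRoot s N)
    {u : Matrix (Fin (m + 2 + 2)) (Fin (m + 2 + 2)) D} (hu : FrobPoint N s u)
    (hU : LinearIndependent ℂ fun e : {e : Fin (m + 2 + 2) → ℕ //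
      e (inn 0) = 0 ∧ e (Fin.last (m + 2 + 1)) = 0} => mono (u 0) e.1)
    (hl : u 0 (Fin.last (m + 2 + 1)) = 0) :
    RowIndep N s (m + 2) fun e => e 0 * e (Fin.last (m + 2 + 1)) = 0 := by
  have hr := frobPoint_rootPt (m := m) hN (qTorus_c (D := D) (s := s))
  refine ⟨ShiftAlg D, inferInstance, inferInstance, _,
    FrobPoint.mul hN hu hr (φ := leftOp D) (ψ := (ShiftComm D).val)
      (fun a b => (shiftComm_commute b a).symm), ?_⟩
  set y := (u.map (leftOp D) * (rootPt m (cK D s) (cK' D s) (cE D)).map (ShiftComm D).val) with hy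
  have y0 : y 0 0 = leftOp D (u 0 0) * opK D s := by
    rw [hy, Matrix.mul_apply, sum_inn, sum_inn]
    simp only [Matrix.map_apply, hl]
    simp [rootPt, ← val_cK, -Subalgebra.coe_val]
  have y1 : y 0 (inn 0) = leftOp D (u 0 0) * opE D + leftOp D (u 0 (inn 0)) * opK' D s := by
    rw [hy, Matrix.mul_apply, sum_inn, sum_inn]
    simp only [Matrix.map_apply, hl]
    simp [rootPt, ← val_cE, ← val_cK', -Subalgebra.coe_val]
  have y2 : ∀ k, y 0 (inn (inn k)) = leftOp D (u 0 (inn (inn k))) := fun k => by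
    rw [hy, Matrix.mul_apply, sum_inn, sum_inn]
    simp only [Matrix.map_apply, hl]
    simp [rootPt, -Subalgebra.coe_val, Matrix.one_apply, apply_ite (ShiftComm D).val]
  have y3 : y 0 (inn (Fin.last (m + 1))) = leftOp D (u 0 (inn (Fin.last (m + 1)))) * opK D s := by
    rw [hy, Matrix.mul_apply, sum_inn, sum_inn]
    simp only [Matrix.map_apply, hl]
    simp [rootPt, ← val_cK, -Subalgebra.coe_val]
  have y4 : y 0 (Fin.last (m + 2 + 1)) =
      (-1 : ℂ) • (leftOp D (u 0 (inn (Fin.last (m + 1)))) * opE D) := by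
    rw [hy, Matrix.mul_apply, sum_inn, sum_inn]
    simp only [Matrix.map_apply, hl]
    simp [rootPt, ← val_cE, -Subalgebra.coe_val]
    exact (mul_neg (leftOp D (u 0 (inn (Fin.last (m + 1))))) (opE D)).trans
      (neg_one_smul ℂ (leftOp D (u 0 (inn (Fin.last (m + 1)))) * opE D)).symm
  refine linearIndependent_of_shifts hU
    -- The leading coefficient merges exponents: positions `0` and `1` both lead with `u_0`, and
    -- positions `1'` and `0'` both with `u_1'`.
    (h := fun e => ⟨ext3 (e.1 0 + e.1 (inn 0)) (ext3 0 (fun k => e.1 (inn (inn k)))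
      (e.1 (inn (Fin.last _)) + e.1 (Fin.last _))) 0, by simp⟩)
    (d := fun e => (e.1 (inn 0) : ℤ) + e.1 (Fin.last _))
    (b := fun e => (e.1 0 : ℤ) + e.1 (inn (Fin.last _))) (fun e => ?_) ?_
  · have hk := shifts_opK (D := D) (s := s)
    have hk' := shifts_opK' (D := D) (s := s)
    have he := shifts_opE (D := D)
    have h1 := ((shifts_leftOp (u 0 0)).mul hk).pow (e.1 0)
    -- In the entry `u_0 E + u_1 K'` the first summand leads, since only `E` raises the first index.
    have h2 := (((shifts_leftOp (u 0 0)).mul he).add ((shifts_leftOp (u 0 (inn 0))).mul hk')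
      (by norm_num)).pow (e.1 (inn 0))
    have h3 := shifts_mono (fun k => shifts_leftOp (u 0 (inn (inn k)))) (fun k => e.1 (inn (inn k)))
    have h4 := ((shifts_leftOp (u 0 (inn (Fin.last _)))).mul hk).pow (e.1 (inn (Fin.last _)))
    have h5 := (((shifts_leftOp (u 0 (inn (Fin.last _)))).mul he).smul (x := -1)
      (by simp)).pow (e.1 (Fin.last _))
    have := (h1.mul ((h2.mul h3).mul h4)).mul h5
    rw [mono_inn, mono_inn]
    refine Eq.mp ?_ this
    congr 1
    · rw [y0, y1, y3, y4]
      simp only [y2]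
    · simp
    · simp
    · rw [mono_inn, mono_inn]
      simp [pow_add, mul_assoc]
  · rintro ⟨e, he⟩ ⟨e', he'⟩ hd hb hh
    have hh' := Subtype.ext_iff.1 hh
    have g1 := congrFun hh' 0
    have g2 := fun k => congrFun hh' (inn (inn k))
    have g3 := congrFun hh' (inn (Fin.last _))
    change e 0 * e (Fin.last (m + 3)) = 0 at he
    change e' 0 * e' (Fin.last (m + 3)) = 0 at he'
    -- The known sums give `e_0 - e_last`; the vanishing of one of the two exponents recovers each.
    simp only [mul_eq_zero, ext3_zero, ext3_inn, ext3_last] at he he' hd hb g1 g2 g3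
    ext k
    revert k
    refine inn_cases ?_ ?_ (inn_cases ?_ ?_ (fun k => ?_))
    · show e 0 = e' 0
      omega
    · show e (Fin.last _) = e' (Fin.last _)
      omega
    · show e (inn 0) = e' (inn 0)
      omega
    · show e (inn (Fin.last _)) = e' (inn (Fin.last _))
      omega
    · exact g2 k

/-- The root point times `diag(1, v, 1)` has first row `(K, E v_0, 0)`. Exponent `0` at position `1`
means exponent `0` at the first entry of `v_0`, so the constraint for `v` holds, and
`RowIndep.of_root` applies. The simple root is thus used on both sides of the inner block. -/
lemma rowIndep_add_two {m : ℕ} (hN : IsOddRoot s N)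
    (hv : RowIndep N s m fun e => e 0 * e (Fin.last (m + 1)) = 0) :
    RowIndep N s (m + 2) fun e => e 0 * e (Fin.last (m + 2 + 1)) = 0 := by
  obtain ⟨D, _, _, v, hv, hU⟩ := hv
  have hp := frobPoint_rootPt (m := m) hN (qTorus_c (D := D) (s := s))
  have hu := FrobPoint.mul hN hp (hv.bd hN) (φ := (ShiftComm D).val) (ψ := leftOp D)
    shiftComm_commute
  set u := (rootPt m (cK D s) (cK' D s) (cE D)).map (ShiftComm D).val * (bd v).map (leftOp D) with hudef
  have hx0 : u 0 0 = opK D s := by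
    rw [hudef, Matrix.mul_apply, sum_inn, sum_inn]
    simp only [Matrix.map_apply]
    simp [rootPt, ← val_cK, -Subalgebra.coe_val]
  have hxi : ∀ k, u 0 (inn k) = opE D * leftOp D (v 0 k) := fun k => by
    rw [hudef, Matrix.mul_apply, sum_inn, sum_inn]
    simp only [Matrix.map_apply]
    simp [rootPt, ← val_cE, -Subalgebra.coe_val]
  have hxl : u 0 (Fin.last _) = 0 := by
    rw [hudef, Matrix.mul_apply, sum_inn, sum_inn]
    simp only [Matrix.map_apply]
    simp [rootPt, -Subalgebra.coe_val]
  refine RowIndep.of_root hN hu ?_ hxl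
  refine linearIndependent_of_shifts hU
    (h := fun e => ⟨fun k => e.1 (inn k), by simp [e.2.1]⟩)
    (d := fun e => ((∑ k, e.1 (inn k) : ℕ) : ℤ)) (b := fun e => (e.1 0 : ℤ)) (fun e => ?_) ?_
  · have h1 := (shifts_opK (D := D) (s := s)).pow (e.1 0)
    have h2 := shifts_mono (fun k => (shifts_opE (D := D)).mul (shifts_leftOp (v 0 k)))
      (fun k => e.1 (inn k))
    have h3 : mono (u 0) e.1 = opK D s ^ e.1 0 *
        mono (fun k => opE D * leftOp D (v 0 k)) (fun k => e.1 (inn k)) := by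
      rw [mono_inn, hx0, e.2.2, pow_zero, mul_one]
      simp only [hxi]
    rw [h3]
    simpa using h1.mul h2
  · rintro ⟨e, h1, h2⟩ ⟨e', h1', h2'⟩ - hb hh
    ext k
    revert k
    refine inn_cases ?_ ?_ (fun k => ?_)
    · exact_mod_cast hb
    · exact h2.trans h2'.symm
    · exact congrFun (Subtype.ext_iff.1 hh) k

/-- Induction in steps of two from types `B₁` and `D₂`, under the constraint `e_0 e_last = 0` that
the step reproduces; the case `e_last = 0` is then a subfamily. -/
lemma rowIndep (hN : IsOddRoot s N) (m : ℕ) : RowIndep N s m fun e => e (Fin.last (m + 1)) = 0 := by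
  have key : ∀ m, RowIndep N s (m + 1) (fun e => e 0 * e (Fin.last (m + 1 + 1)) = 0) ∧
      RowIndep N s (m + 2) (fun e => e 0 * e (Fin.last (m + 2 + 1)) = 0) := by
    intro m
    induction m with
    | zero => exact ⟨rowIndep_one hN, rowIndep_two hN⟩
    | succ m ih => exact ⟨ih.2, rowIndep_add_two hN ih.1⟩
  cases m with
  | zero => exact rowIndep_zero hN
  | succ m =>
    obtain ⟨D, i1, i2, v, hv, hU⟩ := (key m).1
    refine ⟨D, i1, i2, v, hv, ?_⟩
    exact hU.comp (fun e : {e : Fin (m + 1 + 2) → ℕ // e (Fin.last _) = 0} => ⟨e.1, by simp [e.2]⟩)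
      fun e e' h => Subtype.ext (by have := congrArg Subtype.val h; exact this)

end Mono

/-! ### Inner blocks and spanning by ordered monomials -/

section Inner

variable {n N : ℕ} {A : Type*} [Ring A] [Algebra ℂ A] {s : ℂˣ}

/-- The inner block of a matrix. -/
def innerBlock {α : Type*} (z : Matrix (Fin (n + 2)) (Fin (n + 2)) α) : Matrix (Fin n) (Fin n) α :=
  Matrix.of fun i k => z (inn i) (inn k)

@[simp] lemma innerBlock_apply {α : Type*} (z : Matrix (Fin (n + 2)) (Fin (n + 2)) α) (i k : Fin n) :
    innerBlock z i k = z (inn i) (inn k) := rfl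

lemma IsPoint.tri_inn_zero {z : Matrix (Fin (n + 2)) (Fin (n + 2)) A} (h : IsPoint s z) (i : Fin n) :
    z (inn i) 0 = 0 := h.tri _ _ (zero_lt_inn i)

lemma IsPoint.tri_last_inn {z : Matrix (Fin (n + 2)) (Fin (n + 2)) A} (h : IsPoint s z) (i : Fin n) :
    z (Fin.last _) (inn i) = 0 := h.tri _ _ (inn_lt_last i)

/-- Triangularity kills the outer terms of the truncated forms and of the matrix products. -/
lemma IsPoint.innerBlock {z : Matrix (Fin (n + 2)) (Fin (n + 2)) A} (h : IsPoint s z) :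
    IsPoint s (innerBlock z) where
  frt := by
    refine frt_of_sides fun i j a b => ?_
    have := h.sides (inn i) (inn j) (inn a) (inn b)
    rw [rowSide_eq, colSide_eq, upperForm_inn, lowerForm_inn, h.tri_inn_zero, h.tri_last_inn] at this
    simp only [qd_inn, inn_lt_inn, metricJ_inn, zero_mul, mul_zero, smul_zero, add_zero] at this
    rw [rowSide_eq, colSide_eq]
    exact this
  left := by
    ext i j
    have := congrFun (congrFun h.left (inn i)) (inn j)
    rw [metricL_eq, Matrix.mul_apply, sum_inn] at this
    rw [metricL_eq, Matrix.mul_apply]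
    simpa [metricInv_apply, h.tri_inn_zero, Matrix.one_apply] using this
  right := by
    ext i j
    have := congrFun (congrFun h.right (inn i)) (inn j)
    rw [Matrix.mul_apply, sum_inn] at this
    rw [Matrix.mul_apply]
    simpa [metricInv_apply, h.tri_last_inn, Matrix.one_apply, h.tri 0 0,
      h.tri (Fin.last (n + 1)) (inn j.rev)] using this
  tri i j hij := h.tri _ _ (inn_lt_inn.2 hij)
  mid i hi := h.mid _ (by rw [rev_inn, hi])

lemma mul_pow_eq_smul {x y : A} {c : ℂ} (h : y * x = c • (x * y)) (a : ℕ) :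
    y * x ^ a = c ^ a • (x ^ a * y) := by
  induction a with
  | zero => simp
  | succ a ih =>
    rw [pow_succ, ← mul_assoc, ih, smul_mul_assoc, mul_assoc, h, mul_smul_comm, smul_smul, ← mul_assoc,
      pow_succ]

lemma mul_mono_eq_smul {x : Fin n → A} {y : A} {c : ℂ} (hc : c ≠ 0)
    (h : ∀ k, y * x k = c • (x k * y)) (e : Fin n → ℕ) :
    ∃ d : ℂ, d ≠ 0 ∧ y * mono x e = d • (mono x e * y) := by
  induction n with
  | zero => exact ⟨1, one_ne_zero, by simp [mono_zero]⟩
  | succ n ih =>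
    obtain ⟨d, hd, h'⟩ := ih (x := fun k => x k.succ) (fun k => h k.succ) (fun k => e k.succ)
    refine ⟨c ^ e 0 * d, mul_ne_zero (pow_ne_zero _ hc) hd, ?_⟩
    have : mono x e = x 0 ^ e 0 * mono (fun k => x k.succ) (fun k => e k.succ) := by
      rw [mono, List.ofFn_succ, List.prod_cons]; rfl
    rw [this, ← mul_assoc, mul_pow_eq_smul (h 0), smul_mul_assoc, mul_assoc, h', mul_smul_comm,
      smul_smul, ← mul_assoc]

lemma mul_mul_mem_of_range {ι : Type*} {f : ι → A} {S : Submodule ℂ A} {y y' : A}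
    (h : ∀ e, y * f e * y' ∈ S) {t : A} (ht : t ∈ Submodule.span ℂ (Set.range f)) : y * t * y' ∈ S := by
  have : Submodule.span ℂ (Set.range f) ≤
      S.comap ((LinearMap.mulRight ℂ y').comp (LinearMap.mulLeft ℂ y)) := by
    rw [Submodule.span_le]
    rintro _ ⟨e, rfl⟩
    exact h e
  exact this ht

lemma mul_mem_of_range {ι : Type*} {f : ι → A} {S : Submodule ℂ A} {y : A}
    (h : ∀ e, y * f e ∈ S) {t : A} (ht : t ∈ Submodule.span ℂ (Set.range f)) : y * t ∈ S := by
  have := mul_mul_mem_of_range (y' := 1) (by simpa using h) ht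
  simpa using this

/-- The span of the ordered monomials. -/
def monoSpan (x : Fin n → A) : Submodule ℂ A := Submodule.span ℂ (Set.range (mono x))

lemma mono_mem_monoSpan (x : Fin n → A) (e : Fin n → ℕ) : mono x e ∈ monoSpan x :=
  Submodule.subset_span ⟨e, rfl⟩

lemma midForm_zero (x : Fin (n + 2) → A) :
    midForm s x 0 = fullForm s (fun k => x (inn k)) (fun k => x (inn k)) := by
  rw [midForm, sum_inn]
  simp [fullForm]

lemma RowRel.zero_inn {x : Fin (n + 2) → A} (h : RowRel s x) (k : Fin n) :
    x (QSO.inn k) * x 0 = ((s : ℂ) ^ 2)⁻¹ • (x 0 * x (QSO.inn k)) :=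
  h.comm (zero_lt_inn k) (by simp)

lemma RowRel.last_inn {x : Fin (n + 2) → A} (h : RowRel s x) (k : Fin n) :
    x (Fin.last _) * x (QSO.inn k) = ((s : ℂ) ^ 2)⁻¹ • (x (QSO.inn k) * x (Fin.last _)) :=
  h.comm (inn_lt_last k) (by simp)

/-- Normal ordering by recursion on the outer pair. Inner entries q-commute with both outer ones;
passing `x_last` over a power of `x_0` leaves inner quadratic terms with a smaller power of `x_0`.
-/
lemma RowRel.mul_mem_monoSpan (hN : IsOddRoot s N) : ∀ {n : ℕ} {x : Fin n → A} (_ : RowRel s x) (k : Fin n)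
    {t : A}, t ∈ monoSpan x → x k * t ∈ monoSpan x
  | 0, _, _, k, _, _ => k.elim0
  | 1, x, h, k, t, ht => by
    refine mul_mem_of_range (fun e => ?_) ht
    have : x k * mono x e = mono x (fun i => e i + 1) := by
      rw [mono_one, mono_one, pow_succ', Subsingleton.elim k 0]
    rw [this]
    exact mono_mem_monoSpan _ _
  | n + 2, x, h, k, t, ht => by
    have hR : ∀ a b : ℕ, ∀ r ∈ monoSpan (fun k => x (QSO.inn k)),
        x 0 ^ a * r * x (Fin.last _) ^ b ∈ monoSpan x := by
      intro a b r hr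
      refine mul_mul_mem_of_range (fun e => ?_) hr
      have := mono_mem_monoSpan x (ext3 a e b)
      rw [mono_inn] at this
      simpa using this
    have h0 : ∀ t ∈ monoSpan x, x 0 * t ∈ monoSpan x := by
      intro t ht
      refine mul_mem_of_range (fun e => ?_) ht
      rw [mono_inn, ← mul_assoc, ← mul_assoc, ← pow_succ']
      exact hR _ _ _ (mono_mem_monoSpan _ _)
    have hi : ∀ k, ∀ t ∈ monoSpan x, x (QSO.inn k) * t ∈ monoSpan x := by
      intro k t ht
      refine mul_mem_of_range (fun e => ?_) ht
      rw [mono_inn, ← mul_assoc, ← mul_assoc, mul_pow_eq_smul (h.zero_inn k), smul_mul_assoc,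
        smul_mul_assoc, mul_assoc (x 0 ^ _)]
      exact Submodule.smul_mem _ _ (hR _ _ _
        (RowRel.mul_mem_monoSpan hN h.inn k (mono_mem_monoSpan _ _)))
    have hl : ∀ t ∈ monoSpan x, x (Fin.last _) * t ∈ monoSpan x := by
      intro t ht
      refine mul_mem_of_range (fun e => ?_) ht
      rw [mono_inn]
      generalize e 0 = a
      induction a with
      | zero =>
        obtain ⟨d, -, hd⟩ := mul_mono_eq_smul (inv_ne_zero (sq_ne_zero' s)) h.last_inn (fun k => e (QSO.inn k))
        rw [pow_zero, one_mul, ← mul_assoc, hd, smul_mul_assoc, mul_assoc, ← pow_succ']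
        have := hR 0 (e (Fin.last _) + 1) _ (mono_mem_monoSpan _ (fun k => e (QSO.inn k)))
        rw [pow_zero, one_mul] at this
        exact Submodule.smul_mem _ _ this
      | succ a ih =>
        obtain ⟨c, hc⟩ := h.pair' hN.odd hN.pow (a := 0) (by simp)
        rw [rev_zero', midForm_zero] at hc
        rw [pow_succ', mul_assoc, mul_assoc, ← mul_assoc (x (Fin.last _)), hc, add_mul,
          mul_assoc (x 0), smul_mul_assoc]
        refine Submodule.add_mem _ (h0 _ ?_) (Submodule.smul_mem _ _ ?_)
        · rwa [mul_assoc] at ih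
        · rw [fullForm, Finset.sum_mul]
          refine Submodule.sum_mem _ fun l _ => ?_
          rw [smul_mul_assoc, mul_assoc]
          refine Submodule.smul_mem _ _ (hi _ _ (hi _ _ ?_))
          have := hR a (e (Fin.last _)) _ (mono_mem_monoSpan _ (fun k => e (QSO.inn k)))
          rwa [mul_assoc] at this
    revert k
    exact inn_cases (h0 _ ht) (hl _ ht) fun k => hi k _ ht

/-- Localization at a normal element `K`: if a space `P` is stable under left multiplication by
the elements of `g`, and under conjugation by `K`, then every element generated by `g` and the
inverse of `K` lies in `P` after multiplication by a power of `K`. -/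
lemma exists_mul_pow_mem {P : Submodule ℂ A} {K K' : A} (hK : K' * K = 1) (h1 : 1 ∈ P)
    (hP : ∀ p ∈ P, p * K ∈ P) (hP' : ∀ p ∈ P, K' * p * K ∈ P) {x : A}
    (hx : x ∈ Algebra.adjoin ℂ (insert K' {y | ∀ p ∈ P, y * p ∈ P})) : ∃ M : ℕ, x * K ^ M ∈ P := by
  have hpow : ∀ (M : ℕ), ∀ p ∈ P, p * K ^ M ∈ P := by
    intro M p hp
    induction M with
    | zero => simpa using hp
    | succ M ih => rw [pow_succ, ← mul_assoc]; exact hP _ ih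
  -- Stated for `x * y` with arbitrary `y`, so that the claim passes through products of generators.
  have key : ∀ y, (∃ M : ℕ, y * K ^ M ∈ P) → ∃ M : ℕ, x * y * K ^ M ∈ P := by
    induction hx using Algebra.adjoin_induction with
    | mem x hx =>
      rintro y ⟨M, hM⟩
      rcases hx with rfl | hx
      · refine ⟨M + 1, ?_⟩
        rw [pow_succ, ← mul_assoc, mul_assoc x]
        exact hP' _ hM
      · exact ⟨M, by rw [mul_assoc]; exact hx _ hM⟩
    | algebraMap r =>
      rintro y ⟨M, hM⟩
      refine ⟨M, ?_⟩
      rw [← Algebra.smul_def, smul_mul_assoc]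
      exact P.smul_mem _ hM
    | add a b _ _ ha hb =>
      intro y hy
      obtain ⟨M, hM⟩ := ha y hy
      obtain ⟨M', hM'⟩ := hb y hy
      refine ⟨M + M', ?_⟩
      rw [add_mul, add_mul]
      refine P.add_mem ?_ ?_
      · rw [pow_add, ← mul_assoc]; exact hpow _ _ hM
      · rw [add_comm, pow_add, ← mul_assoc]; exact hpow _ _ hM'
    | mul a b _ _ ha hb =>
      intro y hy
      rw [mul_assoc a]
      exact ha _ (hb _ hy)
  have := key 1 ⟨0, by simpa using h1⟩
  simpa using this

end Inner

/-! ### Normal form in the quantum Borel algebra -/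

section CoeffSum

variable {A H ι : Type*} [Ring A] [Algebra ℂ A] [Ring H] [Algebra ℂ H]

/-- The linear combination `∑ j(c_e) r_e`. -/
def coeffSum (j : H →ₐ[ℂ] A) (r : ι → A) : (ι →₀ H) →ₗ[ℂ] A :=
  Finsupp.lsum ℂ fun e => (LinearMap.mulRight ℂ (r e)).comp j.toLinearMap

@[simp] lemma coeffSum_single (j : H →ₐ[ℂ] A) (r : ι → A) (e : ι) (c : H) :
    coeffSum j r (Finsupp.single e c) = j c * r e := by
  simp [coeffSum]

lemma mul_mul_mem_of_coeffSum {j : H →ₐ[ℂ] A} {r : ι → A} {S : Submodule ℂ A} {y y' : A}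
    (h : ∀ c e, y * (j c * r e) * y' ∈ S) {p : A} (hp : p ∈ LinearMap.range (coeffSum j r)) :
    y * p * y' ∈ S := by
  obtain ⟨c, rfl⟩ := hp
  induction c using Finsupp.induction_linear with
  | zero => simp
  | add a b ha hb => rw [map_add, mul_add, add_mul]; exact S.add_mem ha hb
  | single e c => rw [coeffSum_single]; exact h c e

lemma mul_mem_of_coeffSum {j : H →ₐ[ℂ] A} {r : ι → A} {S : Submodule ℂ A} {y : A}
    (h : ∀ c e, y * (j c * r e) ∈ S) {p : A} (hp : p ∈ LinearMap.range (coeffSum j r)) :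
    y * p ∈ S := by
  have := mul_mul_mem_of_coeffSum (y' := 1) (by simpa using h) hp
  simpa using this

lemma mul_mem_range_coeffSum {j : H →ₐ[ℂ] A} {r : ι → A} (c : H) {w : A}
    (hw : w ∈ Submodule.span ℂ (Set.range r)) : j c * w ∈ LinearMap.range (coeffSum j r) :=
  mul_mem_of_range (S := LinearMap.range (coeffSum j r))
    (fun e => ⟨Finsupp.single e c, coeffSum_single ..⟩) hw

end CoeffSum

/-! ### Spanning over the inner block by first row monomials -/

section Spanning

variable {n N : ℕ} {s : ℂˣ}

/-- The exponents of the monomials in all but the last variable. -/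
abbrev Expo (n : ℕ) : Type := {e : Fin (n + 2) → ℕ // e (Fin.last (n + 1)) = 0}

variable {A : Type*} [Ring A] [Algebra ℂ A]

lemma pow_mul_mem_span {x : Fin (n + 2) → A} (a : ℕ) {t : A} (ht : t ∈ monoSpan fun k => x (inn k)) :
    x 0 ^ a * t ∈ Submodule.span ℂ (Set.range fun e : Expo n => mono x e.1) := by
  refine mul_mem_of_range (fun e => ?_) ht
  refine Submodule.subset_span ⟨⟨ext3 a e 0, by simp⟩, ?_⟩
  simp [mono_inn]

lemma mono_expo (x : Fin (n + 2) → A) (e : Expo n) :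
    mono x e.1 = x 0 ^ e.1 0 * mono (fun k => x (inn k)) (fun k => e.1 (inn k)) := by
  rw [mono_inn, e.2, pow_zero, mul_one]

lemma RowRel.zero_mul_mem {x : Fin (n + 2) → A} {t : A}
    (ht : t ∈ Submodule.span ℂ (Set.range fun e : Expo n => mono x e.1)) :
    x 0 * t ∈ Submodule.span ℂ (Set.range fun e : Expo n => mono x e.1) := by
  refine mul_mem_of_range (fun e => ?_) ht
  rw [mono_expo, ← mul_assoc, ← pow_succ']
  exact pow_mul_mem_span _ (mono_mem_monoSpan _ _)

lemma RowRel.inn_mul_mem (hN : IsOddRoot s N) {x : Fin (n + 2) → A} (h : RowRel s x) (k : Fin n) {t : A}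
    (ht : t ∈ Submodule.span ℂ (Set.range fun e : Expo n => mono x e.1)) :
    x (QSO.inn k) * t ∈ Submodule.span ℂ (Set.range fun e : Expo n => mono x e.1) := by
  refine mul_mem_of_range (fun e => ?_) ht
  rw [mono_expo, ← mul_assoc, mul_pow_eq_smul (h.zero_inn k), smul_mul_assoc, mul_assoc]
  exact Submodule.smul_mem _ _ (pow_mul_mem_span _
    (h.inn.mul_mem_monoSpan hN k (mono_mem_monoSpan _ _)))

lemma RowRel.mono_mul_zero {x : Fin (n + 2) → A} (h : RowRel s x) (e : Expo n) :
    ∃ d : ℂ, mono x e.1 * x 0 = d • (x 0 * mono x e.1) := by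
  obtain ⟨d, hd, h'⟩ := mul_mono_eq_smul (x := fun k => x (QSO.inn k)) (y := x 0) (sq_ne_zero' s)
    (fun k => h.comm' (zero_lt_inn k) (by simp)) (fun k => e.1 (QSO.inn k))
  refine ⟨d⁻¹, ?_⟩
  rw [mono_expo, eq_inv_smul_iff₀ hd, mul_assoc, ← mul_smul_comm, ← h', ← mul_assoc, ← mul_assoc,
    ← pow_succ, ← pow_succ']

variable {z : Matrix (Fin (n + 2)) (Fin (n + 2)) A}

lemma IsPoint.rowRel_zero (h : IsPoint s z) : RowRel s (z 0) := h.rowRel (by simp)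

lemma IsPoint.last_mul_zero (h : IsPoint s z) : z (Fin.last _) (Fin.last _) * z 0 0 = 1 := by
  have := h.fullForm_row (Fin.last _) 0
  rw [fullForm_sum_inn, h.tri (Fin.last _) 0 (by simp)] at this
  simp only [h.tri_last_inn, fullForm_zero_left', zero_mul, smul_zero, add_zero, metricJ_last_zero,
    Algebra.algebraMap_eq_smul_one] at this
  exact smul_right_injective _ (zpow_ne_zero (n : ℤ) s.ne_zero) this

lemma IsPoint.zero_mul_last (h : IsPoint s z) : z 0 0 * z (Fin.last _) (Fin.last _) = 1 := by
  have := h.fullForm_row 0 (Fin.last _)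
  rw [fullForm_sum_inn, h.tri (Fin.last _) 0 (by simp)] at this
  simp only [h.tri_last_inn, fullForm_zero_right', mul_zero, smul_zero, zero_add, metricJ_zero_last,
    Algebra.algebraMap_eq_smul_one] at this
  exact smul_right_injective _ (zpow_ne_zero (-n : ℤ) s.ne_zero) this

lemma IsPoint.inn_last_mul_zero (h : IsPoint s z) (i : Fin n) :
    z (inn i) (Fin.last _) * z 0 0 =
      -(s : ℂ) ^ (-n : ℤ) • fullForm s (fun k => z (inn i) (inn k)) (fun k => z 0 (inn k)) := by
  have := h.fullForm_row (inn i) 0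
  rw [fullForm_sum_inn, h.tri_inn_zero] at this
  simp only [zero_mul, smul_zero, add_zero, metricJ_inn_zero, map_zero] at this
  rw [add_eq_zero_iff_eq_neg] at this
  rw [neg_smul, ← smul_neg, ← this, smul_smul, ← zpow_add₀ s.ne_zero, neg_add_cancel, zpow_zero, one_smul]

/-- The first row is isotropic and its outer entries commute up to the inner form. Solving the two
relations requires `s ^ n + s ^ (-n) ≠ 0`, which holds because `N` is odd. -/
lemma IsPoint.zero_last_mul_zero (hN : IsOddRoot s N) (h : IsPoint s z) :
    ∃ c : ℂ, z 0 (Fin.last _) * z 0 0 =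
      c • fullForm s (fun k => z 0 (inn k)) (fun k => z 0 (inn k)) := by
  have h1 := h.fullForm_row 0 0
  rw [fullForm_sum_inn] at h1
  simp only [metricJ_zero_zero, map_zero] at h1
  obtain ⟨c, hc⟩ := h.rowRel_zero.pair' hN.odd hN.pow (a := 0) (by simp)
  rw [rev_zero', midForm_zero] at hc
  have h0 : (s : ℂ) ^ (n : ℤ) + (s : ℂ) ^ (-n : ℤ) ≠ 0 := by
    intro h0
    have h2 := hN.zpow_pow n
    rw [eq_neg_of_add_eq_zero_left h0, hN.odd.neg_pow, hN.zpow_pow] at h2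
    norm_num at h2
  refine ⟨((s : ℂ) ^ (n : ℤ) + (s : ℂ) ^ (-n : ℤ))⁻¹ * (c * (s : ℂ) ^ (-n : ℤ) - 1), ?_⟩
  rw [← smul_smul, eq_inv_smul_iff₀ h0]
  linear_combination (norm := module) h1 + (s : ℂ) ^ (-n : ℤ) • hc

lemma IsPoint.commute_zero_inn (h : IsPoint s z) (i b : Fin n) :
    Commute (z 0 0) (z (inn i) (inn b)) := by
  have := h.sides (inn i) 0 0 (inn b)
  rw [rowSide_eq, colSide_eq, h.tri_inn_zero] at this
  simp at this
  exact this.symm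

/-- The FRT relation that moves a first row entry to the right of an inner entry. -/
lemma IsPoint.row_zero_mul_inn (h : IsPoint s z) (a i b : Fin n) :
    z 0 (inn a) * z (inn i) (inn b) =
      qd s a b • (z (inn i) (inn b) * z 0 (inn a))
        + (if a < b then lam s • (z (inn i) (inn a) * z 0 (inn b)) else 0)
        - (lam s * metricJ s a b) •
          upperForm s (fun k => z (inn i) (inn k)) (fun k => z 0 (inn k)) a := by
  have := h.sides (inn i) 0 (inn a) (inn b)
  rw [rowSide_eq, colSide_eq, upperForm_inn, h.tri_inn_zero] at this
  simp at this
  exact this.symm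

/-- The map `O_q(B⁺_n) → O_q(B⁺_{n+2})` onto the inner block. -/
def OqB.inner (n : ℕ) (s : ℂˣ) : OqB n s →ₐ[ℂ] OqB (n + 2) s :=
  OqB.lift (innerBlock (OqB.z (n + 2) s)) (OqB.isPoint _ _).innerBlock

@[simp] lemma OqB.inner_z (i k : Fin n) : OqB.inner n s (OqB.z n s i k) = OqB.z (n + 2) s (inn i) (inn k) := by
  simp [OqB.inner]

lemma OqB.commute_zero_inner (x : OqB n s) : Commute (OqB.z (n + 2) s 0 0) (OqB.inner n s x) := by
  induction x using OqB.induction with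
  | hs c => rw [AlgHom.commutes]; exact Algebra.commute_algebraMap_right _ _
  | hz i j => rw [OqB.inner_z]; exact (OqB.isPoint _ _).commute_zero_inn i j
  | ha x y hx hy => rw [map_add]; exact hx.add_right hy
  | hm x y hx hy => rw [map_mul]; exact hx.mul_right hy

lemma OqB.row_zero_mul_inner (a : Fin n) (x : OqB n s) :
    OqB.z (n + 2) s 0 (inn a) * OqB.inner n s x ∈ Submodule.span ℂ
      (Set.range fun p : OqB n s × Fin n => OqB.inner n s p.1 * OqB.z (n + 2) s 0 (inn p.2)) := by
  set S := Submodule.span ℂ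
      (Set.range fun p : OqB n s × Fin n => OqB.inner n s p.1 * OqB.z (n + 2) s 0 (inn p.2)) with hS
  have hm : ∀ x k, OqB.inner n s x * OqB.z (n + 2) s 0 (inn k) ∈ S := fun x k =>
    Submodule.subset_span ⟨(x, k), rfl⟩
  induction x using OqB.induction generalizing a with
  | hs c =>
    rw [AlgHom.commutes, ← Algebra.commutes, ← AlgHom.commutes (OqB.inner n s)]
    exact hm _ _
  | hz i b =>
    rw [OqB.inner_z, (OqB.isPoint _ _).row_zero_mul_inn]
    have hz : ∀ i k l, OqB.z (n + 2) s (inn i) (inn k) * OqB.z (n + 2) s 0 (inn l) ∈ S := by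
      intro i k l
      rw [← OqB.inner_z]; exact hm _ _
    refine S.sub_mem (S.add_mem (S.smul_mem _ (hz _ _ _)) ?_) (S.smul_mem _ ?_)
    · split_ifs
      · exact S.smul_mem _ (hz _ _ _)
      · exact S.zero_mem
    · refine S.sum_mem fun l _ => ?_
      split_ifs
      · exact S.smul_mem _ (hz _ _ _)
      · exact S.zero_mem
  | ha x y hx hy => rw [map_add, mul_add]; exact S.add_mem (hx a) (hy a)
  | hm x y hx hy =>
    rw [map_mul, ← mul_assoc, ← one_mul (_ * OqB.inner n s x)]
    refine mul_mul_mem_of_range (fun p => ?_) (hx a)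
    rw [one_mul, mul_assoc]
    refine mul_mem_of_range (fun p' => ?_) (hy p.2)
    rw [← mul_assoc, ← map_mul]
    exact hm _ _

/-- The linear combinations `∑ j(c_e) z₀^e` of ordered monomials in the first row. -/
abbrev OqB.rowSum (n : ℕ) (s : ℂˣ) : (Expo n →₀ OqB n s) →ₗ[ℂ] OqB (n + 2) s :=
  coeffSum (OqB.inner n s) fun e : Expo n => mono (OqB.z (n + 2) s 0) e.1

/-- The sums in question are stable under left multiplication by inner entries and by the first row
without its last entry. The entry `z_last,last` is inverse to `z_00`, and the remaining last column
entries become quadratic in the others after multiplication by `z_00`. Thus `exists_mul_pow_mem`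
applies. -/
lemma OqB.exists_rowSum (hN : IsOddRoot s N) (x : OqB (n + 2) s) :
    ∃ M : ℕ, x * OqB.z (n + 2) s 0 0 ^ M ∈ LinearMap.range (OqB.rowSum n s) := by
  have hz := OqB.isPoint (n + 2) s
  set z := OqB.z (n + 2) s with hzdef
  have hr := hz.rowRel_zero
  set P := LinearMap.range (OqB.rowSum n s) with hPdef
  have h0 : ∀ p ∈ P, z 0 0 * p ∈ P := fun p hp => by
    refine mul_mem_of_coeffSum (fun c e => ?_) hp
    rw [← mul_assoc, (OqB.commute_zero_inner c).eq, mul_assoc]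
    exact mul_mem_range_coeffSum _ (RowRel.zero_mul_mem (Submodule.subset_span ⟨e, rfl⟩))
  have hk : ∀ k, ∀ p ∈ P, z 0 (inn k) * p ∈ P := fun k p hp => by
    refine mul_mem_of_coeffSum (fun c e => ?_) hp
    rw [← mul_assoc, ← one_mul (z 0 (inn k) * _)]
    refine mul_mul_mem_of_range (fun q => ?_) (OqB.row_zero_mul_inner k c)
    rw [one_mul, mul_assoc]
    exact mul_mem_range_coeffSum _ (hr.inn_mul_mem hN _ (Submodule.subset_span ⟨e, rfl⟩))
  have hi : ∀ i k, ∀ p ∈ P, z (inn i) (inn k) * p ∈ P := fun i k p hp => by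
    refine mul_mem_of_coeffSum (fun c e => ?_) hp
    rw [← mul_assoc, hzdef, ← OqB.inner_z, ← map_mul]
    exact mul_mem_range_coeffSum _ (Submodule.subset_span ⟨e, rfl⟩)
  have h1 : ∀ (c : OqB n s) (e : Expo n), OqB.inner n s c * mono (z 0) e.1 * z 0 0 ∈ P := fun c e => by
    obtain ⟨d, hd⟩ := hr.mono_mul_zero e
    rw [mul_assoc, hd, mul_smul_comm]
    exact P.smul_mem _ (mul_mem_range_coeffSum _ (RowRel.zero_mul_mem (Submodule.subset_span ⟨e, rfl⟩)))
  -- The inverse of `z_00` commutes with the inner block because `z_00` does.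
  have hl : ∀ c, z (Fin.last _) (Fin.last _) * OqB.inner n s c =
      OqB.inner n s c * z (Fin.last _) (Fin.last _) := fun c => by
    calc _ = z (Fin.last _) (Fin.last _) * (OqB.inner n s c * z 0 0) * z (Fin.last _) (Fin.last _) := by
            rw [mul_assoc, mul_assoc, hz.zero_mul_last, mul_one]
      _ = _ := by rw [← (OqB.commute_zero_inner c).eq, ← mul_assoc, hz.last_mul_zero, one_mul]
  refine exists_mul_pow_mem (K' := z (Fin.last _) (Fin.last _)) hz.last_mul_zero ?_ ?_ ?_ ?_
  · refine ⟨Finsupp.single ⟨0, rfl⟩ 1, ?_⟩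
    rw [coeffSum_single]
    simp [mono]
  · intro p hp
    rw [← one_mul p]
    refine mul_mul_mem_of_coeffSum (fun c e => ?_) hp
    rw [one_mul]
    exact h1 c e
  · intro p hp
    refine mul_mul_mem_of_coeffSum (fun c e => ?_) hp
    obtain ⟨d, hd⟩ := hr.mono_mul_zero e
    rw [← mul_assoc, hl, mul_assoc, mul_assoc, hd, mul_smul_comm, mul_smul_comm, ← mul_assoc (z _ _),
      hz.last_mul_zero, one_mul]
    exact P.smul_mem _ (mul_mem_range_coeffSum _ (Submodule.subset_span ⟨e, rfl⟩))
  · set T := Algebra.adjoin ℂ (insert (z (Fin.last _) (Fin.last _)) {y | ∀ p ∈ P, y * p ∈ P}) with hT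
    have g0 : z 0 0 ∈ T := Algebra.subset_adjoin (Or.inr h0)
    have gk : ∀ k, z 0 (inn k) ∈ T := fun k => Algebra.subset_adjoin (Or.inr (hk k))
    have gi : ∀ i k, z (inn i) (inn k) ∈ T := fun i k => Algebra.subset_adjoin (Or.inr (hi i k))
    have gl : z (Fin.last _) (Fin.last _) ∈ T := Algebra.subset_adjoin (Or.inl rfl)
    have hdiv : ∀ y, y * z 0 0 ∈ T → y ∈ T := fun y hy => by
      have := T.mul_mem hy gl
      rwa [mul_assoc, hz.zero_mul_last, mul_one] at this
    induction x using OqB.induction with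
    | hs c => exact T.algebraMap_mem c
    | ha x y hx hy => exact T.add_mem hx hy
    | hm x y hx hy => exact T.mul_mem hx hy
    | hz i j =>
      rw [← hzdef]
      revert i j
      refine inn_cases ?_ ?_ (fun i => ?_) <;> refine inn_cases ?_ ?_ (fun j => ?_)
      · exact g0
      · apply hdiv
        obtain ⟨c, hc⟩ := hz.zero_last_mul_zero hN
        rw [hc]
        exact T.smul_mem (T.sum_mem fun l _ => T.smul_mem (T.mul_mem (gk _) (gk _)) _) _
      · exact gk j
      · rw [hz.tri _ _ (by simp)]; exact T.zero_mem
      · exact gl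
      · rw [hz.tri_last_inn]; exact T.zero_mem
      · rw [hz.tri_inn_zero]; exact T.zero_mem
      · apply hdiv
        rw [hz.inn_last_mul_zero]
        exact T.smul_mem (T.sum_mem fun l _ => T.smul_mem (T.mul_mem (gi _ _) (gk _)) _) _
      · exact gi i j

end Spanning

/-! ### Coactions and linear independence -/

section Untwist

variable {H D : Type*} [Ring H] [HopfAlgebra ℂ H] [Ring D] [Algebra ℂ D]

/-- The inverse of the map `a ⊗ d ↦ a₁ ⊗ f(a₂) d`. -/
def untwist (f : H →ₐ[ℂ] D) : H ⊗[ℂ] D →ₗ[ℂ] H ⊗[ℂ] D :=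
  (LinearMap.lTensor H (LinearMap.mul' ℂ D)) ∘ₗ (TensorProduct.assoc ℂ H D D).toLinearMap ∘ₗ
    LinearMap.rTensor D (LinearMap.lTensor H (f.toLinearMap ∘ₗ HopfAlgebra.antipode ℂ) ∘ₗ
      Coalgebra.comul)

/-- In Sweedler notation, `a₁ ⊗ f(S(a₂)) f(a₃) d = a ⊗ d` by coassociativity and the antipode axiom.
-/
lemma untwist_apply (f : H →ₐ[ℂ] D) (a : H) (d : D) :
    untwist f (Algebra.TensorProduct.map (AlgHom.id ℂ H) f (Coalgebra.comul a) * (1 ⊗ₜ d)) = a ⊗ₜ d := by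
  set g : H ⊗[ℂ] H →ₗ[ℂ] D := LinearMap.mulRight ℂ d ∘ₗ f.toLinearMap ∘ₗ LinearMap.mul' ℂ H ∘ₗ
    LinearMap.rTensor H (HopfAlgebra.antipode ℂ) with hg
  have h1 : ∀ t : H ⊗[ℂ] H, untwist f (Algebra.TensorProduct.map (AlgHom.id ℂ H) f t * (1 ⊗ₜ d)) =
      LinearMap.lTensor H g (TensorProduct.assoc ℂ H H H (LinearMap.rTensor H Coalgebra.comul t)) := by
    intro t
    induction t using TensorProduct.induction_on with
    | zero => simp
    | add x y hx hy => simp only [map_add, add_mul, hx, hy]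
    | tmul b c =>
      simp only [untwist, Algebra.TensorProduct.map_tmul, AlgHom.id_apply,
        Algebra.TensorProduct.tmul_mul_tmul, mul_one, LinearMap.comp_apply, LinearMap.rTensor_tmul,
        LinearEquiv.coe_coe]
      generalize Coalgebra.comul (R := ℂ) b = w
      induction w using TensorProduct.induction_on with
      | zero => simp
      | add x y hx hy => simp only [map_add, TensorProduct.add_tmul, hx, hy]
      | tmul x y => simp [hg, mul_assoc]
  have h2 : g ∘ₗ Coalgebra.comul = (LinearMap.toSpanSingleton ℂ D d) ∘ₗ Coalgebra.counit := by
    ext x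
    have := HopfAlgebra.mul_antipode_rTensor_comul_apply (R := ℂ) x
    simp only [hg, LinearMap.comp_apply, this, AlgHom.toLinearMap_apply, AlgHom.commutes]
    simp [Algebra.smul_def]
  rw [h1, Coalgebra.coassoc_apply, ← LinearMap.comp_apply, ← LinearMap.lTensor_comp, h2,
    LinearMap.lTensor_comp, LinearMap.comp_apply, Coalgebra.lTensor_counit_comul]
  simp

/-- An independent family is an injective linear map, and `H` is flat over `ℂ`. -/
lemma sum_tmul_injective {H D ι : Type*} [AddCommGroup H] [Module ℂ H] [AddCommGroup D] [Module ℂ D]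
    {w : ι → D} (hw : LinearIndependent ℂ w) {c : ι →₀ H} (h : (c.sum fun e a => a ⊗ₜ[ℂ] w e) = 0) :
    c = 0 := by
  classical
  have h1 : ∀ c : ι →₀ H, (c.sum fun e a => a ⊗ₜ[ℂ] w e) = LinearMap.lTensor H (Finsupp.linearCombination ℂ w)
      ((TensorProduct.finsuppScalarRight ℂ ℂ H ι).symm c) := by
    intro c
    induction c using Finsupp.induction_linear with
    | zero => simp
    | add a b ha' hb' =>
      rw [Finsupp.sum_add_index' (by simp) (by simp [TensorProduct.add_tmul]), ha', hb', map_add, map_add]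
    | single e a =>
      rw [Finsupp.sum_single_index (by simp), TensorProduct.finsuppScalarRight_symm_apply_single]
      simp
  rw [h1] at h
  have h2 := Module.Flat.lTensor_preserves_injective_linearMap (M := H) _ hw
  have h3 := h2 (h.trans (map_zero _).symm)
  simpa using h3

end Untwist

/-! ### The coaction, its injectivity and a faithful Frobenius point -/

section Coaction

variable {n N : ℕ} {s : ℂˣ} {D : Type*} [Ring D] [Algebra ℂ D]

open Algebra.TensorProduct

/-- The homomorphism `O_q(B⁺_{n+2}) → O_q(B⁺_n) ⊗ D` given by the product of `diag(1, z, 1)` with a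
point `v` over `D`. -/
def OqB.coact (v : Matrix (Fin (n + 2)) (Fin (n + 2)) D) (hv : IsPoint s v) :
    OqB (n + 2) s →ₐ[ℂ] OqB n s ⊗[ℂ] D :=
  OqB.lift ((bd (OqB.z n s)).map (includeLeft : OqB n s →ₐ[ℂ] OqB n s ⊗[ℂ] D) *
      v.map (includeRight : D →ₐ[ℂ] OqB n s ⊗[ℂ] D))
    (((OqB.isPoint n s).bd.map _).mul (hv.map _) fun i j k l => by
      simp [Commute, SemiconjBy])

variable {v : Matrix (Fin (n + 2)) (Fin (n + 2)) D}

lemma OqB.coact_z_zero (hv : IsPoint s v) (k : Fin (n + 2)) :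
    OqB.coact v hv (OqB.z (n + 2) s 0 k) = 1 ⊗ₜ v 0 k := by
  rw [coact, lift_z, Matrix.mul_apply, sum_inn]
  simp

/-- An inner row of `diag(1, z, 1)` has no outer entries, so only the inner block of `v`
contributes, giving `x₁ ⊗ f(x₂)`. -/
lemma OqB.coact_inner (hv : IsPoint s v) (x : OqB n s) :
    OqB.coact v hv (OqB.inner n s x) = Algebra.TensorProduct.map (AlgHom.id ℂ (OqB n s))
      ((OqB.lift v hv).comp (OqB.inner n s)) (Coalgebra.comul x) := by
  have : (OqB.coact v hv).comp (OqB.inner n s) = (Algebra.TensorProduct.map (AlgHom.id ℂ (OqB n s))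
      ((OqB.lift v hv).comp (OqB.inner n s))).comp (Bialgebra.comulAlgHom ℂ (OqB n s)) := by
    apply OqB.algHom_ext
    intro i j
    simp only [AlgHom.comp_apply, inner_z, Bialgebra.comulAlgHom_apply, comul_z]
    rw [coact, lift_z, Matrix.mul_apply, sum_inn]
    simp
  exact congrArg (fun φ => φ x) this

lemma OqB.coact_mono_zero (hv : IsPoint s v) (e : Fin (n + 2) → ℕ) :
    OqB.coact v hv (mono (OqB.z (n + 2) s 0) e) = 1 ⊗ₜ mono (v 0) e := by
  have h1 := map_mono (OqB.coact v hv : OqB (n + 2) s →* OqB n s ⊗[ℂ] D) (OqB.z (n + 2) s 0) e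
  have h2 := map_mono ((includeRight : D →ₐ[ℂ] OqB n s ⊗[ℂ] D) : D →* OqB n s ⊗[ℂ] D) (v 0) e
  simp only [MonoidHom.coe_coe, coact_z_zero, includeRight_apply] at h1 h2
  rw [h1, h2]

/-- Untwisting turns the image of `∑ c_e r_e` into `∑ c_e ⊗ w_e`. -/
lemma OqB.eq_zero_of_coact_coeffSum {ι : Type*} (hv : IsPoint s v) {r : ι → OqB (n + 2) s} {w : ι → D}
    (hr : ∀ e, OqB.coact v hv (r e) = 1 ⊗ₜ w e) (hw : LinearIndependent ℂ w) {c : ι →₀ OqB n s}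
    (h : OqB.coact v hv (coeffSum (OqB.inner n s) r c) = 0) : c = 0 := by
  classical
  refine sum_tmul_injective hw ?_
  have key : ∀ c, untwist ((OqB.lift v hv).comp (OqB.inner n s))
      (OqB.coact v hv (coeffSum (OqB.inner n s) r c)) = c.sum fun e a => a ⊗ₜ[ℂ] w e := by
    intro c
    induction c using Finsupp.induction_linear with
    | zero => simp
    | add a b ha hb =>
      rw [map_add, map_add, map_add, ha, hb, Finsupp.sum_add_index'] <;> simp [TensorProduct.add_tmul]
    | single e a =>
      rw [coeffSum_single, map_mul, hr, coact_inner, untwist_apply,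
        Finsupp.sum_single_index (by simp)]
  rw [← key, h, map_zero]

/-- After multiplication by a power of `z_00` an element of the kernel is in normal form and
vanishes; `z_00` is invertible. -/
lemma OqB.coact_injective (hN : IsOddRoot s N) (hv : IsPoint s v)
    (hi : LinearIndependent ℂ fun e : Expo n => mono (v 0) e.1) :
    Function.Injective (OqB.coact v hv) := by
  rw [injective_iff_map_eq_zero]
  intro x hx
  obtain ⟨M, c, hc⟩ := OqB.exists_rowSum hN x
  have h0 : c = 0 := by
    refine eq_zero_of_coact_coeffSum hv (r := fun e : Expo n => mono (OqB.z (n + 2) s 0) e.1)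
      (fun e => coact_mono_zero hv e.1) hi ?_
    rw [hc, map_mul, hx, zero_mul]
  rw [h0, map_zero] at hc
  have h1 : OqB.z (n + 2) s 0 0 ^ M * OqB.z (n + 2) s (Fin.last _) (Fin.last _) ^ M = 1 := by
    have hz := OqB.isPoint (n + 2) s
    have : Commute (OqB.z (n + 2) s 0 0) (OqB.z (n + 2) s (Fin.last _) (Fin.last _)) :=
      hz.zero_mul_last.trans hz.last_mul_zero.symm
    rw [← this.mul_pow, hz.zero_mul_last, one_pow]
  rw [← mul_one x, ← h1, ← mul_assoc, ← hc, zero_mul]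

lemma mono_smul_pow {m : ℕ} (d : Fin m → ℂ) (x : Fin m → D) (N : ℕ) (e : Fin m → ℕ) :
    mono (fun k => d k • x k ^ N) e = (∏ k, d k ^ e k) • mono x (fun k => N * e k) := by
  induction m with
  | zero => simp [mono_zero]
  | succ m ih =>
    have := ih (fun k => d k.succ) (fun k => x k.succ) (fun k => e k.succ)
    simp only [mono] at this ⊢
    rw [List.ofFn_succ, List.ofFn_succ, List.prod_cons, List.prod_cons, this, Fin.prod_univ_succ,
      smul_pow, ← pow_mul, smul_mul_smul_comm]

/-- Independence, over the inner block, of the ordered monomials in the rescaled `N`-th powers of the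
entries of the first row. -/
lemma OqB.powSum_injective (hN : IsOddRoot s N) :
    Function.Injective (coeffSum (OqB.inner n s) fun e : Expo n =>
      mono (powMat N s (OqB.z (n + 2) s) 0) e.1) := by
  obtain ⟨D, _, _, v, hv, hU⟩ := rowIndep hN n
  have hs : ∀ k : Fin (n + 2), powScale N s 0 k ≠ 0 := fun k => by
    unfold powScale
    split_ifs
    · exact hN.gam_ne_zero
    · exact one_ne_zero
  have hd : ∀ e : Expo n, ∏ k, powScale N s 0 k ^ e.1 k ≠ 0 := fun e =>
    Finset.prod_ne_zero_iff.2 fun k _ => pow_ne_zero _ (hs k)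
  -- Monomials in the rescaled powers are nonzero multiples of monomials with exponents multiplied
  -- by `N`, a subfamily of an independent family.
  have hw := (hU.comp (fun e : Expo n => (⟨fun k => N * e.1 k, by simp [e.2]⟩ : Expo n)) (by
    intro e e' h
    ext k
    have := congrFun (congrArg Subtype.val h) k
    exact Nat.eq_of_mul_eq_mul_left (by have := hN.one_lt; omega) this)).units_smul
      fun e => Units.mk0 _ (hd e)
  rw [injective_iff_map_eq_zero]
  intro c hc
  refine eq_zero_of_coact_coeffSum hv.point (fun e => ?_) hw (by rw [hc, map_zero])
  have : powMat N s (OqB.z (n + 2) s) 0 = fun k => powScale N s 0 k • OqB.z (n + 2) s 0 k ^ N := rfl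
  rw [this, mono_smul_pow, map_smul, coact_mono_zero, ← TensorProduct.tmul_smul]
  rfl

lemma OqB.lift_injective_of_scalar {m : ℕ} {B : Type*} [Ring B] [Algebra ℂ B] [Nontrivial B]
    (h : ∀ i j, ∃ c : ℂ, OqB.z m s i j = algebraMap ℂ _ c) (φ : OqB m s →ₐ[ℂ] B) :
    Function.Injective φ := by
  have key : ∀ x : OqB m s, ∃ c : ℂ, x = algebraMap ℂ _ c := by
    intro x
    induction x using OqB.induction with
    | hs c => exact ⟨c, rfl⟩
    | hz i j => exact h i j
    | ha x y hx hy =>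
      obtain ⟨a, rfl⟩ := hx
      obtain ⟨b, rfl⟩ := hy
      exact ⟨a + b, by simp⟩
    | hm x y hx hy =>
      obtain ⟨a, rfl⟩ := hx
      obtain ⟨b, rfl⟩ := hy
      exact ⟨a * b, by simp⟩
  rw [injective_iff_map_eq_zero]
  intro x hx
  obtain ⟨c, rfl⟩ := key x
  rw [AlgHom.commutes, map_eq_zero] at hx
  rw [hx, map_zero]

lemma OqB.exists_scalar_of_lt_two {m : ℕ} (hm : m < 2) (i j : Fin m) :
    ∃ c : ℂ, OqB.z m s i j = algebraMap ℂ _ c := by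
  have hij : i = j := by ext; omega
  subst hij
  refine ⟨1, ?_⟩
  rw [(OqB.isPoint m s).mid i (by ext; rw [Fin.val_rev]; omega), map_one]

/-- The algebra `O_q(B⁺)` has a faithful representation by a Frobenius point. -/
lemma OqB.exists_frobPoint (hN : IsOddRoot s N) (m : ℕ) :
    ∃ (D : Type) (_ : Ring D) (_ : Algebra ℂ D) (z : Matrix (Fin m) (Fin m) D) (h : FrobPoint N s z),
      Function.Injective (OqB.lift z h.point) := by
  induction m using Nat.strong_induction_on with
  | _ m ih =>
    rcases lt_or_ge m 2 with hm | hm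
    · exact ⟨ℂ, inferInstance, inferInstance, 1, frobPoint_one hN,
        lift_injective_of_scalar (exists_scalar_of_lt_two hm) _⟩
    · obtain ⟨n, rfl⟩ := Nat.exists_eq_add_of_le' hm
      obtain ⟨D', _, _, z, hz, hinj⟩ := ih n (by omega)
      obtain ⟨D, _, _, v, hv, hU⟩ := rowIndep hN n
      refine ⟨D' ⊗[ℂ] D, inferInstance, inferInstance, _, FrobPoint.mul hN (hz.bd hN) hv
        (φ := includeLeft) (ψ := includeRight) (fun a b => by simp [Commute, SemiconjBy]), ?_⟩
      set Z := (bd z).map (includeLeft : D' →ₐ[ℂ] D' ⊗[ℂ] D) *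
        v.map (includeRight : D →ₐ[ℂ] D' ⊗[ℂ] D) with hZ
      -- The product point factors through the coaction followed by the faithful point of the
      -- smaller algebra, tensored with `D`.
      have e : ∀ h, OqB.lift Z h = (Algebra.TensorProduct.map (OqB.lift z hz.point)
          (AlgHom.id ℂ D)).comp (OqB.coact v hv.point) := by
        intro h
        apply OqB.algHom_ext
        intro i j
        rw [lift_z, AlgHom.comp_apply, coact, lift_z, hZ, Matrix.mul_apply, Matrix.mul_apply, map_sum]
        refine Finset.sum_congr rfl fun k _ => ?_
        have hb := bd_map (OqB.lift z hz.point) (map_zero _) (map_one _) (OqB.z n s)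
        have hb' : (OqB.z n s).map (OqB.lift z hz.point) = z := by ext; simp
        rw [hb'] at hb
        rw [← hb]
        simp
      rw [e, AlgHom.coe_comp]
      refine Function.Injective.comp ?_ (coact_injective hN hv.point hU)
      exact Module.Flat.rTensor_preserves_injective_linearMap (M := D)
        (OqB.lift z hz.point).toLinearMap hinj

end Coaction

/-! ### The quantum Frobenius map -/

section Frob

variable {n N : ℕ} {s : ℂˣ}

open Algebra.TensorProduct
open scoped IsMulCommutative

/-- The matrix of rescaled `N`-th powers of the generators. -/
abbrev OqB.y (N n : ℕ) (s : ℂˣ) : Matrix (Fin n) (Fin n) (OqB n s) := powMat N s (OqB.z n s)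

lemma OqB.y_apply (i j : Fin n) : OqB.y N n s i j = powScale N s i j • OqB.z n s i j ^ N := rfl

/-- The identity holds for the faithful Frobenius point, hence in the algebra. -/
lemma OqB.commute_y (hN : IsOddRoot s N) (i j k l : Fin n) :
    Commute (OqB.y N n s i j) (OqB.y N n s k l) := by
  obtain ⟨D, _, _, z, hz, hinj⟩ := OqB.exists_frobPoint hN n
  apply hinj
  have hm : powMat N s z = (OqB.y N n s).map (OqB.lift z hz.point) := by
    rw [← powMat_map]; congr 1; ext; simp
  have := (hz.comm i j k l).eq
  rw [hm] at this
  simpa using this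

/-- Two commuting copies of the faithful point in `D ⊗ D` multiply to the image of the
comultiplication; the tensor square of an injective map over `ℂ` is injective. -/
lemma OqB.comul_y (hN : IsOddRoot s N) (i j : Fin n) :
    Coalgebra.comul (R := ℂ) (OqB.y N n s i j) = ∑ k, OqB.y N n s i k ⊗ₜ[ℂ] OqB.y N n s k j := by
  obtain ⟨D, _, _, z, hz, hinj⟩ := OqB.exists_frobPoint hN n
  set Φ := OqB.lift z hz.point with hΦ
  have hi : Function.Injective (Algebra.TensorProduct.map Φ Φ) :=
    TensorProduct.map_injective_of_flat_flat Φ.toLinearMap Φ.toLinearMap hinj hinj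
  apply hi
  have hm : powMat N s z = (OqB.y N n s).map Φ := by
    rw [← powMat_map]; congr 1; ext; simp [hΦ]
  have h1 := congrFun (congrFun (FrobPoint.powMat_mul hN hz hz
    (φ := (includeLeft : D →ₐ[ℂ] D ⊗[ℂ] D)) (ψ := includeRight)
    (fun a b => by simp [Commute, SemiconjBy])) i) j
  have h2 : z.map (includeLeft : D →ₐ[ℂ] D ⊗[ℂ] D) * z.map (includeRight : D →ₐ[ℂ] D ⊗[ℂ] D) =
      (OqB.z n s).map ((Algebra.TensorProduct.map Φ Φ).comp (Bialgebra.comulAlgHom ℂ (OqB n s))) := by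
    ext a b
    simp [Matrix.mul_apply, hΦ]
  rw [h2, powMat_map, powMat_map, powMat_map, hm, Matrix.mul_apply] at h1
  simpa using h1

lemma OqB.counit_y (hN : IsOddRoot s N) (i j : Fin n) :
    Coalgebra.counit (R := ℂ) (OqB.y N n s i j) = if i = j then 1 else 0 := by
  have h0 : N ≠ 0 := by have := hN.one_lt; omega
  rw [OqB.y_apply, map_smul, Bialgebra.counit_pow, OqB.counit_z]
  split_ifs with h
  · subst h; simp [powScale_self]
  · simp [h0]

lemma OqB.antipode_y (hN : IsOddRoot s N) (i j : Fin n) :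
    HopfAlgebra.antipode ℂ (OqB.y N n s i j) = OqB.y N n s j.rev i.rev := by
  have h : ∀ x : OqB n s, HopfAlgebra.antipode ℂ (x ^ N) = HopfAlgebra.antipode ℂ x ^ N := by
    intro x
    have := map_pow (HopfAlgebra.antipodeAlgHomOp ℂ (OqB n s)) x N
    apply MulOpposite.op_injective
    simpa using this
  rw [OqB.y_apply, map_smul, h, OqB.antipode_z, smul_pow, hN.zpow_pow, one_smul, OqB.y_apply,
    powScale_rev]

/-- This is the antipode axiom for `y_ij`, since comultiplication and antipode have the classical
form on the rescaled powers. -/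
lemma OqB.orth_y (hN : IsOddRoot s N) (i j : Fin n) :
    ∑ k : Fin n, OqB.y N n s k j * OqB.y N n s k.rev i.rev = if i = j then 1 else 0 := by
  have h := HopfAlgebra.mul_antipode_rTensor_comul_apply (R := ℂ) (OqB.y N n s i j)
  rw [OqB.comul_y hN, OqB.counit_y hN] at h
  simp only [map_sum, LinearMap.rTensor_tmul, LinearMap.mul'_apply, OqB.antipode_y hN,
    apply_ite (algebraMap ℂ (OqB n s)), map_one, map_zero] at h
  rw [← h]
  exact Finset.sum_congr rfl fun k _ => (OqB.commute_y hN _ _ _ _).eq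

lemma OB.IsPoint.of_orth {A : Type*} [CommRing A] {x : Matrix (Fin n) (Fin n) A}
    (orth : ∀ i j, ∑ k, x k j * x k.rev i.rev = if i = j then 1 else 0)
    (tri : ∀ i j, j < i → x i j = 0) (mid : ∀ i : Fin n, i.rev = i → x i i = 1) : OB.IsPoint x where
  orth := orth
  tri := tri
  det := by
    rw [Matrix.det_of_isUpperTriangular fun i j hij => tri i j hij]
    -- The diagonal entries at `i` and `i'` multiply to `1` by orthogonality and triangularity; a
    -- middle one is `1` by hypothesis.
    refine Finset.prod_involution (fun i _ => i.rev) (fun i _ => ?_) (fun i _ h1 h2 => h1 (mid i h2))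
      (fun i _ => Finset.mem_univ _) (fun i _ => Fin.rev_rev i)
    have h := orth i i
    rw [Finset.sum_eq_single i] at h
    · simpa using h
    · intro k _ hk
      rcases lt_or_gt_of_ne hk with h | h
      · rw [tri k.rev i.rev (Fin.rev_lt_rev.2 h), mul_zero]
      · rw [tri k i h, zero_mul]
    · simp

/-- The commutative subalgebra generated by the rescaled `N`-th powers. -/
abbrev OqB.powAlg (N n : ℕ) (s : ℂˣ) : Subalgebra ℂ (OqB n s) :=
  Algebra.adjoin ℂ (Set.range fun p : Fin n × Fin n => OqB.y N n s p.1 p.2)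

lemma OqB.isMulCommutative_powAlg (hN : IsOddRoot s N) : IsMulCommutative (OqB.powAlg N n s) := by
  refine Algebra.isMulCommutative_adjoin ℂ ?_
  rintro _ ⟨p, rfl⟩ _ ⟨r, rfl⟩
  exact (OqB.commute_y hN _ _ _ _).eq

/-- The generators of the commutative subalgebra of rescaled `N`-th powers. -/
def OqB.powGen (N n : ℕ) (s : ℂˣ) : Matrix (Fin n) (Fin n) (OqB.powAlg N n s) :=
  Matrix.of fun i j => ⟨OqB.y N n s i j, Algebra.subset_adjoin ⟨(i, j), rfl⟩⟩

/-- The homomorphism `O(B⁺) → O_q(B⁺)` given by the rescaled `N`-th powers. -/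
def OB.frobAlgHom (hN : IsOddRoot s N) (n : ℕ) : OB n →ₐ[ℂ] OqB n s :=
  -- The universal property of `OB` is stated for commutative targets, so the map is first built
  -- into the subalgebra of rescaled powers.
  haveI := OqB.isMulCommutative_powAlg (n := n) hN
  (OqB.powAlg N n s).val.comp (OB.lift (OqB.powGen N n s) (OB.IsPoint.of_orth
    (fun i j => by
      apply Subtype.ext
      have := OqB.orth_y hN i j
      rw [apply_ite Subtype.val]
      simpa [OqB.powGen] using this)
    (fun i j hij => by
      apply Subtype.ext
      have h0 : N ≠ 0 := by have := hN.one_lt; omega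
      simp [OqB.powGen, OqB.y_apply, (OqB.isPoint n s).tri i j hij, h0])
    (fun i hi => by
      apply Subtype.ext
      simp [OqB.powGen, OqB.y_apply, (OqB.isPoint n s).mid i hi, powScale_self])))

@[simp] lemma OB.frobAlgHom_X (hN : IsOddRoot s N) (i j : Fin n) :
    OB.frobAlgHom hN n (OB.X n i j) = OqB.y N n s i j := by
  have := OqB.isMulCommutative_powAlg (n := n) hN
  simp [frobAlgHom, OqB.powGen]

lemma OB.hom_ext {A : Type*} [Ring A] [Algebra ℂ A] {f g : OB n →ₐ[ℂ] A}
    (h : ∀ i j, f (OB.X n i j) = g (OB.X n i j)) : f = g := by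
  apply Ideal.Quotient.algHom_ext
  apply MvPolynomial.algHom_ext
  intro p
  exact h p.1 p.2

/-- The quantum Frobenius map, as a homomorphism of bialgebras. -/
def OB.frob (hN : IsOddRoot s N) (n : ℕ) : OB n →ₐc[ℂ] OqB n s :=
  BialgHom.ofAlgHom (OB.frobAlgHom hN n)
    (OB.hom_ext fun i j => by
      simp only [AlgHom.comp_apply, OB.frobAlgHom_X, Bialgebra.counitAlgHom_apply, OqB.counit_y hN,
        OB.counit_X])
    (OB.hom_ext fun i j => by
      simp only [AlgHom.comp_apply, OB.frobAlgHom_X, Bialgebra.comulAlgHom_apply, OqB.comul_y hN,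
        OB.comul_X, map_sum, Algebra.TensorProduct.map_tmul])

lemma OB.frob_apply (hN : IsOddRoot s N) (x : OB n) : OB.frob hN n x = OB.frobAlgHom hN n x := rfl

lemma OB.frob_antipode (hN : IsOddRoot s N) (x : OB n) :
    OB.frob hN n (HopfAlgebra.antipode ℂ x) = HopfAlgebra.antipode ℂ (OB.frob hN n x) := by
  have : (AlgHom.op (OB.frobAlgHom hN n)).comp (HopfAlgebra.antipodeAlgHomOp ℂ (OB n)) =
      (HopfAlgebra.antipodeAlgHomOp ℂ (OqB n s)).comp (OB.frobAlgHom hN n) := by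
    apply OB.hom_ext
    intro i j
    simp [OB.antipode_X, OqB.antipode_y hN]
  apply MulOpposite.op_injective
  simpa [OB.frob_apply] using congrArg (fun φ => φ x) this

end Frob

/-! ### Injectivity of the quantum Frobenius map -/

section Classical

variable {n N : ℕ} {s : ℂˣ} {A : Type*} [CommRing A] {x : Matrix (Fin (n + 2)) (Fin (n + 2)) A}

namespace OB

lemma IsPoint.inn_zero (h : IsPoint x) (i : Fin n) : x (inn i) 0 = 0 := h.tri _ _ (zero_lt_inn i)

lemma IsPoint.last_inn (h : IsPoint x) (i : Fin n) : x (Fin.last _) (inn i) = 0 :=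
  h.tri _ _ (inn_lt_last i)

lemma IsPoint.last_zero (h : IsPoint x) : x (Fin.last _) 0 = 0 := h.tri _ _ (by simp)

lemma IsPoint.sum_row (h : IsPoint x) (i j : Fin (n + 2)) :
    ∑ k, x i k * x j k.rev = if i = j.rev then 1 else 0 := by
  have := congrFun (congrFun h.mul_inv i) j.rev
  rw [Matrix.mul_apply, Matrix.one_apply] at this
  rw [← this]
  simp [invMat]

lemma IsPoint.zero_mul_last (h : IsPoint x) : x 0 0 * x (Fin.last _) (Fin.last _) = 1 := by
  have := h.sum_row 0 (Fin.last _)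
  rw [sum_inn] at this
  simpa [h.last_inn, h.last_zero] using this

lemma IsPoint.zero_last_mul_zero (h : IsPoint x) :
    2 * (x 0 (Fin.last _) * x 0 0) = -∑ k, x 0 (inn k) * x 0 (inn k.rev) := by
  have := h.sum_row 0 0
  rw [sum_inn] at this
  simp at this
  linear_combination this

lemma IsPoint.inn_last_mul_zero (h : IsPoint x) (i : Fin n) :
    x (inn i) (Fin.last _) * x 0 0 = -∑ k, x (inn i) (inn k) * x 0 (inn k.rev) := by
  have := h.sum_row (inn i) 0
  rw [sum_inn] at this
  simp [h.inn_zero] at this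
  linear_combination this

lemma IsPoint.innerBlock (h : IsPoint x) : IsPoint (innerBlock x) where
  orth i j := by
    have := h.orth (inn i) (inn j)
    rw [sum_inn] at this
    simpa [h.last_inn, h.inn_zero] using this
  det := by
    have h1 := h.det
    rw [Matrix.det_of_isUpperTriangular fun i j hij => h.tri i j hij, Fin.prod_univ_succ,
      Fin.prod_univ_castSucc] at h1
    have h3 : (QSO.innerBlock x).IsUpperTriangular := fun i j hij => h.tri _ _ (inn_lt_inn.2 hij)
    rw [Matrix.det_of_isUpperTriangular h3]
    have h2 := h.zero_mul_last
    rw [Fin.succ_last, mul_left_comm, h2, mul_one] at h1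
    exact h1
  tri i j hij := h.tri _ _ (inn_lt_inn.2 hij)

lemma mul_mono {m : ℕ} (y : Fin m → A) (k : Fin m) (e : Fin m → ℕ) :
    y k * mono y e = mono y (e + Pi.single k 1) := by
  simp only [mono, List.prod_ofFn, Pi.add_apply, pow_add, Finset.prod_mul_distrib]
  rw [mul_comm]
  congr 1
  simp [Pi.single_apply]

/-- The map `O(B⁺_n) → O(B⁺_{n+2})` onto the inner block. -/
def inner (n : ℕ) : OB n →ₐ[ℂ] OB (n + 2) := lift (QSO.innerBlock (X (n + 2))) (isPoint _).innerBlock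

@[simp] lemma inner_X (i k : Fin n) : inner n (X n i k) = X (n + 2) (inn i) (inn k) := by
  simp [inner]

lemma induction {P : OB n → Prop} (hs : ∀ c, P (algebraMap ℂ _ c))
    (hz : ∀ i j, P (X n i j)) (ha : ∀ x y, P x → P y → P (x + y))
    (hm : ∀ x y, P x → P y → P (x * y)) (x : OB n) : P x := by
  obtain ⟨y, rfl⟩ := Ideal.Quotient.mkₐ_surjective ℂ (Ideal.span (classicalRel n)) x
  induction y using MvPolynomial.induction_on with
  | C a => exact hs a
  | add p q hp hq => rw [map_add]; exact ha _ _ hp hq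
  | mul_X p i hp => rw [map_mul]; exact hm _ _ hp (hz i.1 i.2)

/-- The commutative analogue of `OqB.exists_rowSum`, with the same treatment of the last column.
Only spanning is needed on the classical side. -/
lemma exists_rowSum (f : OB (n + 2)) : ∃ M : ℕ, f * X (n + 2) 0 0 ^ M ∈
    LinearMap.range (coeffSum (inner n) fun e : Expo n => mono (X (n + 2) 0) e.1) := by
  have hx := isPoint (n + 2)
  set x := X (n + 2) with hxdef
  set P := LinearMap.range (coeffSum (inner n) fun e : Expo n => mono (x 0) e.1) with hP
  have h0 : ∀ k, k ≠ Fin.last (n + 1) → ∀ p ∈ P, x 0 k * p ∈ P := fun k hk p hp => by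
    refine mul_mem_of_coeffSum (fun c e => ?_) hp
    rw [mul_left_comm, mul_mono]
    exact mul_mem_range_coeffSum _ (Submodule.subset_span ⟨⟨e.1 + Pi.single k 1, by
      simp [e.2, hk.symm]⟩, rfl⟩)
  have hi : ∀ i k, ∀ p ∈ P, x (inn i) (inn k) * p ∈ P := fun i k p hp => by
    refine mul_mem_of_coeffSum (fun c e => ?_) hp
    rw [← mul_assoc, hxdef, ← inner_X, ← map_mul]
    exact mul_mem_range_coeffSum _ (Submodule.subset_span ⟨e, rfl⟩)
  have hl : x (Fin.last _) (Fin.last _) * x 0 0 = 1 := by rw [mul_comm, hx.zero_mul_last]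
  refine exists_mul_pow_mem (K' := x (Fin.last _) (Fin.last _)) hl ?_ ?_ ?_ ?_
  · refine ⟨Finsupp.single ⟨0, rfl⟩ 1, ?_⟩
    rw [coeffSum_single]
    simp [mono]
  · intro p hp
    rw [mul_comm]
    exact h0 0 (by simp) p hp
  · intro p hp
    rw [mul_right_comm, hl, one_mul]
    exact hp
  · set T := Algebra.adjoin ℂ (insert (x (Fin.last _) (Fin.last _)) {y | ∀ p ∈ P, y * p ∈ P}) with hT
    have gk : ∀ k, k ≠ Fin.last (n + 1) → x 0 k ∈ T := fun k hk =>
      Algebra.subset_adjoin (Or.inr (h0 k hk))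
    have gi : ∀ i k, x (inn i) (inn k) ∈ T := fun i k => Algebra.subset_adjoin (Or.inr (hi i k))
    have gl : x (Fin.last _) (Fin.last _) ∈ T := Algebra.subset_adjoin (Or.inl rfl)
    have hdiv : ∀ y, y * x 0 0 ∈ T → y ∈ T := fun y hy => by
      have := T.mul_mem hy gl
      rwa [mul_assoc, hx.zero_mul_last, mul_one] at this
    induction f using OB.induction with
    | hs c => exact T.algebraMap_mem c
    | ha x y hx hy => exact T.add_mem hx hy
    | hm x y hx hy => exact T.mul_mem hx hy
    | hz i j =>
      rw [← hxdef]
      revert i j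
      refine inn_cases ?_ ?_ (fun i => ?_) <;> refine inn_cases ?_ ?_ (fun j => ?_)
      · exact gk _ (by simp)
      · apply hdiv
        have h2 : x 0 (Fin.last _) * x 0 0 =
            (2⁻¹ : ℂ) • (-∑ k, x 0 (inn k) * x 0 (inn k.rev)) := by
          rw [eq_inv_smul_iff₀ two_ne_zero, ← hx.zero_last_mul_zero, two_smul, two_mul]
        rw [h2]
        exact T.smul_mem (T.neg_mem (T.sum_mem fun l _ => T.mul_mem (gk _ (by simp)) (gk _ (by simp)))) _
      · exact gk _ (by simp)
      · rw [hx.last_zero]; exact T.zero_mem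
      · exact gl
      · rw [hx.last_inn]; exact T.zero_mem
      · rw [hx.inn_zero]; exact T.zero_mem
      · apply hdiv
        rw [hx.inn_last_mul_zero]
        exact T.neg_mem (T.sum_mem fun l _ => T.mul_mem (gi _ _) (gk _ (by simp)))
      · exact gi i j

lemma exists_scalar_of_lt_two {m : ℕ} (hm : m < 2) (f : OB m) : ∃ c : ℂ, f = algebraMap ℂ _ c := by
  induction f using OB.induction with
  | hs c => exact ⟨c, rfl⟩
  | hz i j =>
    have hij : i = j := by ext; omega
    subst hij
    refine ⟨1, ?_⟩
    have h1 := (isPoint m).det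
    rw [Matrix.det_of_isUpperTriangular fun i j hij => (isPoint m).tri i j hij,
      Finset.prod_eq_single i (fun b _ hb => (hb (by ext; omega)).elim) (by simp)] at h1
    rw [h1, map_one]
  | ha x y hx hy =>
    obtain ⟨a, rfl⟩ := hx
    obtain ⟨b, rfl⟩ := hy
    exact ⟨a + b, by simp⟩
  | hm x y hx hy =>
    obtain ⟨a, rfl⟩ := hx
    obtain ⟨b, rfl⟩ := hy
    exact ⟨a * b, by simp⟩

lemma frobAlgHom_inner (hN : IsOddRoot s N) (f : OB n) :
    frobAlgHom hN (n + 2) (inner n f) = OqB.inner n s (frobAlgHom hN n f) := by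
  have : (frobAlgHom hN (n + 2)).comp (inner n) = (OqB.inner n s).comp (frobAlgHom hN n) := by
    apply hom_ext
    intro i j
    simp [OqB.y_apply]
  exact congrArg (fun φ => φ f) this

lemma frobAlgHom_coeffSum (hN : IsOddRoot s N) (c : Expo n →₀ OB n) :
    frobAlgHom hN (n + 2) (coeffSum (inner n) (fun e => mono (X (n + 2) 0) e.1) c) =
      coeffSum (OqB.inner n s) (fun e => mono (OqB.y N (n + 2) s 0) e.1)
        (c.mapRange (frobAlgHom hN n) (map_zero _)) := by
  induction c using Finsupp.induction_linear with
  | zero => simp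
  | add a b ha hb =>
    rw [map_add, map_add, ha, hb, Finsupp.mapRange_add (map_add _), map_add]
  | single e a =>
    have h1 := map_mono (frobAlgHom hN (n + 2) : OB (n + 2) →* OqB (n + 2) s) (X (n + 2) 0) e.1
    simp only [MonoidHom.coe_coe, frobAlgHom_X] at h1
    rw [Finsupp.mapRange_single, coeffSum_single, coeffSum_single, map_mul, h1, frobAlgHom_inner]

/-- If `f` is in the kernel, a multiple of it by a power of the invertible `X_00` is a sum of first
row monomials over the inner block. Independence of the quantum images kills the images of the
coefficients, and induction kills the coefficients. -/
lemma frobAlgHom_injective (hN : IsOddRoot s N) (m : ℕ) :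
    Function.Injective (frobAlgHom hN m) := by
  induction m using Nat.strong_induction_on with
  | _ m ih =>
    rw [injective_iff_map_eq_zero]
    intro f hf
    rcases lt_or_ge m 2 with hm | hm
    · obtain ⟨c, rfl⟩ := exists_scalar_of_lt_two hm f
      -- The counit detects scalars, so no separate proof that `OqB` is nontrivial is needed.
      have h1 := congrArg (Coalgebra.counit (R := ℂ)) hf
      rw [AlgHom.commutes, Bialgebra.counit_algebraMap, map_zero] at h1
      rw [h1, map_zero]
    · obtain ⟨n, rfl⟩ := Nat.exists_eq_add_of_le' hm
      obtain ⟨M, c, hc⟩ := exists_rowSum f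
      have h1 : c.mapRange (frobAlgHom hN n) (map_zero _) = 0 := by
        apply OqB.powSum_injective hN
        rw [map_zero, ← frobAlgHom_coeffSum, hc, map_mul, hf, zero_mul]
      have h2 : c = 0 := by
        ext e
        apply ih n (by omega)
        have := DFunLike.congr_fun h1 e
        simpa using this
      rw [h2, map_zero] at hc
      have h3 : X (n + 2) 0 0 ^ M * X (n + 2) (Fin.last _) (Fin.last _) ^ M = 1 := by
        rw [← mul_pow, (isPoint (n + 2)).zero_mul_last, one_pow]
      rw [← mul_one f, ← h3, ← mul_assoc, ← hc, zero_mul]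

end OB

end Classical

end QSO

end

theorem mainTheorem9 (n N : ℕ) (hodd : Odd N) (h3 : Nat.Coprime 3 N) (h7 : 7 < N)
    (q : ℂ) (hq : IsPrimitiveRoot q N)
    (s : ℂˣ) (hs : (s : ℂ) ^ 2 = q) (hsN : (s : ℂ) ^ N = 1) :
    ∃ ι : QSO.OB n →ₐc[ℂ] QSO.OqB n s,
      (∀ i j : Fin n, i ≤ j →
        ι (QSO.OB.X n i j) =
          if ∃ k : Fin n, k.rev = k ∧ i < k ∧ k < j then
            ((1 + q) ^ N / 2 : ℂ) • QSO.OqB.z n s i j ^ N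
          else QSO.OqB.z n s i j ^ N) ∧
      (∀ x : QSO.OB n, ι (HopfAlgebra.antipode ℂ x) = HopfAlgebra.antipode ℂ (ι x)) ∧
      Function.Injective ι := by
  subst hs
  have hN : QSO.IsOddRoot s N := ⟨hodd, by omega, hq, hsN⟩
  refine ⟨QSO.OB.frob hN n, fun i j _ => ?_, QSO.OB.frob_antipode hN, QSO.OB.frobAlgHom_injective hN n⟩
  rw [QSO.OB.frob_apply, QSO.OB.frobAlgHom_X, QSO.OqB.y_apply, QSO.powScale, QSO.gam]
  split_ifs
  · rfl
  · rw [one_smul]
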